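/- Let $X$ be a compact complex manifold of dimension $n$ with a Kähler form $\omega$, let $D\subset X$ be a smooth divisor, let $s$ be a defining section of $D$ in the associated holomorphic line bundle $L_D$ (so $D=\{s=0\}$ and $s$ vanishes to first order along $D$), and let $h$ be a smooth Hermitian metric on $L_D$ with curvature form $\theta=-\sqrt{-1}\partial\bar\partial\log h$. Let $\eta$ be a smooth closed real $(1,1)$-form, $\gamma\in(0,1)$, and $0<T<T^\eta_{\gamma,\max}$, where $$T^\eta_{\gamma,\max}=\sup\{t\ge 0 : [\omega]+t(-c_1(X)+(1-\gamma)c_1(L_D)+[\eta])>0\}$$ (positivity of a class means that it contains a Kähler form; $c_1(X)=[\mathrm{Ric}(\omega)]$ and $c_1(L_D)=[\theta]$). Let $\Omega_\gamma=e^{-h_\gamma}\omega^n$, $h_\gamma\in C^\infty(X,\mathbb R)$, be a smooth volume form such that, with $\nu_\gamma=-\mathrm{Ric}(\Omega_\gamma)+(1-\gamma)\theta+\eta$, $$\omega_{\gamma t}:=\omega+t\,\nu_\gamma>0\qquad\text{for all } t\in[0,T].$$ For $\varepsilon\in(0,1)$ and $k>0$ put $$\chi_{\gamma\varepsilon}=\frac1\gamma\int_0^{|s|_h^2}\frac{(\varepsilon^2+r)^\gamma-\varepsilon^{2\gamma}}{r}\,dr,\qquad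 \omega_{\gamma\varepsilon}=\omega+k\sqrt{-1}\partial\bar\partial\chi_{\gamma\varepsilon}.$$ **Proposition.** There is $k_0>0$ such that for every fixed $k\in(0,k_0]$ all the forms $\omega_{\gamma\varepsilon}$, $\varepsilon\in(0,1)$, are positive and the following holds. For every $M\in\mathbb R$ there is a constant $C_1$, and for all $0<t_0<T'<T$ there is a constant $C_2$ (depending in addition on $t_0$ and $T'$), such that the following is true. Let $\varphi_0$ be an $\omega$-psh function with zero Lelong number at every point and $\sup_X\varphi_0=M$, let $(\varphi_j)$ be a sequence of smooth strictly $\omega$-psh functions decreasing pointwise to $\varphi_0$, let $\varepsilon\in(0,1)$, and let $\varphi_{\gamma\varepsilon j}$ be a smooth solution on $[0,T]\times X$, with $\omega_{\gamma\varepsilon j}(t):=\omega_{\gamma t}+\sqrt{-1}\partial\bar\partial\varphi_{\gamma\varepsilon j}(t)>0$, of $$\frac{\partial\varphi_{\gamma\varepsilon j}}{\partial t}=\log\frac{(\omega_{\gamma t}+\sqrt{-1}\partial\bar\partial\varphi_{\gamma\varepsilon j})^n}{\omega^n}+h_\gamma+(1-\gamma)\log(\varepsilon^2+|s|_h^2),\qquad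 \varphi_{\gamma\varepsilon j}(0)=\varphi_j .$$ Put $\phi_{\gamma\varepsilon j}=\varphi_{\gamma\varepsilon j}-k\chi_{\gamma\varepsilon}$. Then $$(t-t_0)\log\mathrm{tr}_{\omega_{\gamma\varepsilon}}\omega_{\gamma\varepsilon j}(t)\le C_1\,\operatorname{osc}_X\phi_{\gamma\varepsilon j}(t_0)+C_2\qquad\text{on } X$$ for all $t\in(t_0,T']$. In particular $C_1$ and $C_2$ do not depend on $j$ and $\varepsilon$, and $C_1$ does not depend on $t_0$ and $T'$. -/

import Mathlib

open scoped Manifold ContDiff ComplexOrder Topology NNReal ENNReal Matrix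

noncomputable section

namespace ConicalKRF

/-- The model space `ℂⁿ`. -/
abbrev Cn (n : ℕ) : Type := EuclideanSpace ℂ (Fin n)

/-- The `i`-th standard basis vector of `ℂⁿ`. -/
def stdVec {n : ℕ} (i : Fin n) : Cn n := EuclideanSpace.single i (1 : ℂ)

/-- The Wirtinger derivative `∂f/∂z_i`. -/
def dz {n : ℕ} (i : Fin n) (f : Cn n → ℂ) (z : Cn n) : ℂ :=
  (1 / 2 : ℂ) * (fderiv ℝ f z (stdVec i) - Complex.I * fderiv ℝ f z (Complex.I • stdVec i))

/-- The Wirtinger derivative `∂f/∂z̄_i`. -/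
def dzbar {n : ℕ} (i : Fin n) (f : Cn n → ℂ) (z : Cn n) : ℂ :=
  (1 / 2 : ℂ) * (fderiv ℝ f z (stdVec i) + Complex.I * fderiv ℝ f z (Complex.I • stdVec i))

/-- The complex Hessian `(∂²u/∂z_i∂z̄_j)` of a real function. -/
def complexHessian {n : ℕ} (u : Cn n → ℝ) (z : Cn n) : Matrix (Fin n) (Fin n) ℂ :=
  Matrix.of fun i j => dz i (fun w => dzbar j (fun v => (u v : ℂ)) w) z

/-- Coefficients `α_{ij̄}`, in each chart `c` at each point `z` of the target of `c`, of a
`(1,1)`-form `√-1 ∑ α_{ij̄} dz_i ∧ dz̄_j` on `X`. Only charts of the atlas and points of their targets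
are ever used. -/
abbrev Coeff (n : ℕ) (X : Type*) [TopologicalSpace X] : Type _ :=
  OpenPartialHomeomorph X (Cn n) → Cn n → Matrix (Fin n) (Fin n) ℂ

section Forms

variable {n : ℕ} {X : Type*} [TopologicalSpace X]

/-- The holomorphic Jacobian matrix `∂w_a/∂z_i` of the change of charts `w = c'(c⁻¹(z))`. -/
def jac (c c' : OpenPartialHomeomorph X (Cn n)) (z : Cn n) : Matrix (Fin n) (Fin n) ℂ :=
  Matrix.of fun a i => (fderiv ℂ (fun y : Cn n => c' (c.symm y)) z (stdVec i)) a

/-- `√-1∂∂̄f` of a real function `f` on `X`. -/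
def ddbar (f : X → ℝ) : Coeff n X :=
  fun c z => complexHessian (fun w => f (c.symm w)) z

/-- The Ricci form `-√-1∂∂̄ log (e^{-h} det ω₀)` of the volume form `e^{-h} ω₀ⁿ`. -/
def ricciOfVolume (ω₀ : Coeff n X) (h : X → ℝ) : Coeff n X :=
  fun c z => -complexHessian (fun w => Real.log (Real.exp (-h (c.symm w)) * (ω₀ c w).det.re)) z

/-- The Ricci form `-√-1∂∂̄ log det ω₀` of a Kähler form. -/
def ricci (ω₀ : Coeff n X) : Coeff n X := ricciOfVolume ω₀ 0

variable [ChartedSpace (Cn n) X]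

/-- The coefficients define a smooth real `(1,1)`-form on `X`. -/
structure IsForm (α : Coeff n X) : Prop where
  hermitian : ∀ c ∈ atlas (Cn n) X, ∀ z ∈ c.target, (α c z).IsHermitian
  smooth : ∀ c ∈ atlas (Cn n) X, ∀ i j, ContDiffOn ℝ ∞ (fun z => α c z i j) c.target
  transform : ∀ c ∈ atlas (Cn n) X, ∀ c' ∈ atlas (Cn n) X, ∀ z ∈ (c.symm.trans c').source,
    α c z = (jac c c' z)ᵀ * α c' (c' (c.symm z)) * (jac c c' z).map (starRingEnd ℂ)

/-- `dα = 0`, for a real `(1,1)`-form: `∂_k α_{ij̄} = ∂_i α_{kj̄}` in every chart. -/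
def IsClosedForm (α : Coeff n X) : Prop :=
  ∀ c ∈ atlas (Cn n) X, ∀ z ∈ c.target, ∀ i j k,
    dz k (fun w => α c w i j) z = dz i (fun w => α c w k j) z

/-- `α > 0` on `X`. -/
def IsPositive (α : Coeff n X) : Prop :=
  ∀ c ∈ atlas (Cn n) X, ∀ z ∈ c.target, (α c z).PosDef

/-- `ω₀` is a (smooth) Kähler form on `X`. -/
structure IsKahler (ω₀ : Coeff n X) : Prop where
  isForm : IsForm ω₀
  closed : IsClosedForm ω₀
  pos : IsPositive ω₀

/-- `β = da` for some smooth real 1-form `a`. The 1-form is given by its coefficients `a_i`, in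
`∑ a_i dz_i + ∑ ā_i dz̄_i`; the first condition on derivatives says that the `(2,0)`-part of `da`
vanishes, the second that its `(1,1)`-part is `β`. -/
def IsExactForm (β : Coeff n X) : Prop :=
  ∃ a : OpenPartialHomeomorph X (Cn n) → Cn n → Fin n → ℂ,
    (∀ c ∈ atlas (Cn n) X, ∀ i, ContDiffOn ℝ ∞ (fun z => a c z i) c.target) ∧
    (∀ c ∈ atlas (Cn n) X, ∀ c' ∈ atlas (Cn n) X, ∀ z ∈ (c.symm.trans c').source, ∀ i,
      a c z i = ∑ b, a c' (c' (c.symm z)) b * jac c c' z b i) ∧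
    ∀ c ∈ atlas (Cn n) X, ∀ z ∈ c.target, ∀ i j,
      dz j (fun w => a c w i) z = dz i (fun w => a c w j) z ∧
      Complex.I * β c z i j =
        dz i (fun w => starRingEnd ℂ (a c w j)) z - dzbar j (fun w => a c w i) z

/-- The trace `tr_{ω₀} α = g^{ij̄} α_{ij̄}` (with `g` the coefficients of `ω₀`), as a function on `X`. -/
def traceForm (ω₀ α : Coeff n X) (x : X) : ℝ :=
  ((ω₀ (chartAt (Cn n) x) (chartAt (Cn n) x x))⁻¹ *
    α (chartAt (Cn n) x) (chartAt (Cn n) x x)).trace.re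

/-- The quotient `αⁿ / ω₀ⁿ` of top degree forms, as a function on `X`. -/
def volumeRatio (α ω₀ : Coeff n X) (x : X) : ℝ :=
  (α (chartAt (Cn n) x) (chartAt (Cn n) x x)).det.re /
    (ω₀ (chartAt (Cn n) x) (chartAt (Cn n) x x)).det.re

/-- `T^η_{γ,max}`: the supremum of the `t ≥ 0` such that the de Rham class
`[ω₀] + t (-c₁(X) + (1-γ) c₁(L_D) + [η])` contains a Kähler form; here `θ ∈ c₁(L_D)`, and `c₁(X)` is
the class of `Ric(ω₀)`. -/
def maxTime (ω₀ θ η : Coeff n X) (γ : ℝ) : EReal :=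
  sSup {τ : EReal | ∃ t : ℝ, τ = (t : EReal) ∧ 0 ≤ t ∧ ∃ κ : Coeff n X, IsKahler κ ∧
    IsExactForm (κ - (ω₀ + t • (-ricci ω₀ + (1 - γ) • θ + η)))}

end Forms

section PSH

/-- Plurisubharmonic functions on an open subset `U` of `ℂⁿ`. The mean value over a circle is
compared through the continuous majorants of the (upper semicontinuous) function on that circle. -/
structure IsPSH {n : ℕ} (U : Set (Cn n)) (u : Cn n → EReal) : Prop where
  usc : UpperSemicontinuousOn u U
  lt_top : ∀ z ∈ U, u z ≠ ⊤
  nontrivial : ∀ V ⊆ U, IsOpen V → V.Nonempty → ∃ z ∈ V, u z ≠ ⊥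
  submean : ∀ a b : Cn n, (∀ ζ : ℂ, ‖ζ‖ ≤ 1 → a + ζ • b ∈ U) →
    ∀ g : ℂ → ℝ, Continuous g → (∀ ζ : ℂ, ‖ζ‖ = 1 → u (a + ζ • b) ≤ (g ζ : EReal)) →
      u a ≤ ((Real.circleAverage g 0 1 : ℝ) : EReal)

variable {n : ℕ} {X : Type*} [TopologicalSpace X] [ChartedSpace (Cn n) X]

/-- `φ : X → [-∞,∞)` is `ω₀`-plurisubharmonic: wherever `ρ` is a local potential of `ω₀` in a chart,
`ρ + φ` is plurisubharmonic. -/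
def IsOmegaPSH (ω₀ : Coeff n X) (φ : X → EReal) : Prop :=
  ∀ c ∈ atlas (Cn n) X, ∀ V ⊆ c.target, IsOpen V → ∀ ρ : Cn n → ℝ, ContDiffOn ℝ ∞ ρ V →
    (∀ z ∈ V, ω₀ c z = complexHessian ρ z) →
      IsPSH V fun z => (ρ z : EReal) + φ (c.symm z)

variable (n) in
/-- The Lelong number of `φ` at `x`: the supremum of the `r ≥ 0` with
`φ ≤ r log |z - z(x)| + O(1)` near `x`. -/
def lelongNumber (φ : X → EReal) (x : X) : ℝ≥0∞ :=
  ⨆ (r : ℝ≥0) (_ : ∃ C : ℝ, ∀ᶠ y in 𝓝[≠] x,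
    φ y ≤ ((r * Real.log ‖chartAt (Cn n) x y - chartAt (Cn n) x x‖ + C : ℝ) : EReal)), (r : ℝ≥0∞)

/-- A sequence of smooth strictly `ω₀`-psh functions `ψ j` decreasing to `φ₀`. -/
structure IsSmoothApprox (ω₀ : Coeff n X) (φ₀ : X → EReal) (ψ : ℕ → X → ℝ) : Prop where
  smooth : ∀ j, ContMDiff 𝓘(ℝ, Cn n) 𝓘(ℝ, ℝ) ∞ (ψ j)
  strict : ∀ j, IsPositive (ω₀ + ddbar (ψ j))
  anti : ∀ x, Antitone fun j => ψ j x
  tendsto : ∀ x, Filter.Tendsto (fun j => (ψ j x : EReal)) Filter.atTop (𝓝 (φ₀ x))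

end PSH

section LineBundle

variable {n : ℕ} {X : Type*} [TopologicalSpace X] [ChartedSpace (Cn n) X]
  (L : X → Type*) [∀ x, AddCommGroup (L x)] [∀ x, Module ℂ (L x)] [∀ x, TopologicalSpace (L x)]
  [TopologicalSpace (Bundle.TotalSpace ℂ L)] [FiberBundle ℂ L]

variable (n) in
/-- A smooth Hermitian metric on the line bundle `L`, given by `v ↦ |v|²`. -/
structure HermitianMetric where
  normSq : ∀ x, L x → ℝ
  pos : ∀ x v, v ≠ 0 → 0 < normSq x v
  smul : ∀ x (a : ℂ) (v : L x), normSq x (a • v) = ‖a‖ ^ 2 * normSq x v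
  smooth : ∀ (e : Bundle.Trivialization ℂ (Bundle.TotalSpace.proj : Bundle.TotalSpace ℂ L → X))
    [MemTrivializationAtlas e],
    ContMDiffOn 𝓘(ℝ, Cn n) 𝓘(ℝ, ℝ) ∞ (fun x => normSq x (e.symm x 1)) e.baseSet

variable {L}

/-- The curvature form `-√-1∂∂̄ log h` of a Hermitian metric; `h` is evaluated on a local frame. -/
def HermitianMetric.curvature (h : HermitianMetric n L) : Coeff n X :=
  fun c z => -complexHessian
    (fun w => Real.log (h.normSq (c.symm w) ((trivializationAt ℂ L (c.symm z)).symm (c.symm w) 1))) z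

/-- `s` is a defining section of the smooth divisor `D`: its zero set is `D`, and it vanishes
transversally (to first order) along `D`. -/
structure IsDefiningSection (n : ℕ) {X : Type*} [TopologicalSpace X] [ChartedSpace (Cn n) X]
    {L : X → Type*} [∀ x, AddCommGroup (L x)] [∀ x, TopologicalSpace (L x)]
    [TopologicalSpace (Bundle.TotalSpace ℂ L)] [FiberBundle ℂ L]
    (s : ∀ x, L x) (D : Set X) : Prop where
  zeroSet : ∀ x, x ∈ D ↔ s x = 0
  transversal : ∀ x ∈ D,
    mfderiv 𝓘(ℂ, Cn n) 𝓘(ℂ, ℂ)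
      (fun y => (trivializationAt ℂ L x (Bundle.TotalSpace.mk' ℂ y (s y))).2) x ≠ 0

end LineBundle

section Flow

variable {n : ℕ} {X : Type*} [TopologicalSpace X]

/-- `χ_{γε} = (1/γ) ∫₀^{σ} ((ε² + r)^γ - ε^{2γ}) / r dr`, where `σ = |s|_h²`. -/
def chi (σ : X → ℝ) (γ ε : ℝ) (x : X) : ℝ :=
  1 / γ * ∫ r in (0 : ℝ)..σ x, ((ε ^ 2 + r) ^ γ - ε ^ (2 * γ)) / r

/-- The form `ω_{γε} = ω₀ + k √-1∂∂̄χ_{γε}` approximating a metric with cone singularities. -/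
def coneApprox (ω₀ : Coeff n X) (σ : X → ℝ) (k γ ε : ℝ) : Coeff n X :=
  ω₀ + k • ddbar (chi σ γ ε)

/-- The form `ν_γ = -Ric(e^{-h} ω₀ⁿ) + (1-γ) θ + η`. -/
def nu (ω₀ θ η : Coeff n X) (h : X → ℝ) (γ : ℝ) : Coeff n X :=
  -ricciOfVolume ω₀ h + (1 - γ) • θ + η

/-- The form `ω₀ + t ν + √-1∂∂̄u`. -/
def evolvingForm (ω₀ ν : Coeff n X) (t : ℝ) (u : X → ℝ) : Coeff n X :=
  ω₀ + t • ν + ddbar u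

/-- The oscillation `sup u - inf u`. -/
def osc (u : X → ℝ) : ℝ := (⨆ x, u x) - ⨅ x, u x

/-- `φ` is a smooth solution on `[0,T] × X`, with `ω₀ + tν + √-1∂∂̄φ(t) > 0`, of
`∂φ/∂t = log ((ω₀ + tν + √-1∂∂̄φ)ⁿ / ω₀ⁿ) + h + (1-γ) log (ε² + σ)`, `φ(0) = ψ`. -/
structure IsFlow [ChartedSpace (Cn n) X] (ω₀ ν : Coeff n X) (h σ : X → ℝ) (γ ε T : ℝ) (ψ : X → ℝ)
    (φ : ℝ → X → ℝ) : Prop where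
  smooth : ContMDiffOn (𝓘(ℝ, ℝ).prod 𝓘(ℝ, Cn n)) 𝓘(ℝ, ℝ) ∞ (fun p : ℝ × X => φ p.1 p.2)
    (Set.Icc 0 T ×ˢ Set.univ)
  pos : ∀ t ∈ Set.Icc 0 T, IsPositive (evolvingForm ω₀ ν t (φ t))
  eqn : ∀ t ∈ Set.Icc 0 T, ∀ x, HasDerivWithinAt (fun τ => φ τ x)
    (Real.log (volumeRatio (evolvingForm ω₀ ν t (φ t)) ω₀ x) + h x
      + (1 - γ) * Real.log (ε ^ 2 + σ x)) (Set.Icc 0 T) t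
  init : ∀ x, φ 0 x = ψ x

end Flow

end ConicalKRF

end

open ConicalKRF

open scoped Manifold ContDiff ComplexOrder Topology NNReal ENNReal Matrix

noncomputable section

set_option linter.unusedSectionVars false

/-! The estimate is a parabolic maximum principle in which the curvature of the cone metrics
`ω_{γε}` never enters. Write `σ = |s|²_h` and `β = √-1∂∂̄σ + σθ`. In a holomorphic frame with
squared norm `a`, where `s` has coefficient `S`, one has `β = a ∇S ∇S^*`, with `∇S = ∂S + S ∂log a`;
so `β` is semipositive of rank at most one. Moreover `√-1∂∂̄χ_{γε}` is `(ε²+σ)^{γ-1} β` minus a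
multiple of `θ` that is bounded independently of `ε`. For small `k` the forms `ω_{γε}` are therefore
uniformly comparable to the model `g_ε = ω + (ε²+σ)^{γ-1} β`, and `ω_{γt} + k√-1∂∂̄χ_{γε}` is
bounded below by `b g_ε`.

Let `G` be the evolving metric and `y = tr_G g_ε`. Uniformly in `ε`, `y` is comparable to the
maximum of finitely many local functions `e^ψ |ξ|²_G` with `ξ` a holomorphic `(1,0)`-form: `ξ =
dz_i` with `ψ = 0`, and near `D` also `ξ = dS` with `ψ = (γ-1) log(ε²+σ)` (`hasTests_univ`). The
Bochner inequality gives `Δ log|ξ|² ≥ Ric(ξ^#,ξ^#)/|ξ|²` (`bochner_inequality`), while the flow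
reads `∂_t G = -Ric + (1-γ)(θ + √-1∂∂̄ log(ε²+σ)) + η`. In `(∂_t - Δ)(ψ + log|ξ|²)` the Ricci terms
cancel. The rest is at most `C tr_G ω`: the unbounded part of the twist is a nonnegative multiple of
`β`, which has the good sign for `dz_i`; for `dS` it absorbs the unbounded part of `-Δψ`, because
`∇S` and `dS` differ only by `S ∂log a`.

The maximum principle is applied to `H = (t-t₀)(φ̇ + (n-1)(ψ + log|ξ|²_G - Nδ)) - A(φ - kχ)`, where
`δ` is the squared distance to the centre of the coordinate ball divided by the squared radius. On
the boundary of its ball a test loses `N`, so it is beaten by a test in whose half ball the same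
point lies; the maximum over all tests is thus attained at an interior point of some ball
(`exists_max_testQuantity`). There `(A-1)φ̇ + y ≤ (n-1)(log y + c) + An` for large `A`
(`evolution_estimate`). Since `φ̇ ≥ -n log y - c`, this bounds first `y` and then `φ̇`
(`exists_testQuantity_le`).

To return to the required trace, `tr_g G ≤ n (det G/det g)(tr_G g)^{n-1}` with `g = ω_{γε}`. Hence
`log tr_g G` is at most `φ̇ + (n-1) log y` plus a constant, which explains the factor `n-1` in `H`.
The term `A(φ - kχ)` is compared with time `t₀`: the supremum of `φ` grows, and the infimum of `φ -
kχ` decays, at most linearly. Only `A osc(φ - kχ)(t₀)` and a constant remain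
(`exists_trace_estimate`). -/

namespace ConicalKRF

/-! ### Complexified directional derivatives of scalar and matrix valued functions. -/

section Wirtinger

variable {E : Type*} [NormedAddCommGroup E] [NormedSpace ℝ E]

/-- The complexified directional derivative in the direction `p + √-1 q`. -/
def wd (p q : E) (f : E → ℂ) (z : E) : ℂ := fderiv ℝ f z p + Complex.I * fderiv ℝ f z q

variable {p q p' q' : E} {f g : E → ℂ} {z : E} {U : Set E}

theorem wd_congr (h : f =ᶠ[𝓝 z] g) : wd p q f z = wd p q g z := by
  simp only [wd, h.fderiv_eq]

theorem wd_congr_on (hU : IsOpen U) (h : ∀ y ∈ U, f y = g y) (hz : z ∈ U) :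
    wd p q f z = wd p q g z :=
  wd_congr (Filter.eventuallyEq_of_mem (hU.mem_nhds hz) h)

@[simp] theorem wd_const (c : ℂ) : wd p q (fun _ : E => c) z = 0 := by simp [wd]

theorem wd_add (hf : DifferentiableAt ℝ f z) (hg : DifferentiableAt ℝ g z) :
    wd p q (fun y => f y + g y) z = wd p q f z + wd p q g z := by
  simp only [wd, fderiv_fun_add hf hg, add_apply]; ring

theorem wd_sub (hf : DifferentiableAt ℝ f z) (hg : DifferentiableAt ℝ g z) :
    wd p q (fun y => f y - g y) z = wd p q f z - wd p q g z := by
  simp only [wd, fderiv_fun_sub hf hg, sub_apply]; ring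

theorem wd_mul (hf : DifferentiableAt ℝ f z) (hg : DifferentiableAt ℝ g z) :
    wd p q (fun y => f y * g y) z = wd p q f z * g z + f z * wd p q g z := by
  simp only [wd, fderiv_fun_mul hf hg, add_apply, smul_apply, smul_eq_mul]; ring

theorem wd_const_mul (c : ℂ) (hf : DifferentiableAt ℝ f z) :
    wd p q (fun y => c * f y) z = c * wd p q f z := by
  rw [wd_mul (differentiableAt_const c) hf]; simp

theorem wd_sum {ι : Type*} (s : Finset ι) {F : ι → E → ℂ}
    (hF : ∀ i ∈ s, DifferentiableAt ℝ (F i) z) :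
    wd p q (fun y => ∑ i ∈ s, F i y) z = ∑ i ∈ s, wd p q (F i) z := by
  simp only [wd, fderiv_fun_sum hF, sum_apply, Finset.mul_sum,
    Finset.sum_add_distrib]

theorem wd_comp_real {φ : ℝ → ℝ} {u : E → ℝ} {c : ℝ} (hφ : HasDerivAt φ c (u z))
    (hu : DifferentiableAt ℝ u z) :
    wd p q (fun y => ((φ (u y) : ℝ) : ℂ)) z = c * wd p q (fun y => (u y : ℂ)) z := by
  have h1 : HasFDerivAt (fun y => ((φ (u y) : ℝ) : ℂ))
      (Complex.ofRealCLM.comp (c • fderiv ℝ u z)) z :=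
    Complex.ofRealCLM.hasFDerivAt.comp z (hφ.comp_hasFDerivAt z hu.hasFDerivAt)
  have h2 : HasFDerivAt (fun y => ((u y : ℝ) : ℂ)) (Complex.ofRealCLM.comp (fderiv ℝ u z)) z :=
    Complex.ofRealCLM.hasFDerivAt.comp z hu.hasFDerivAt
  simp only [wd, h1.fderiv, h2.fderiv, ContinuousLinearMap.comp_apply, smul_apply,
    smul_eq_mul, Complex.ofRealCLM_apply, Complex.ofReal_mul]; ring

theorem wd_conj (hf : DifferentiableAt ℝ f z) :
    wd p q (fun y => starRingEnd ℂ (f y)) z = starRingEnd ℂ (wd p (-q) f z) := by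
  have h : HasFDerivAt (fun y => starRingEnd ℂ (f y))
      ((Complex.conjCLE : ℂ →L[ℝ] ℂ).comp (fderiv ℝ f z)) z :=
    (Complex.conjCLE : ℂ →L[ℝ] ℂ).hasFDerivAt.comp z hf.hasFDerivAt
  simp [wd, h.fderiv]

theorem ContDiffOn.wd (hU : IsOpen U) (hf : ContDiffOn ℝ ∞ f U) :
    ContDiffOn ℝ ∞ (wd p q f) U := by
  have h : ContDiffOn ℝ ∞ (fun y => fderiv ℝ f y) U := hf.fderiv_of_isOpen hU (by simp)
  exact (h.clm_apply contDiffOn_const).add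
    (contDiffOn_const.mul (h.clm_apply contDiffOn_const))

theorem _root_.ContDiffOn.diffAt {F : Type*} [NormedAddCommGroup F] [NormedSpace ℝ F] {f : E → F}
    (hf : ContDiffOn ℝ ∞ f U) (hU : IsOpen U) (hz : z ∈ U) :
    DifferentiableAt ℝ f z :=
  (hf.contDiffAt (hU.mem_nhds hz)).differentiableAt (by simp)

/-- Both sides expand into second derivatives of `f` in the same pairs of directions, and these are
symmetric. Later interchanges of time and space derivatives, and of ∂ and ∂̄, are instances. -/
theorem wd_comm (hU : IsOpen U) (hf : ContDiffOn ℝ ∞ f U) (hz : z ∈ U) :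
    wd p q (wd p' q' f) z = wd p' q' (wd p q f) z := by
  have h : ContDiffOn ℝ ∞ (fun y => fderiv ℝ f y) U := hf.fderiv_of_isOpen hU (by simp)
  have hd : DifferentiableAt ℝ (fun y => fderiv ℝ f y) z := h.diffAt hU hz
  have key : ∀ a b : E, ∀ v, fderiv ℝ (wd a b f) z v =
      fderiv ℝ (fderiv ℝ f) z v a + Complex.I * fderiv ℝ (fderiv ℝ f) z v b := by
    intro a b v
    have h1 : HasFDerivAt (fun y => fderiv ℝ f y a)
        ((fderiv ℝ (fderiv ℝ f) z).flip a) z := by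
      simpa using hd.hasFDerivAt.clm_apply (hasFDerivAt_const a z)
    have h2 : HasFDerivAt (fun y => fderiv ℝ f y b)
        ((fderiv ℝ (fderiv ℝ f) z).flip b) z := by
      simpa using hd.hasFDerivAt.clm_apply (hasFDerivAt_const b z)
    have h3 := h1.add (h2.const_mul Complex.I)
    have h4 : HasFDerivAt (wd a b f) _ z := h3
    rw [h4.fderiv]; simp
  have hs : IsSymmSndFDerivAt ℝ f z :=
    (hf.contDiffAt (hU.mem_nhds hz)).isSymmSndFDerivAt (by simpa using WithTop.coe_le_coe.2 (le_top : (2 : ℕ∞) ≤ ⊤))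
  conv_lhs => rw [wd]
  conv_rhs => rw [wd]
  simp only [key]
  rw [hs.eq p p', hs.eq p q', hs.eq q p', hs.eq q q']
  ring

/-- The entrywise derivative of a matrix valued function. -/
def wdM {m n : Type*} (p q : E) (A : E → Matrix m n ℂ) (z : E) : Matrix m n ℂ :=
  Matrix.of fun i j => wd p q (fun y => A y i j) z

variable {l m n : Type*}

@[simp] theorem wdM_apply (A : E → Matrix m n ℂ) (i : m) (j : n) :
    wdM p q A z i j = wd p q (fun y => A y i j) z := rfl

theorem wdM_congr {A B : E → Matrix m n ℂ} (h : A =ᶠ[𝓝 z] B) :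
    wdM p q A z = wdM p q B z := by
  ext i j
  exact wd_congr (h.mono fun y hy => congrFun (congrFun hy i) j)

theorem wdM_mul [Fintype m] {A : E → Matrix l m ℂ} {B : E → Matrix m n ℂ}
    (hA : ∀ i j, DifferentiableAt ℝ (fun y => A y i j) z)
    (hB : ∀ i j, DifferentiableAt ℝ (fun y => B y i j) z) :
    wdM p q (fun y => A y * B y) z = wdM p q A z * B z + A z * wdM p q B z := by
  ext i j
  simp only [wdM_apply, Matrix.mul_apply, Matrix.add_apply]
  rw [wd_sum (F := fun k y => A y i k * B y k j) _ fun k _ => (hA i k).mul (hB k j), ← Finset.sum_add_distrib]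
  exact Finset.sum_congr rfl fun k _ => wd_mul (hA i k) (hB k j)

theorem wdM_conjTranspose {A : E → Matrix m n ℂ}
    (hA : ∀ i j, DifferentiableAt ℝ (fun y => A y i j) z) :
    wdM p q (fun y => (A y)ᴴ) z = (wdM p (-q) A z)ᴴ := by
  ext i j
  simp only [wdM_apply, Matrix.conjTranspose_apply]
  exact wd_conj (hA j i)

theorem wdM_sub {A B : E → Matrix m n ℂ}
    (hA : ∀ i j, DifferentiableAt ℝ (fun y => A y i j) z)
    (hB : ∀ i j, DifferentiableAt ℝ (fun y => B y i j) z) :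
    wdM p q (fun y => A y - B y) z = wdM p q A z - wdM p q B z := by
  ext i j
  exact wd_sub (hA i j) (hB i j)

theorem wd_trace [Fintype n] {A : E → Matrix n n ℂ}
    (hA : ∀ i j, DifferentiableAt ℝ (fun y => A y i j) z) :
    wd p q (fun y => (A y).trace) z = (wdM p q A z).trace := by
  simp only [Matrix.trace, Matrix.diag_apply, wdM_apply]
  exact wd_sum _ fun i _ => hA i i

end Wirtinger

/-! ### Derivatives of the determinant and of the inverse matrix. -/

section Det

variable {ι : Type*} [Fintype ι] [DecidableEq ι]

/-- Jacobi's formula. Along the line `M₀ + rH` the determinant is `det M₀ · det(1 + r M₀⁻¹H)`, whose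
linear term in `r` is a trace. -/
theorem hasFDerivAt_det_apply (M₀ : Matrix ι ι ℂ) (h0 : M₀.det ≠ 0) :
    ∃ D : (ι → ι → ℂ) →L[ℂ] ℂ,
      HasFDerivAt (fun M : ι → ι → ℂ => (Matrix.of M).det) D (fun i j => M₀ i j) ∧
      ∀ H : Matrix ι ι ℂ, D (fun i j => H i j) = M₀.det * (M₀⁻¹ * H).trace := by
  have hd : Differentiable ℂ (fun M : ι → ι → ℂ => (Matrix.of M).det) := by
    simp only [Matrix.det_apply', Matrix.of_apply]
    fun_prop
  refine ⟨_, (hd _).hasFDerivAt, fun H => ?_⟩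
  have h1 : HasDerivAt (fun r : ℂ => (fun i j => M₀ i j : ι → ι → ℂ) + r • (fun i j => H i j))
      (fun i j => H i j) 0 := by
    simpa using ((hasDerivAt_id (0 : ℂ)).smul_const (fun i j => H i j : ι → ι → ℂ)).const_add
      (fun i j => M₀ i j : ι → ι → ℂ)
  have h2 := HasFDerivAt.comp_hasDerivAt_of_eq (0 : ℂ) (hd (fun i j => M₀ i j)).hasFDerivAt h1
    (by simp)
  refine h2.unique ?_
  have h3 : ∀ r : ℂ, (Matrix.of ((fun i j => M₀ i j : ι → ι → ℂ) + r • (fun i j => H i j))).det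
      = M₀.det * (1 + r • (M₀⁻¹ * H)).det := by
    intro r
    rw [← Matrix.det_mul, mul_add, Matrix.mul_smul, ← mul_assoc,
      Matrix.mul_nonsing_inv _ (Ne.isUnit h0), mul_one, one_mul]
    rfl
  have h4 : HasDerivAt (fun r : ℂ => M₀.det * (1 + r • (M₀⁻¹ * H)).det)
      (M₀.det * (M₀⁻¹ * H).trace) 0 := by
    have e := fun r : ℂ => Matrix.det_one_add_smul r (M₀⁻¹ * H)
    simp only [e]
    have h5 : HasDerivAt (fun r : ℂ => 1 + (M₀⁻¹ * H).trace * r) (M₀⁻¹ * H).trace 0 := by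
      simpa using ((hasDerivAt_id (0 : ℂ)).const_mul (M₀⁻¹ * H).trace).const_add 1
    have h6 : ∀ R : Polynomial ℂ, HasDerivAt (fun r : ℂ => Polynomial.eval r R * r ^ 2) 0 0 := by
      intro R
      have := (Polynomial.hasDerivAt R (0 : ℂ)).mul (hasDerivAt_pow 2 (0 : ℂ))
      exact this.congr_deriv (by simp)
    simpa using (h5.add (h6 _)).const_mul M₀.det
  exact h4.congr_of_eventuallyEq (Filter.Eventually.of_forall fun r => by simp [h3 r])

theorem hasDerivAt_det {A : ℝ → Matrix ι ι ℂ} {A' : Matrix ι ι ℂ} {t : ℝ}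
    (hA : ∀ i j, HasDerivAt (fun s => A s i j) (A' i j) t) (h0 : (A t).det ≠ 0) :
    HasDerivAt (fun s => (A s).det) ((A t).det * ((A t)⁻¹ * A').trace) t := by
  obtain ⟨D, hD, hD'⟩ := hasFDerivAt_det_apply (A t) h0
  have h1 : HasDerivAt (fun s => (fun i j => A s i j : ι → ι → ℂ)) (fun i j => A' i j) t :=
    hasDerivAt_pi.2 fun i => hasDerivAt_pi.2 fun j => hA i j
  have := (hD.restrictScalars ℝ).comp_hasDerivAt t h1
  rw [← hD']
  exact this

variable {E : Type*} [NormedAddCommGroup E] [NormedSpace ℝ E] {p q : E} {z : E} {U : Set E}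

theorem wd_det {A : E → Matrix ι ι ℂ} (hA : ∀ i j, DifferentiableAt ℝ (fun y => A y i j) z)
    (h0 : (A z).det ≠ 0) :
    wd p q (fun y => (A y).det) z = (A z).det * ((A z)⁻¹ * wdM p q A z).trace := by
  obtain ⟨D, hD, hD'⟩ := hasFDerivAt_det_apply (A z) h0
  have h1 : HasFDerivAt (fun y => (fun i j => A y i j : ι → ι → ℂ))
      (ContinuousLinearMap.pi fun i => ContinuousLinearMap.pi fun j =>
        fderiv ℝ (fun y => A y i j) z) z :=
    hasFDerivAt_pi.2 fun i => hasFDerivAt_pi.2 fun j => (hA i j).hasFDerivAt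
  have h2 := (hD.restrictScalars ℝ).comp z h1
  have h4 : fderiv ℝ (fun y => (A y).det) z = _ := h2.fderiv
  rw [wd, h4, ← hD']
  have h3 : (fun i j => wdM p q A z i j) = (fun i j => fderiv ℝ (fun y => A y i j) z p : ι → ι → ℂ)
      + Complex.I • (fun i j => fderiv ℝ (fun y => A y i j) z q : ι → ι → ℂ) := by
    ext i j; simp [wd]
  rw [h3, map_add, map_smul]
  rfl

theorem contDiffOn_det {A : E → Matrix ι ι ℂ} (hA : ∀ i j, ContDiffOn ℝ ∞ (fun y => A y i j) U) :
    ContDiffOn ℝ ∞ (fun y => (A y).det) U := by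
  simp only [Matrix.det_apply']
  exact ContDiffOn.sum fun s _ => contDiffOn_const.mul (contDiffOn_prod fun i _ => hA _ _)

theorem contDiffOn_matrix_inv {A : E → Matrix ι ι ℂ}
    (hA : ∀ i j, ContDiffOn ℝ ∞ (fun y => A y i j) U) (h0 : ∀ y ∈ U, (A y).det ≠ 0) (i j : ι) :
    ContDiffOn ℝ ∞ (fun y => (A y)⁻¹ i j) U := by
  have h1 : ∀ y, (A y)⁻¹ i j = ((A y).det)⁻¹ * ((A y).updateRow j (Pi.single i 1)).det := by
    intro y
    rw [Matrix.inv_def, Matrix.smul_apply, Matrix.adjugate_apply, Ring.inverse_eq_inv', smul_eq_mul]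
  simp only [h1]
  refine ((contDiffOn_det hA).inv h0).mul (contDiffOn_det fun a b => ?_)
  by_cases h : a = j
  · subst h; simp only [Matrix.updateRow_self]; exact contDiffOn_const
  · simp only [Matrix.updateRow_ne h]; exact hA a b

theorem contDiffOn_matrix_mul {l m n : Type*} [Fintype m] {A : E → Matrix l m ℂ}
    {B : E → Matrix m n ℂ}
    (hA : ∀ i j, ContDiffOn ℝ ∞ (fun y => A y i j) U)
    (hB : ∀ i j, ContDiffOn ℝ ∞ (fun y => B y i j) U) (i : l) (j : n) :
    ContDiffOn ℝ ∞ (fun y => (A y * B y) i j) U := by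
  simp only [Matrix.mul_apply]
  exact ContDiffOn.sum fun k _ => (hA i k).mul (hB k j)

/-- Differentiate `A⁻¹ A = 1` and solve for the derivative of the inverse. -/
theorem wdM_inv (hU : IsOpen U) {A : E → Matrix ι ι ℂ}
    (hA : ∀ i j, ContDiffOn ℝ ∞ (fun y => A y i j) U) (h0 : ∀ y ∈ U, (A y).det ≠ 0) (hz : z ∈ U) :
    wdM p q (fun y => (A y)⁻¹) z = -((A z)⁻¹ * wdM p q A z * (A z)⁻¹) := by
  have hi := fun i j => (contDiffOn_matrix_inv hA h0 i j).diffAt hU hz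
  have h1 : wdM p q (fun y => (A y)⁻¹ * A y) z = 0 := by
    rw [wdM_congr (B := fun _ => 1)]
    · ext i j; simp
    · filter_upwards [hU.mem_nhds hz] with y hy
      exact Matrix.nonsing_inv_mul _ (Ne.isUnit (h0 y hy))
  rw [wdM_mul hi fun i j => (hA i j).diffAt hU hz] at h1
  have hu : IsUnit (A z).det := Ne.isUnit (h0 z hz)
  have h2 := congrArg (fun M => M * (A z)⁻¹) h1
  simp only [add_mul, zero_mul, mul_assoc, Matrix.mul_nonsing_inv _ hu, mul_one] at h2
  rw [mul_assoc]
  exact eq_neg_of_add_eq_zero_left h2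

end Det

end ConicalKRF

namespace ConicalKRF

/-! ### Inequalities between positive Hermitian matrices, their traces and determinants. -/

section LinearAlgebra

open Matrix

variable {ι : Type*} [Fintype ι] [DecidableEq ι]

/-- The rank one matrix `v v^*`. -/
def rankOne (v : ι → ℂ) : Matrix ι ι ℂ := vecMulVec v (star v)

theorem rankOne_posSemidef (v : ι → ℂ) : (rankOne v).PosSemidef :=
  posSemidef_vecMulVec_self_star v

theorem trace_mul_rankOne (P : Matrix ι ι ℂ) (v : ι → ℂ) :
    (P * rankOne v).trace = star v ⬝ᵥ (P *ᵥ v) := by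
  rw [rankOne, mul_vecMulVec, trace_vecMulVec, dotProduct_comm]

theorem trace_mul_re_nonneg {P A : Matrix ι ι ℂ} (hP : P.PosSemidef) (hA : A.PosSemidef) :
    0 ≤ (P * A).trace.re := by
  obtain ⟨m, v, rfl⟩ := posSemidef_iff_eq_sum_vecMulVec.mp hA
  rw [Matrix.mul_sum, trace_sum, Complex.re_sum]
  refine Finset.sum_nonneg fun i _ => ?_
  have := trace_mul_rankOne P (v i)
  rw [rankOne] at this
  rw [this]
  exact hP.re_dotProduct_nonneg _

theorem trace_mul_le {P A B : Matrix ι ι ℂ} (hP : P.PosSemidef) (h : (B - A).PosSemidef) :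
    (P * A).trace.re ≤ (P * B).trace.re := by
  have := trace_mul_re_nonneg hP h
  rw [mul_sub, trace_sub, Complex.sub_re] at this
  linarith

theorem trace_mul_real_smul (P A : Matrix ι ι ℂ) (c : ℝ) :
    (P * (c • A)).trace.re = c * (P * A).trace.re := by
  rw [Matrix.mul_smul, trace_smul, Complex.real_smul, Complex.re_ofReal_mul]

theorem trace_mul_add_re (P A B : Matrix ι ι ℂ) :
    (P * (A + B)).trace.re = (P * A).trace.re + (P * B).trace.re := by
  rw [mul_add, trace_add, Complex.add_re]

theorem trace_mul_sub_re (P A B : Matrix ι ι ℂ) :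
    (P * (A - B)).trace.re = (P * A).trace.re - (P * B).trace.re := by
  rw [mul_sub, trace_sub, Complex.sub_re]

/-- Cauchy-Schwarz inequality as an inequality of Hermitian matrices. -/
theorem cauchySchwarz_posSemidef {P : Matrix ι ι ℂ} (hP : P.PosDef) (ξ : ι → ℂ) :
    ((star ξ ⬝ᵥ (P *ᵥ ξ)).re • P - rankOne (P *ᵥ ξ)).PosSemidef := by
  classical
  by_cases hξ : ξ = 0
  · subst hξ
    simpa [rankOne] using PosSemidef.zero
  set c : ℝ := (star ξ ⬝ᵥ (P *ᵥ ξ)).re with hc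
  have hcpos : 0 < c := hP.re_dotProduct_pos hξ
  have hcc : star ξ ⬝ᵥ (P *ᵥ ξ) = (c : ℂ) := by
    have h1 := hP.posSemidef.dotProduct_mulVec_nonneg ξ
    rw [Complex.le_def] at h1
    apply Complex.ext <;> simp [hc, ← h1.2]
  set Q : Matrix ι ι ℂ := (c : ℂ) • (1 : Matrix ι ι ℂ) - vecMulVec ξ (star (P *ᵥ ξ)) with hQ
  have hPH : Pᴴ = P := hP.isHermitian
  have hs : star (P *ᵥ ξ) = star ξ ᵥ* P := by rw [star_mulVec, hPH]
  have h1 := (hP.posSemidef.conjTranspose_mul_mul_same Q).smul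
    (show (0 : ℝ) ≤ c⁻¹ by positivity)
  have hQH : Qᴴ = (c : ℂ) • (1 : Matrix ι ι ℂ) - vecMulVec (P *ᵥ ξ) (star ξ) := by
    rw [hQ, conjTranspose_sub, conjTranspose_smul, conjTranspose_one, conjTranspose_vecMulVec,
      star_star]
    simp
  have h2 : Qᴴ * P * Q = c • ((c : ℂ) • P - rankOne (P *ᵥ ξ)) := by
    rw [hQH, hQ]
    have e1 : vecMulVec (P *ᵥ ξ) (star ξ) * P = rankOne (P *ᵥ ξ) := by
      rw [vecMulVec_mul, ← hs, rankOne]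
    have e2 : P * vecMulVec ξ (star (P *ᵥ ξ)) = rankOne (P *ᵥ ξ) := by
      rw [mul_vecMulVec, rankOne]
    have e3 : rankOne (P *ᵥ ξ) * vecMulVec ξ (star (P *ᵥ ξ)) = (c : ℂ) • rankOne (P *ᵥ ξ) := by
      rw [rankOne, vecMulVec_mul_vecMulVec, hs, ← dotProduct_mulVec, hcc, vecMulVec_smul]
    simp only [sub_mul, mul_sub, smul_mul_assoc, mul_smul_comm, one_mul, mul_one, e1, e2, e3]
    ext i j
    simp only [Matrix.sub_apply, Matrix.smul_apply, smul_eq_mul, Complex.real_smul]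
    ring
  rw [h2, smul_smul, inv_mul_cancel₀ hcpos.ne', one_smul] at h1
  have h3 : c • P = (c : ℂ) • P := by
    ext i j; simp only [Matrix.smul_apply, smul_eq_mul, Complex.real_smul]
  rwa [h3]

/-- Pairing the matrix Cauchy-Schwarz inequality with `A` under the trace. For `P = G⁻¹` it bounds a
semipositive form on the dual vector of a covector `ξ` by `|ξ|²_G` times its trace. -/
theorem dotProduct_le_mul_trace {P A : Matrix ι ι ℂ} (hP : P.PosDef) (hA : A.PosSemidef)
    (ξ : ι → ℂ) :
    (star (P *ᵥ ξ) ⬝ᵥ (A *ᵥ (P *ᵥ ξ))).re ≤ (star ξ ⬝ᵥ (P *ᵥ ξ)).re * (P * A).trace.re := by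
  have h := trace_mul_le hA (cauchySchwarz_posSemidef hP ξ)
  rwa [trace_mul_rankOne, trace_mul_real_smul, trace_mul_comm A P] at h

/-- An eigenbasis of `g`, rescaled by the inverse square roots of the eigenvalues, turns `g` into
the identity. A further unitary change of basis then diagonalizes `A` without disturbing this. -/
theorem exists_simultaneous_diagonalization {g A : Matrix ι ι ℂ} (hg : g.PosDef)
    (hA : A.IsHermitian) : ∃ (S : Matrix ι ι ℂ) (d : ι → ℝ), IsUnit S.det ∧ Sᴴ * g * S = 1 ∧
      Sᴴ * A * S = diagonal (fun i => (d i : ℂ)) := by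
  have key : ∀ {B : Matrix ι ι ℂ} (hB : B.IsHermitian), ∃ V : Matrix ι ι ℂ,
      Vᴴ * V = 1 ∧ Vᴴ * B * V = diagonal (fun i => (hB.eigenvalues i : ℂ)) := by
    intro B hB
    set V : Matrix ι ι ℂ := (hB.eigenvectorUnitary : Matrix ι ι ℂ) with hV
    have h1 : Vᴴ * V = 1 := Unitary.coe_star_mul_self hB.eigenvectorUnitary
    refine ⟨V, h1, ?_⟩
    have h2 : B = V * diagonal (fun i => (hB.eigenvalues i : ℂ)) * Vᴴ := by
      have := hB.spectral_theorem
      rw [Unitary.conjStarAlgAut_apply] at this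
      exact this
    set Λ : Matrix ι ι ℂ := diagonal (fun i => (hB.eigenvalues i : ℂ)) with hΛ
    calc Vᴴ * B * V = Vᴴ * (V * Λ * Vᴴ) * V := by rw [← h2]
      _ = (Vᴴ * V) * Λ * (Vᴴ * V) := by simp only [mul_assoc]
      _ = Λ := by rw [h1]; simp
  obtain ⟨V, hV, hVg⟩ := key hg.isHermitian
  set μ := hg.isHermitian.eigenvalues with hμ
  have hμpos : ∀ i, 0 < μ i := fun i => hg.eigenvalues_pos i
  set R : Matrix ι ι ℂ := diagonal (fun i => (((Real.sqrt (μ i))⁻¹ : ℝ) : ℂ)) with hR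
  have hRH : Rᴴ = R := by
    rw [hR, diagonal_conjTranspose]; congr 1; ext i; simp
  have hRR : R * diagonal (fun i => (μ i : ℂ)) * R = 1 := by
    rw [hR, diagonal_mul_diagonal, diagonal_mul_diagonal, ← diagonal_one]
    congr 1; ext i
    have h1 : Real.sqrt (μ i) ≠ 0 := (Real.sqrt_pos.2 (hμpos i)).ne'
    have h2 : (Real.sqrt (μ i))⁻¹ * μ i * (Real.sqrt (μ i))⁻¹ = 1 := by
      field_simp; exact (Real.sq_sqrt (hμpos i).le).symm
    exact_mod_cast h2
  set S₀ := V * R with hS₀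
  have hS₀g : S₀ᴴ * g * S₀ = 1 := by
    rw [hS₀, conjTranspose_mul, hRH, ← hRR, ← hVg]; simp only [mul_assoc]
  have hB : (S₀ᴴ * A * S₀).IsHermitian := by
    exact isHermitian_conjTranspose_mul_mul S₀ hA
  obtain ⟨W, hW, hWB⟩ := key hB
  have hSg : (S₀ * W)ᴴ * g * (S₀ * W) = 1 := by
    calc (S₀ * W)ᴴ * g * (S₀ * W) = Wᴴ * (S₀ᴴ * g * S₀) * W := by
          rw [conjTranspose_mul]; simp only [mul_assoc]
      _ = 1 := by rw [hS₀g, mul_one, hW]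
  refine ⟨S₀ * W, hB.eigenvalues, ?_, hSg, ?_⟩
  · have := congrArg det hSg
    rw [det_mul, det_one] at this
    exact IsUnit.of_mul_eq_one_right _ this
  · rw [← hWB, conjTranspose_mul]; simp only [mul_assoc]

/-- Relative eigenvalues of a positive definite matrix with respect to another one. -/
theorem exists_relative_eigenvalues {g A : Matrix ι ι ℂ} (hg : g.PosDef) (hA : A.PosDef) :
    ∃ d : ι → ℝ, (∀ i, 0 < d i) ∧ (g⁻¹ * A).trace.re = ∑ i, d i ∧
      (A⁻¹ * g).trace.re = ∑ i, (d i)⁻¹ ∧ A.det.re = g.det.re * ∏ i, d i := by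
  obtain ⟨S, d, hS, hSg, hSA⟩ := exists_simultaneous_diagonalization hg hA.isHermitian
  have hSH : IsUnit Sᴴ.det := by rw [det_conjTranspose]; exact hS.star
  have hdpos : ∀ i, 0 < d i := by
    intro i
    have h1 : (Sᴴ * A * S).PosDef :=
      hA.conjTranspose_mul_mul_same (mulVec_injective_iff_isUnit.2 ((isUnit_iff_isUnit_det S).2 hS))
    rw [hSA, posDef_diagonal_iff] at h1
    exact_mod_cast h1 i
  have hgi : g⁻¹ = S * Sᴴ := by
    refine inv_eq_left_inv ?_
    have : Sᴴ * (g * S) = 1 := by rw [← mul_assoc, hSg]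
    have h2 : (g * S) * Sᴴ = 1 := mul_eq_one_comm.1 this
    rw [mul_eq_one_comm, ← mul_assoc]; exact h2
  have hAinv : A⁻¹ = S * diagonal (fun i => (((d i)⁻¹ : ℝ) : ℂ)) * Sᴴ := by
    refine inv_eq_left_inv ?_
    set Λi : Matrix ι ι ℂ := diagonal (fun i => (((d i)⁻¹ : ℝ) : ℂ)) with hΛi
    have h1 : (Λi * Sᴴ * A) * S = 1 := by
      calc (Λi * Sᴴ * A) * S = Λi * (Sᴴ * A * S) := by simp only [mul_assoc]
        _ = 1 := by
          rw [hSA, hΛi, diagonal_mul_diagonal, ← diagonal_one]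
          congr 1; ext i
          have := (hdpos i).ne'
          push_cast
          exact inv_mul_cancel₀ (by exact_mod_cast this)
    have h2 := mul_eq_one_comm.1 h1
    rw [← h2]; simp only [mul_assoc]
  refine ⟨d, hdpos, ?_, ?_, ?_⟩
  · rw [hgi, mul_assoc, trace_mul_comm, hSA, trace_diagonal, Complex.re_sum]
    simp
  · rw [hAinv, mul_assoc, mul_assoc, trace_mul_comm, mul_assoc, hSg, mul_one, trace_diagonal,
      Complex.re_sum]
    simp only [Complex.ofReal_re]
  · have h1 := congrArg det hSg
    have h2 := congrArg det hSA
    rw [det_mul, det_mul, det_one] at h1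
    rw [det_mul, det_mul, det_diagonal] at h2
    have h3 : A.det = g.det * ∏ i, (d i : ℂ) := by
      rw [← h2]; linear_combination (-A.det) * h1
    have hgr : g.det = (g.det.re : ℂ) := by
      have := hg.det_pos; rw [Complex.lt_def] at this
      apply Complex.ext <;> simp [← this.2]
    rw [h3, hgr, ← Complex.ofReal_prod, ← Complex.ofReal_mul, Complex.ofReal_re, Complex.ofReal_re]

theorem det_re_pos {A : Matrix ι ι ℂ} (hA : A.PosDef) : 0 < A.det.re :=
  (Complex.lt_def.1 hA.det_pos).1

theorem ofReal_det_re {A : Matrix ι ι ℂ} (hA : A.IsHermitian) : ((A.det.re : ℝ) : ℂ) = A.det := by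
  have h : star A.det = A.det := by rw [← det_conjTranspose, hA.eq]
  exact Complex.conj_eq_iff_re.1 h

/-- The product of the relative eigenvalues is at most the `n`-th power of their sum; the sharp
constant of the arithmetic-geometric mean inequality is not needed. -/
theorem det_le_trace_pow {g A : Matrix ι ι ℂ} (hg : g.PosDef) (hA : A.PosDef) :
    A.det.re ≤ g.det.re * (g⁻¹ * A).trace.re ^ Fintype.card ι := by
  obtain ⟨d, hd, h1, -, h3⟩ := exists_relative_eigenvalues hg hA
  rw [h1, h3]
  have : ∏ i, d i ≤ (∑ i, d i) ^ Fintype.card ι := by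
    rw [← Finset.card_univ, ← Finset.prod_const]
    exact Finset.prod_le_prod (fun i _ => (hd i).le) fun i _ =>
      Finset.single_le_sum (fun j _ => (hd j).le) (Finset.mem_univ i)
  exact mul_le_mul_of_nonneg_left this (det_re_pos hg).le

/-- Each relative eigenvalue is the product of all of them times the inverses of the other `n - 1`,
and each of these inverses is at most the trace of `A⁻¹ g`. This exponent becomes the coefficient `n
- 1` of the test quantity. -/
theorem trace_le_det_mul_trace_pow {g A : Matrix ι ι ℂ} (hg : g.PosDef) (hA : A.PosDef) :
    (g⁻¹ * A).trace.re ≤ Fintype.card ι * (A.det.re / g.det.re) *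
      (A⁻¹ * g).trace.re ^ (Fintype.card ι - 1) := by
  obtain ⟨d, hd, h1, h2, h3⟩ := exists_relative_eigenvalues hg hA
  rw [h1, h2, h3, mul_div_cancel_left₀ _ (det_re_pos hg).ne']
  have : ∀ i ∈ Finset.univ, d i ≤ (∏ i, d i) * (∑ i, (d i)⁻¹) ^ (Fintype.card ι - 1) := by
    intro i hi
    have e1 : d i = (∏ j, d j) * ∏ j ∈ Finset.univ.erase i, (d j)⁻¹ := by
      rw [← Finset.mul_prod_erase _ d hi, mul_assoc, ← Finset.prod_mul_distrib,
        Finset.prod_eq_one fun j _ => mul_inv_cancel₀ (hd j).ne', mul_one]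
    conv_lhs => rw [e1]
    refine mul_le_mul_of_nonneg_left ?_ (Finset.prod_nonneg fun j _ => (hd j).le)
    rw [← Finset.card_univ, ← Finset.card_erase_of_mem hi, ← Finset.prod_const]
    exact Finset.prod_le_prod (fun j _ => (inv_pos.2 (hd j)).le) fun j _ =>
      Finset.single_le_sum (f := fun j => (d j)⁻¹) (fun j _ => (inv_pos.2 (hd j)).le)
        (Finset.mem_univ j)
  refine (Finset.sum_le_sum this).trans ?_
  rw [Finset.sum_const, Finset.card_univ, nsmul_eq_mul, mul_assoc]

theorem trace_inv_mul_pos [Nonempty ι] {g A : Matrix ι ι ℂ} (hg : g.PosDef) (hA : A.PosDef) :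
    0 < (g⁻¹ * A).trace.re := by
  obtain ⟨d, hd, h1, -, -⟩ := exists_relative_eigenvalues hg hA
  rw [h1]
  exact Finset.sum_pos (fun i _ => hd i) Finset.univ_nonempty

theorem trace_inv_mul_self {A : Matrix ι ι ℂ} (hA : A.PosDef) :
    (A⁻¹ * A).trace.re = Fintype.card ι := by
  rw [nonsing_inv_mul _ ((isUnit_iff_isUnit_det A).1 hA.isUnit)]; simp

/-- If `c A ≤ B` then `det A ≤ (n / c)ⁿ det B`. -/
theorem det_le_of_le {A B : Matrix ι ι ℂ} {C : ℝ} (hA : A.PosDef) (hB : B.PosDef)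
    (h : (C • B - A).PosSemidef) :
    A.det.re ≤ (C * Fintype.card ι) ^ Fintype.card ι * B.det.re := by
  have h1 := det_le_trace_pow hB hA
  have h2 := trace_mul_le hB.inv.posSemidef h
  rw [trace_mul_real_smul, trace_inv_mul_self hB] at h2
  have h0 : 0 ≤ (B⁻¹ * A).trace.re := trace_mul_re_nonneg hB.inv.posSemidef hA.posSemidef
  calc A.det.re ≤ B.det.re * (B⁻¹ * A).trace.re ^ Fintype.card ι := h1
    _ ≤ B.det.re * (C * Fintype.card ι) ^ Fintype.card ι :=
      mul_le_mul_of_nonneg_left (pow_le_pow_left₀ h0 h2 _) (det_re_pos hB).le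
    _ = _ := mul_comm _ _

theorem det_add_smul_rankOne {A : Matrix ι ι ℂ} (hA : A.PosDef) (c : ℝ) (v : ι → ℂ) :
    (A + c • rankOne v).det.re = A.det.re * (1 + c * (star v ⬝ᵥ (A⁻¹ *ᵥ v)).re) := by
  have hu : IsUnit A.det := (isUnit_iff_isUnit_det A).1 hA.isUnit
  have e : c • rankOne v = replicateCol Unit (c • v) * replicateRow Unit (star v) := by
    rw [rankOne, ← smul_vecMulVec, vecMulVec_eq Unit]
  rw [e, det_add_replicateCol_mul_replicateRow hu]
  have e2 : (1 + replicateRow Unit (star v) * A⁻¹ * replicateCol Unit (c • v)).det =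
      1 + c * (star v ⬝ᵥ (A⁻¹ *ᵥ v)) := by
    rw [det_unique, Matrix.add_apply, Matrix.mul_assoc, ← replicateCol_mulVec]
    simp [Matrix.mul_apply, dotProduct, mulVec_smul, Finset.mul_sum, mul_left_comm]
  rw [e2, ← ofReal_det_re hA.isHermitian, Complex.re_ofReal_mul]
  simp

/-- A continuous family of Hermitian matrices on a compact set is dominated by a continuous family
of positive definite ones. -/
theorem exists_domination {Y : Type*} [TopologicalSpace Y] {K : Set Y} (hK : IsCompact K)
    {A B : Y → Matrix ι ι ℂ} (hA : ∀ i j, ContinuousOn (fun y => A y i j) K)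
    (hB : ∀ i j, ContinuousOn (fun y => B y i j) K) (hAH : ∀ y ∈ K, (A y).IsHermitian)
    (hBP : ∀ y ∈ K, (B y).PosDef) :
    ∃ C₀ : ℝ, 0 < C₀ ∧ ∀ C, C₀ ≤ C → ∀ y ∈ K, (C • B y - A y).PosSemidef := by
  classical
  have hcont : ∀ {M : Y → Matrix ι ι ℂ}, (∀ i j, ContinuousOn (fun y => M y i j) K) →
      ContinuousOn (fun p : Y × (ι → ℂ) => (star p.2 ⬝ᵥ (M p.1 *ᵥ p.2)).re)
        (K ×ˢ Metric.sphere 0 1) := by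
    intro M hM
    simp only [dotProduct, mulVec, Pi.star_apply]
    refine Complex.continuous_re.comp_continuousOn (continuousOn_finsetSum _ fun i _ =>
      ContinuousOn.mul (by fun_prop) (continuousOn_finsetSum _ fun j _ => ContinuousOn.mul
        ((hM i j).comp continuousOn_fst fun p hp => hp.1) (by fun_prop)))
  have hS : IsCompact (K ×ˢ Metric.sphere (0 : ι → ℂ) 1) := hK.prod (isCompact_sphere 0 1)
  have hpos : ∀ p ∈ K ×ˢ Metric.sphere (0 : ι → ℂ) 1, 0 < (star p.2 ⬝ᵥ (B p.1 *ᵥ p.2)).re := by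
    rintro ⟨y, v⟩ ⟨hy, hv⟩
    refine (hBP y hy).re_dotProduct_pos ?_
    rintro rfl
    simp at hv
  have hq : ContinuousOn (fun p : Y × (ι → ℂ) =>
      (star p.2 ⬝ᵥ (A p.1 *ᵥ p.2)).re / (star p.2 ⬝ᵥ (B p.1 *ᵥ p.2)).re)
        (K ×ˢ Metric.sphere 0 1) := (hcont hA).div (hcont hB) fun p hp => (hpos p hp).ne'
  -- By homogeneity it suffices to bound the quotient of the two quadratic forms over the compact
  -- product of `K` with the unit sphere.
  obtain ⟨C₀, hC₀⟩ := hS.bddAbove_image hq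
  refine ⟨max C₀ 1, by positivity, fun C hC y hy => ?_⟩
  have hBH := (hBP y hy).isHermitian
  refine PosSemidef.of_dotProduct_mulVec_nonneg ?_ fun v => ?_
  · rw [IsHermitian, conjTranspose_sub, conjTranspose_smul, hBH.eq, (hAH y hy).eq]; simp
  have him : ∀ {M : Matrix ι ι ℂ}, M.IsHermitian → (star v ⬝ᵥ (M *ᵥ v)).im = 0 := by
    intro M hM
    have h := star_dotProduct v (M *ᵥ v)
    rw [star_mulVec, hM.eq, ← dotProduct_mulVec] at h
    exact Complex.conj_eq_iff_im.1 h.symm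
  rw [sub_mulVec, dotProduct_sub, smul_mulVec, dotProduct_smul, Complex.le_def]
  refine ⟨?_, by simp [him hBH, him (hAH y hy)]⟩
  simp only [Complex.zero_re, Complex.sub_re, Complex.real_smul, Complex.re_ofReal_mul]
  by_cases hv : v = 0
  · simp [hv]
  have hnv : 0 < ‖v‖ := norm_pos_iff.2 hv
  set u : ι → ℂ := ‖v‖⁻¹ • v with hu
  have hu1 : u ∈ Metric.sphere (0 : ι → ℂ) 1 := by
    rw [mem_sphere_zero_iff_norm, hu, norm_smul, norm_inv, norm_norm, inv_mul_cancel₀ hnv.ne']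
  have hvu : v = ‖v‖ • u := by rw [hu, smul_smul, mul_inv_cancel₀ hnv.ne', one_smul]
  have hsc : ∀ M : Matrix ι ι ℂ,
      (star v ⬝ᵥ (M *ᵥ v)).re = ‖v‖ ^ 2 * (star u ⬝ᵥ (M *ᵥ u)).re := by
    intro M
    conv_lhs => rw [hvu]
    rw [mulVec_smul, star_smul, smul_dotProduct, dotProduct_smul]
    simp [sq, mul_assoc]
  rw [hsc, hsc]
  have h1 := hC₀ ⟨(y, u), ⟨hy, hu1⟩, rfl⟩
  have h2 := hpos (y, u) ⟨hy, hu1⟩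
  simp only at h1 h2
  rw [div_le_iff₀ h2] at h1
  have h3 : C₀ ≤ C := (le_max_left _ _).trans hC
  nlinarith [mul_le_mul_of_nonneg_right h3 h2.le, sq_nonneg ‖v‖]

end LinearAlgebra

end ConicalKRF

namespace ConicalKRF

/-! ### Wirtinger calculus and the complex Hessian. -/

section Hessian

open Matrix

variable {n : ℕ} {f g : Cn n → ℂ} {u v : Cn n → ℝ} {z : Cn n} {U : Set (Cn n)}

theorem dz_eq_wd (i : Fin n) (f : Cn n → ℂ) :
    dz i f = wd ((1 / 2 : ℝ) • stdVec i) (-((1 / 2 : ℝ) • (Complex.I • stdVec i))) f := by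
  ext z
  simp only [dz, wd, map_smul, map_neg, Complex.real_smul]
  push_cast; ring

theorem dzbar_eq_wd (i : Fin n) (f : Cn n → ℂ) :
    dzbar i f = wd ((1 / 2 : ℝ) • stdVec i) ((1 / 2 : ℝ) • (Complex.I • stdVec i)) f := by
  ext z
  simp only [dzbar, wd, map_smul, Complex.real_smul]
  push_cast; ring

theorem contDiffOn_dz (hU : IsOpen U) (hf : ContDiffOn ℝ ∞ f U) (i : Fin n) :
    ContDiffOn ℝ ∞ (dz i f) U := by
  rw [dz_eq_wd]; exact ContDiffOn.wd hU hf

theorem contDiffOn_dzbar (hU : IsOpen U) (hf : ContDiffOn ℝ ∞ f U) (i : Fin n) :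
    ContDiffOn ℝ ∞ (dzbar i f) U := by
  rw [dzbar_eq_wd]; exact ContDiffOn.wd hU hf

theorem contDiffOn_ofReal {E : Type*} [NormedAddCommGroup E] [NormedSpace ℝ E] {u : E → ℝ}
    {U : Set E} (hu : ContDiffOn ℝ ∞ u U) :
    ContDiffOn ℝ ∞ (fun w => (u w : ℂ)) U :=
  Complex.ofRealCLM.contDiff.comp_contDiffOn hu

theorem dz_mul (hf : DifferentiableAt ℝ f z) (hg : DifferentiableAt ℝ g z) (i : Fin n) :
    dz i (fun w => f w * g w) z = dz i f z * g z + f z * dz i g z := by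
  simp only [dz_eq_wd]; exact wd_mul hf hg

theorem dz_sum {ι : Type*} (s : Finset ι) {F : ι → Cn n → ℂ}
    (hF : ∀ k ∈ s, DifferentiableAt ℝ (F k) z) (i : Fin n) :
    dz i (fun y => ∑ k ∈ s, F k y) z = ∑ k ∈ s, dz i (F k) z := by
  simp only [dz_eq_wd]; exact wd_sum s hF

theorem dz_comp_real {φ : ℝ → ℝ} {c : ℝ} (hφ : HasDerivAt φ c (u z))
    (hu : DifferentiableAt ℝ u z) (i : Fin n) :
    dz i (fun y => ((φ (u y) : ℝ) : ℂ)) z = c * dz i (fun y => (u y : ℂ)) z := by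
  simp only [dz_eq_wd]; exact wd_comp_real hφ hu

theorem dzbar_comp_real {φ : ℝ → ℝ} {c : ℝ} (hφ : HasDerivAt φ c (u z))
    (hu : DifferentiableAt ℝ u z) (i : Fin n) :
    dzbar i (fun y => ((φ (u y) : ℝ) : ℂ)) z = c * dzbar i (fun y => (u y : ℂ)) z := by
  simp only [dzbar_eq_wd]; exact wd_comp_real hφ hu

theorem dz_conj (hf : DifferentiableAt ℝ f z) (i : Fin n) :
    dz i (fun w => starRingEnd ℂ (f w)) z = starRingEnd ℂ (dzbar i f z) := by
  rw [dz_eq_wd, dzbar_eq_wd, wd_conj hf, neg_neg]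

theorem dzbar_conj (hf : DifferentiableAt ℝ f z) (i : Fin n) :
    dzbar i (fun w => starRingEnd ℂ (f w)) z = starRingEnd ℂ (dz i f z) := by
  rw [dz_eq_wd, dzbar_eq_wd, wd_conj hf]

theorem dzbar_ofReal (hu : DifferentiableAt ℝ u z) (i : Fin n) :
    dzbar i (fun w => (u w : ℂ)) z = starRingEnd ℂ (dz i (fun w => (u w : ℂ)) z) := by
  have h : DifferentiableAt ℝ (fun w => (u w : ℂ)) z :=
    Complex.ofRealCLM.differentiableAt.comp z hu
  rw [← dzbar_conj h]
  simp

theorem dz_dzbar_comm (hU : IsOpen U) (hf : ContDiffOn ℝ ∞ f U) (hz : z ∈ U) (i j : Fin n) :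
    dz i (dzbar j f) z = dzbar j (dz i f) z := by
  simp only [dz_eq_wd, dzbar_eq_wd]; exact wd_comm hU hf hz

theorem dz_congr_on (hU : IsOpen U) (h : ∀ y ∈ U, f y = g y) (hz : z ∈ U) (i : Fin n) :
    dz i f z = dz i g z := by
  rw [dz_eq_wd, dz_eq_wd]; exact wd_congr_on hU h hz

theorem dzbar_congr_on (hU : IsOpen U) (h : ∀ y ∈ U, f y = g y) (hz : z ∈ U) (i : Fin n) :
    dzbar i f z = dzbar i g z := by
  rw [dzbar_eq_wd, dzbar_eq_wd]; exact wd_congr_on hU h hz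

theorem dzbar_of_differentiableAt (hf : DifferentiableAt ℂ f z) (i : Fin n) : dzbar i f z = 0 := by
  have h : fderiv ℝ f z = (fderiv ℂ f z).restrictScalars ℝ :=
    (hf.hasFDerivAt.restrictScalars ℝ).fderiv
  simp only [dzbar, h, ContinuousLinearMap.coe_restrictScalars', map_smul, smul_eq_mul]
  linear_combination (1 / 2 * fderiv ℂ f z (stdVec i)) * Complex.I_mul_I

theorem dz_of_differentiableAt (hf : DifferentiableAt ℂ f z) (i : Fin n) :
    dz i f z = fderiv ℂ f z (stdVec i) := by
  have h : fderiv ℝ f z = (fderiv ℂ f z).restrictScalars ℝ :=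
    (hf.hasFDerivAt.restrictScalars ℝ).fderiv
  simp only [dz, h, ContinuousLinearMap.coe_restrictScalars', map_smul, smul_eq_mul]
  linear_combination (-1 / 2 * fderiv ℂ f z (stdVec i)) * Complex.I_mul_I

theorem complexHessian_apply (u : Cn n → ℝ) (z : Cn n) (i j : Fin n) :
    complexHessian u z i j = dz i (dzbar j fun v => (u v : ℂ)) z := rfl

theorem complexHessian_congr (h : u =ᶠ[𝓝 z] v) : complexHessian u z = complexHessian v z := by
  ext i j
  simp only [complexHessian_apply, dz_eq_wd, dzbar_eq_wd]
  refine wd_congr ?_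
  filter_upwards [h.eventuallyEq_nhds] with y hy
  exact wd_congr (hy.mono fun w hw => by simp only [hw])

theorem complexHessian_congr_on (hU : IsOpen U) (h : ∀ y ∈ U, u y = v y) (hz : z ∈ U) :
    complexHessian u z = complexHessian v z :=
  complexHessian_congr (Filter.eventuallyEq_of_mem (hU.mem_nhds hz) h)

theorem contDiffOn_complexHessian (hU : IsOpen U) (hu : ContDiffOn ℝ ∞ u U) (i j : Fin n) :
    ContDiffOn ℝ ∞ (fun w => complexHessian u w i j) U :=
  contDiffOn_dz hU (contDiffOn_dzbar hU (contDiffOn_ofReal hu) j) i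

theorem complexHessian_add (hU : IsOpen U) (hu : ContDiffOn ℝ ∞ u U) (hv : ContDiffOn ℝ ∞ v U)
    (hz : z ∈ U) :
    complexHessian (fun w => u w + v w) z = complexHessian u z + complexHessian v z := by
  ext i j
  simp only [Matrix.add_apply, complexHessian_apply]
  rw [dz_congr_on hU (g := fun w => dzbar j (fun v => (u v : ℂ)) w + dzbar j (fun w => (v w : ℂ)) w)
    _ hz]
  · simp only [dz_eq_wd]
    exact wd_add ((contDiffOn_dzbar hU (contDiffOn_ofReal hu) j).diffAt hU hz)
      ((contDiffOn_dzbar hU (contDiffOn_ofReal hv) j).diffAt hU hz)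
  · intro y hy
    simp only [dzbar_eq_wd, Complex.ofReal_add]
    exact wd_add ((contDiffOn_ofReal hu).diffAt hU hy) ((contDiffOn_ofReal hv).diffAt hU hy)

theorem complexHessian_const_mul (hU : IsOpen U) (hu : ContDiffOn ℝ ∞ u U) (c : ℝ) (hz : z ∈ U) :
    complexHessian (fun w => c * u w) z = c • complexHessian u z := by
  ext i j
  simp only [Matrix.smul_apply, Complex.real_smul, complexHessian_apply]
  rw [dz_congr_on hU (g := fun w => (c : ℂ) * dzbar j (fun v => (u v : ℂ)) w) _ hz]
  · simp only [dz_eq_wd]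
    exact wd_const_mul _ ((contDiffOn_dzbar hU (contDiffOn_ofReal hu) j).diffAt hU hz)
  · intro y hy
    simp only [dzbar_eq_wd, Complex.ofReal_mul]
    exact wd_const_mul _ ((contDiffOn_ofReal hu).diffAt hU hy)

theorem complexHessian_neg (hU : IsOpen U) (hu : ContDiffOn ℝ ∞ u U) (hz : z ∈ U) :
    complexHessian (fun w => -u w) z = -complexHessian u z := by
  have := complexHessian_const_mul hU hu (-1) hz
  simpa using this

theorem complexHessian_sub (hU : IsOpen U) (hu : ContDiffOn ℝ ∞ u U) (hv : ContDiffOn ℝ ∞ v U)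
    (hz : z ∈ U) :
    complexHessian (fun w => u w - v w) z = complexHessian u z - complexHessian v z := by
  have := complexHessian_add hU hu hv.neg hz
  simp only [← sub_eq_add_neg] at this
  rw [this, complexHessian_neg hU hv hz, sub_eq_add_neg]

@[simp] theorem complexHessian_const (c : ℝ) : complexHessian (fun _ : Cn n => c) z = 0 := by
  ext i j
  have : (dzbar j fun _ : Cn n => (c : ℂ)) = fun _ => 0 := by
    ext w; rw [dzbar_eq_wd, wd_const]
  rw [complexHessian_apply, this, dz_eq_wd, wd_const]; rfl

theorem isHermitian_complexHessian (hU : IsOpen U) (hu : ContDiffOn ℝ ∞ u U) (hz : z ∈ U) :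
    (complexHessian u z).IsHermitian := by
  ext i j
  rw [conjTranspose_apply, complexHessian_apply, complexHessian_apply]
  have h1 : star (dz j (dzbar i fun v => (u v : ℂ)) z) =
      dzbar j (fun w => starRingEnd ℂ (dzbar i (fun v => (u v : ℂ)) w)) z :=
    (dzbar_conj ((contDiffOn_dzbar hU (contDiffOn_ofReal hu) i).diffAt hU hz) j).symm
  rw [h1, dz_dzbar_comm hU (contDiffOn_ofReal hu) hz]
  refine dzbar_congr_on hU (fun y hy => ?_) hz j
  rw [dzbar_ofReal (hu.diffAt hU hy), Complex.conj_conj]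

/-- The complex Hessian of `φ ∘ u`. -/
theorem complexHessian_comp (hU : IsOpen U) (hu : ContDiffOn ℝ ∞ u U) (hz : z ∈ U)
    {φ φ' : ℝ → ℝ} {c : ℝ} (h1 : ∀ y ∈ U, HasDerivAt φ (φ' (u y)) (u y))
    (h2 : HasDerivAt φ' c (u z)) :
    complexHessian (fun w => φ (u w)) z =
      φ' (u z) • complexHessian u z + c • rankOne (fun i => dz i (fun w => (u w : ℂ)) z) := by
  ext i j
  rw [complexHessian_apply]
  have hd := hu.diffAt hU hz
  rw [dz_congr_on hU (g := fun w => ((φ' (u w) : ℝ) : ℂ) * dzbar j (fun v => (u v : ℂ)) w) _ hz]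
  · have h3 : DifferentiableAt ℝ (fun w => ((φ' (u w) : ℝ) : ℂ)) z :=
      Complex.ofRealCLM.differentiableAt.comp z (h2.differentiableAt.comp z hd)
    have h4 := dzbar_ofReal hd j
    have h5 := (contDiffOn_dzbar hU (contDiffOn_ofReal hu) j).diffAt hU hz
    rw [dz_mul h3 h5, dz_comp_real h2 hd, ← complexHessian_apply]
    simp only [Matrix.add_apply, Matrix.smul_apply, Complex.real_smul, rankOne, vecMulVec_apply,
      Pi.star_apply, h4]
    rw [starRingEnd_apply]; ring
  · intro y hy
    exact dzbar_comp_real (h1 y hy) (hu.diffAt hU hy) j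

/-- The splitting of a real linear map into its complex linear and antilinear parts. For `Λ` the
derivative of a function, the coefficients are its Wirtinger derivatives, so this is the source of
the chain rule for holomorphic maps. -/
theorem real_linear_decomposition (Λ : Cn n →L[ℝ] ℂ) (w : Cn n) :
    Λ w = ∑ a, (w a * ((1 / 2) * (Λ (stdVec a) - Complex.I * Λ (Complex.I • stdVec a))) +
      starRingEnd ℂ (w a) * ((1 / 2) * (Λ (stdVec a) + Complex.I * Λ (Complex.I • stdVec a)))) := by
  have hw : w = ∑ a, ((w a).re • stdVec a + (w a).im • (Complex.I • stdVec a)) := by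
    ext b
    simp only [stdVec, WithLp.ofLp_sum, Finset.sum_apply, PiLp.add_apply, PiLp.smul_apply,
      PiLp.single_apply, Complex.real_smul, smul_eq_mul]
    simp [Finset.sum_add_distrib, mul_ite, Complex.re_add_im]
  conv_lhs => rw [hw]
  rw [map_sum]
  refine Finset.sum_congr rfl fun a _ => ?_
  rw [map_add, map_smul, map_smul, Complex.real_smul, Complex.real_smul]
  have h1 : starRingEnd ℂ (w a) = (w a).re - (w a).im * Complex.I := by
    apply Complex.ext <;> simp
  have h2 : w a = (w a).re + (w a).im * Complex.I := (Complex.re_add_im _).symm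
  rw [h1]
  generalize (w a).re = x at *
  generalize (w a).im = y at *
  rw [h2]
  linear_combination ((y : ℂ) * Λ (Complex.I • stdVec a)) * Complex.I_mul_I

variable {m : ℕ} {F : Cn m → Cn n} {V : Set (Cn m)} {x : Cn m}

/-- The holomorphic Jacobian matrix. -/
def holJac (F : Cn m → Cn n) (x : Cn m) : Matrix (Fin n) (Fin m) ℂ :=
  Matrix.of fun a i => (fderiv ℂ F x (stdVec i)) a

theorem dz_comp_holomorphic (hF : DifferentiableAt ℂ F x) (hf : DifferentiableAt ℝ f (F x))
    (i : Fin m) : dz i (fun w => f (F w)) x = ∑ a, holJac F x a i * dz a f (F x) := by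
  have h : fderiv ℝ (fun w => f (F w)) x = (fderiv ℝ f (F x)).comp
      ((fderiv ℂ F x).restrictScalars ℝ) :=
    (hf.hasFDerivAt.comp x (hF.hasFDerivAt.restrictScalars ℝ)).fderiv
  simp only [dz, h, ContinuousLinearMap.comp_apply, ContinuousLinearMap.coe_restrictScalars',
    map_smul]
  rw [real_linear_decomposition (fderiv ℝ f (F x)) (fderiv ℂ F x (stdVec i)),
    real_linear_decomposition (fderiv ℝ f (F x)) (Complex.I • fderiv ℂ F x (stdVec i)),
    Finset.mul_sum, ← Finset.sum_sub_distrib, Finset.mul_sum]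
  refine Finset.sum_congr rfl fun a _ => ?_
  simp only [PiLp.smul_apply, smul_eq_mul, map_mul, Complex.conj_I, holJac, Matrix.of_apply]
  ring_nf
  simp only [Complex.I_sq, show Complex.I ^ 3 = -Complex.I by
    rw [pow_succ, Complex.I_sq]; ring]
  ring

theorem dzbar_comp_holomorphic (hF : DifferentiableAt ℂ F x) (hf : DifferentiableAt ℝ f (F x))
    (i : Fin m) : dzbar i (fun w => f (F w)) x =
      ∑ a, starRingEnd ℂ (holJac F x a i) * dzbar a f (F x) := by
  have hd : DifferentiableAt ℝ (fun w => f (F w)) x :=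
    hf.comp x (hF.restrictScalars ℝ)
  have hc : DifferentiableAt ℝ (fun w => starRingEnd ℂ (f w)) (F x) :=
    (Complex.conjCLE : ℂ →L[ℝ] ℂ).differentiableAt.comp (F x) hf
  have h1 := dz_comp_holomorphic hF hc i
  rw [dz_conj hd] at h1
  rw [← Complex.conj_conj (dzbar i (fun w => f (F w)) x), h1, map_sum]
  refine Finset.sum_congr rfl fun a _ => ?_
  rw [dz_conj hf, map_mul, Complex.conj_conj]

theorem holJac_apply_differentiableAt (hV : IsOpen V) (hF : ContDiffOn ℂ ∞ F V) (hx : x ∈ V)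
    (a : Fin n) (i : Fin m) : DifferentiableAt ℂ (fun w => holJac F w a i) x := by
  have h1 : ContDiffOn ℂ ∞ (fun y => fderiv ℂ F y) V := hF.fderiv_of_isOpen hV (by simp)
  have h2 : DifferentiableAt ℂ (fun y => fderiv ℂ F y) x :=
    (h1.contDiffAt (hV.mem_nhds hx)).differentiableAt (by simp)
  have h3 : DifferentiableAt ℂ (fun y => fderiv ℂ F y (stdVec i)) x :=
    h2.clm_apply (differentiableAt_const _)
  exact (differentiableAt_piLp 2).1 h3 a

/-- The complex Hessian of `u ∘ F` with `F` holomorphic. -/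
theorem complexHessian_comp_holomorphic (hV : IsOpen V) (hF : ContDiffOn ℂ ∞ F V) (hx : x ∈ V)
    (hU : IsOpen U) (hu : ContDiffOn ℝ ∞ u U) (hVU : Set.MapsTo F V U) :
    complexHessian (fun w => u (F w)) x =
      (holJac F x)ᵀ * complexHessian u (F x) * (holJac F x).map (starRingEnd ℂ) := by
  have hFd : ∀ y ∈ V, DifferentiableAt ℂ F y := fun y hy =>
    (hF.contDiffAt (hV.mem_nhds hy)).differentiableAt (by simp)
  have huC := contDiffOn_ofReal hu
  ext i j
  rw [complexHessian_apply, dz_congr_on hV (g := fun w => ∑ b, starRingEnd ℂ (holJac F w b j) *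
    dzbar b (fun v => (u v : ℂ)) (F w)) _ hx]
  · have hJ := fun b => (holJac_apply_differentiableAt hV hF hx b j)
    have hJc : ∀ b, DifferentiableAt ℝ (fun w => starRingEnd ℂ (holJac F w b j)) x := fun b =>
      (Complex.conjCLE : ℂ →L[ℝ] ℂ).differentiableAt.comp x ((hJ b).restrictScalars ℝ)
    have hub := fun b => (contDiffOn_dzbar hU huC b).diffAt hU (hVU hx)
    have hc : ∀ b, DifferentiableAt ℝ (fun w => dzbar b (fun v => (u v : ℂ)) (F w)) x := fun b =>
      (hub b).comp x ((hFd x hx).restrictScalars ℝ)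
    rw [dz_sum (F := fun b w => starRingEnd ℂ (holJac F w b j) * dzbar b (fun v => (u v : ℂ)) (F w))
      _ fun b _ => (hJc b).mul (hc b)]
    simp only [Matrix.mul_apply, Finset.sum_mul, Matrix.transpose_apply, Matrix.map_apply]
    refine Finset.sum_congr rfl fun b _ => ?_
    rw [dz_mul (hJc b) (hc b), dz_conj ((hJ b).restrictScalars ℝ),
      dzbar_of_differentiableAt (hJ b), map_zero, zero_mul, zero_add,
      dz_comp_holomorphic (hFd x hx) (hub b), Finset.mul_sum]
    refine Finset.sum_congr rfl fun a _ => ?_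
    rw [complexHessian_apply]; ring
  · intro y hy
    exact dzbar_comp_holomorphic (hFd y hy) (huC.diffAt hU (hVU hy)) j

end Hessian

end ConicalKRF

namespace ConicalKRF

/-! ### The Bochner inequality for holomorphic one-forms on a Kähler manifold. -/

section Bochner

open Matrix

variable {n : ℕ} {U : Set (Cn n)} {z : Cn n}

/-- Entrywise `∂/∂z_a`. -/
def dzM {l m : Type*} (a : Fin n) (A : Cn n → Matrix l m ℂ) (z : Cn n) : Matrix l m ℂ :=
  Matrix.of fun i j => dz a (fun w => A w i j) z

/-- Entrywise `∂/∂z̄_a`. -/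
def dzbarM {l m : Type*} (a : Fin n) (A : Cn n → Matrix l m ℂ) (z : Cn n) : Matrix l m ℂ :=
  Matrix.of fun i j => dzbar a (fun w => A w i j) z

variable {l m k : Type*}

theorem dzM_eq_wdM (a : Fin n) (A : Cn n → Matrix l m ℂ) : dzM a A =
    wdM ((1 / 2 : ℝ) • stdVec a) (-((1 / 2 : ℝ) • (Complex.I • stdVec a))) A := by
  ext w i j; simp only [dzM, dz_eq_wd]; rfl

theorem dzbarM_eq_wdM (a : Fin n) (A : Cn n → Matrix l m ℂ) : dzbarM a A =
    wdM ((1 / 2 : ℝ) • stdVec a) ((1 / 2 : ℝ) • (Complex.I • stdVec a)) A := by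
  ext w i j; simp only [dzbarM, dzbar_eq_wd]; rfl

/-- Entrywise smoothness of a matrix valued function. -/
def SmoothMat {E : Type*} [NormedAddCommGroup E] [NormedSpace ℝ E]
    (A : E → Matrix l m ℂ) (U : Set E) : Prop :=
  ∀ i j, ContDiffOn ℝ ∞ (fun w => A w i j) U

section Rules

variable {A : Cn n → Matrix l m ℂ} {B : Cn n → Matrix m k ℂ}

theorem SmoothMat.dzM (hU : IsOpen U) (hA : SmoothMat A U) (a : Fin n) : SmoothMat (dzM a A) U :=
  fun i j => contDiffOn_dz hU (hA i j) a

theorem SmoothMat.dzbarM (hU : IsOpen U) (hA : SmoothMat A U) (a : Fin n) :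
    SmoothMat (dzbarM a A) U :=
  fun i j => contDiffOn_dzbar hU (hA i j) a

theorem SmoothMat.mul [Fintype m] (hA : SmoothMat A U) (hB : SmoothMat B U) :
    SmoothMat (fun w => A w * B w) U :=
  fun i j => contDiffOn_matrix_mul hA hB i j

theorem SmoothMat.sub {B : Cn n → Matrix l m ℂ} (hA : SmoothMat A U) (hB : SmoothMat B U) :
    SmoothMat (fun w => A w - B w) U := fun i j => (hA i j).sub (hB i j)

theorem SmoothMat.conjTranspose (hA : SmoothMat A U) : SmoothMat (fun w => (A w)ᴴ) U :=
  fun i j => (Complex.conjCLE : ℂ →L[ℝ] ℂ).contDiff.comp_contDiffOn (hA j i)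

theorem SmoothMat.diffAt (hA : SmoothMat A U) (hU : IsOpen U) (hz : z ∈ U) (i : l) (j : m) :
    DifferentiableAt ℝ (fun w => A w i j) z := (hA i j).diffAt hU hz

theorem dzM_mul [Fintype m] (hU : IsOpen U) (hz : z ∈ U) (hA : SmoothMat A U) (hB : SmoothMat B U)
    (a : Fin n) : dzM a (fun w => A w * B w) z = dzM a A z * B z + A z * dzM a B z := by
  simp only [dzM_eq_wdM]; exact wdM_mul (hA.diffAt hU hz) (hB.diffAt hU hz)

theorem dzbarM_mul [Fintype m] (hU : IsOpen U) (hz : z ∈ U) (hA : SmoothMat A U)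
    (hB : SmoothMat B U) (a : Fin n) :
    dzbarM a (fun w => A w * B w) z = dzbarM a A z * B z + A z * dzbarM a B z := by
  simp only [dzbarM_eq_wdM]; exact wdM_mul (hA.diffAt hU hz) (hB.diffAt hU hz)

theorem dzbarM_sub {B : Cn n → Matrix l m ℂ} (hU : IsOpen U) (hz : z ∈ U) (hA : SmoothMat A U)
    (hB : SmoothMat B U) (a : Fin n) :
    dzbarM a (fun w => A w - B w) z = dzbarM a A z - dzbarM a B z := by
  simp only [dzbarM_eq_wdM]; exact wdM_sub (hA.diffAt hU hz) (hB.diffAt hU hz)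

theorem dzM_conjTranspose (hU : IsOpen U) (hz : z ∈ U) (hA : SmoothMat A U) (a : Fin n) :
    dzM a (fun w => (A w)ᴴ) z = (dzbarM a A z)ᴴ := by
  rw [dzM_eq_wdM, dzbarM_eq_wdM, wdM_conjTranspose (hA.diffAt hU hz), neg_neg]

theorem dzbarM_conjTranspose (hU : IsOpen U) (hz : z ∈ U) (hA : SmoothMat A U) (a : Fin n) :
    dzbarM a (fun w => (A w)ᴴ) z = (dzM a A z)ᴴ := by
  rw [dzM_eq_wdM, dzbarM_eq_wdM, wdM_conjTranspose (hA.diffAt hU hz)]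

theorem dzM_congr_on {B : Cn n → Matrix l m ℂ} (hU : IsOpen U) (h : ∀ w ∈ U, A w = B w)
    (hz : z ∈ U) (a : Fin n) : dzM a A z = dzM a B z := by
  ext i j
  exact dz_congr_on hU (fun y hy => by rw [h y hy]) hz a

theorem dzbarM_congr_on {B : Cn n → Matrix l m ℂ} (hU : IsOpen U) (h : ∀ w ∈ U, A w = B w)
    (hz : z ∈ U) (a : Fin n) : dzbarM a A z = dzbarM a B z := by
  ext i j
  exact dzbar_congr_on hU (fun y hy => by rw [h y hy]) hz a

end Rules

variable {G : Cn n → Matrix (Fin n) (Fin n) ℂ}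

theorem posDef_det_ne_zero {A : Matrix (Fin n) (Fin n) ℂ} (hA : A.PosDef) : A.det ≠ 0 :=
  hA.det_pos.ne'

theorem SmoothMat.inv (hG : SmoothMat G U) (hpos : ∀ w ∈ U, (G w).PosDef) :
    SmoothMat (fun w => (G w)⁻¹) U :=
  fun i j => contDiffOn_matrix_inv hG (fun w hw => posDef_det_ne_zero (hpos w hw)) i j

theorem dzM_inv (hU : IsOpen U) (hz : z ∈ U) (hG : SmoothMat G U) (hpos : ∀ w ∈ U, (G w).PosDef)
    (a : Fin n) : dzM a (fun w => (G w)⁻¹) z = -((G z)⁻¹ * dzM a G z * (G z)⁻¹) := by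
  simp only [dzM_eq_wdM]
  exact wdM_inv hU hG (fun w hw => posDef_det_ne_zero (hpos w hw)) hz

theorem dzbarM_inv (hU : IsOpen U) (hz : z ∈ U) (hG : SmoothMat G U)
    (hpos : ∀ w ∈ U, (G w).PosDef) (a : Fin n) :
    dzbarM a (fun w => (G w)⁻¹) z = -((G z)⁻¹ * dzbarM a G z * (G z)⁻¹) := by
  simp only [dzbarM_eq_wdM]
  exact wdM_inv hU hG (fun w hw => posDef_det_ne_zero (hpos w hw)) hz

theorem contDiffOn_re {E : Type*} [NormedAddCommGroup E] [NormedSpace ℝ E] {U : Set E} {f : E → ℂ}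
    (hf : ContDiffOn ℝ ∞ f U) : ContDiffOn ℝ ∞ (fun w => (f w).re) U :=
  Complex.reCLM.contDiff.comp_contDiffOn hf

theorem contDiffOn_log_det {E : Type*} [NormedAddCommGroup E] [NormedSpace ℝ E] {U : Set E}
    {G : E → Matrix (Fin n) (Fin n) ℂ} (hG : SmoothMat G U) (hpos : ∀ w ∈ U, (G w).PosDef) :
    ContDiffOn ℝ ∞ (fun w => Real.log (G w).det.re) U :=
  (contDiffOn_re (contDiffOn_det hG)).log fun w hw => (det_re_pos (hpos w hw)).ne'

theorem dzbar_log_det (hU : IsOpen U) (hz : z ∈ U) (hG : SmoothMat G U)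
    (hpos : ∀ w ∈ U, (G w).PosDef) (a : Fin n) :
    dzbar a (fun w => ((Real.log (G w).det.re : ℝ) : ℂ)) z =
      ((G z)⁻¹ * dzbarM a G z).trace := by
  have h0 := (det_re_pos (hpos z hz)).ne'
  have hd : DifferentiableAt ℝ (fun w => (G w).det.re) z :=
    (contDiffOn_re (contDiffOn_det hG)).diffAt hU hz
  rw [dzbar_comp_real (Real.hasDerivAt_log h0) hd,
    dzbar_congr_on hU (g := fun w => (G w).det)
      (fun y hy => ofReal_det_re (hpos y hy).isHermitian) hz,
    dzbar_eq_wd, wd_det (hG.diffAt hU hz) (posDef_det_ne_zero (hpos z hz)), dzbarM_eq_wdM,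
    ← mul_assoc]
  have e : (((G z).det.re⁻¹ : ℝ) : ℂ) * (G z).det = 1 :=
    (congrArg (fun x => (((G z).det.re⁻¹ : ℝ) : ℂ) * x)
      (ofReal_det_re (hpos z hz).isHermitian).symm).trans (by
        rw [← Complex.ofReal_mul, inv_mul_cancel₀ h0, Complex.ofReal_one])
  rw [e, one_mul]

/-- Jacobi's formula for the first derivative, then the derivative of the inverse. The result is
minus the Ricci tensor, in the form to which the curvature term of the Bochner formula contracts. -/
theorem complexHessian_log_det (hU : IsOpen U) (hz : z ∈ U) (hG : SmoothMat G U)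
    (hpos : ∀ w ∈ U, (G w).PosDef) (a b : Fin n) :
    complexHessian (fun w => Real.log (G w).det.re) z a b =
      ((G z)⁻¹ * dzM a (dzbarM b G) z).trace -
        ((G z)⁻¹ * dzM a G z * (G z)⁻¹ * dzbarM b G z).trace := by
  rw [complexHessian_apply,
    dz_congr_on hU (fun y hy => dzbar_log_det hU hy hG hpos b) hz]
  have hGi := hG.inv hpos
  have h1 : dz a (fun w => ((G w)⁻¹ * dzbarM b G w).trace) z =
      (dzM a (fun w => (G w)⁻¹ * dzbarM b G w) z).trace := by
    rw [dz_eq_wd, dzM_eq_wdM]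
    exact wd_trace ((hGi.mul (hG.dzbarM hU b)).diffAt hU hz)
  rw [h1, dzM_mul hU hz hGi (hG.dzbarM hU b), dzM_inv hU hz hG hpos, trace_add, neg_mul,
    trace_neg]
  ring

/-- The squared norm of the `(1,0)`-form with coefficients `ξ` for the metric `G`. -/
def formNormSq (G : Matrix (Fin n) (Fin n) ℂ) (ξ : Fin n → ℂ) : ℝ :=
  (star ξ ⬝ᵥ (G⁻¹ *ᵥ ξ)).re

theorem formNormSq_pos {A : Matrix (Fin n) (Fin n) ℂ} (hA : A.PosDef) {ξ : Fin n → ℂ}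
    (hξ : ξ ≠ 0) : 0 < formNormSq A ξ := hA.inv.re_dotProduct_pos hξ

theorem replicateCol_sandwich (A : Matrix (Fin n) (Fin n) ℂ) (ξ : Fin n → ℂ) :
    ((replicateCol Unit ξ)ᴴ * A * replicateCol Unit ξ) () () = star ξ ⬝ᵥ (A *ᵥ ξ) := by
  rw [Matrix.mul_assoc, ← replicateCol_mulVec]
  simp [Matrix.mul_apply, dotProduct]

theorem ofReal_formNormSq {A : Matrix (Fin n) (Fin n) ℂ} (hA : A.PosDef) (ξ : Fin n → ℂ) :
    ((formNormSq A ξ : ℝ) : ℂ) = star ξ ⬝ᵥ (A⁻¹ *ᵥ ξ) := by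
  have h1 := hA.inv.posSemidef.dotProduct_mulVec_nonneg ξ
  rw [Complex.le_def] at h1
  apply Complex.ext <;> simp [formNormSq, ← h1.2]

theorem contDiffOn_formNormSq {E : Type*} [NormedAddCommGroup E] [NormedSpace ℝ E] {U : Set E}
    {G : E → Matrix (Fin n) (Fin n) ℂ} {ξ : E → Fin n → ℂ}
    (hG : SmoothMat G U) (hpos : ∀ w ∈ U, (G w).PosDef)
    (hξ : ∀ i, ContDiffOn ℝ ∞ (fun w => ξ w i) U) :
    ContDiffOn ℝ ∞ (fun w => formNormSq (G w) (ξ w)) U := by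
  simp only [formNormSq, dotProduct, mulVec, Pi.star_apply]
  refine contDiffOn_re (ContDiffOn.sum fun i _ => ContDiffOn.mul
    ((Complex.conjCLE : ℂ →L[ℝ] ℂ).contDiff.comp_contDiffOn (hξ i)) (ContDiffOn.sum fun j _ =>
      (contDiffOn_matrix_inv hG (fun w hw => posDef_det_ne_zero (hpos w hw)) i j).mul (hξ j)))

/-- The Bochner inequality for the norm of a holomorphic `(1,0)`-form on a Kähler manifold. -/
theorem bochner_inequality (hU : IsOpen U) (hz : z ∈ U) (hG : SmoothMat G U)
    (hpos : ∀ w ∈ U, (G w).PosDef)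
    (hclosed : ∀ w ∈ U, ∀ i j k, dz k (fun w => G w i j) w = dz i (fun w => G w k j) w)
    {ξ : Cn n → Fin n → ℂ} (hξ : ∀ i, ContDiffOn ℝ ∞ (fun w => ξ w i) U)
    (hξh : ∀ w ∈ U, ∀ i j, dzbar j (fun w => ξ w i) w = 0) (hξ0 : ∀ w ∈ U, ξ w ≠ 0) :
    -(star ((G z)⁻¹ *ᵥ ξ z) ⬝ᵥ (complexHessian (fun w => Real.log (G w).det.re) z *ᵥ
        ((G z)⁻¹ *ᵥ ξ z))).re / formNormSq (G z) (ξ z) ≤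
      ((G z)⁻¹ * complexHessian (fun w => Real.log (formNormSq (G w) (ξ w))) z).trace.re := by
  have hP := hG.inv hpos
  have hGH : ∀ w ∈ U, (G w)ᴴ = G w := fun w hw => (hpos w hw).isHermitian
  have hPH : ∀ w ∈ U, ((G w)⁻¹)ᴴ = (G w)⁻¹ := fun w hw => (hpos w hw).inv.isHermitian
  set X : Cn n → Matrix (Fin n) Unit ℂ := fun w => replicateCol Unit (ξ w) with hXdef
  have hX : SmoothMat X U := fun i _ => hξ i
  have hXh : ∀ w ∈ U, ∀ a, dzbarM a X w = 0 := fun w hw a => by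
    ext i j; exact hξh w hw i a
  have hPX := hP.mul hX
  -- the covariant derivative of `ξ`
  set D : Fin n → Cn n → Matrix (Fin n) Unit ℂ :=
    fun b w => dzM b X w - dzM b G w * ((G w)⁻¹ * X w) with hDdef
  have hD : ∀ b, SmoothMat (D b) U := fun b =>
    (hX.dzM hU b).sub ((hG.dzM hU b).mul hPX)
  have hGbar : ∀ w ∈ U, ∀ b, dzbarM b G w = (dzM b G w)ᴴ := fun w hw b => by
    rw [← dzbarM_conjTranspose hU hw hG]
    exact dzbarM_congr_on hU (fun y hy => (hGH y hy).symm) hw b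
  -- The derivative of `G⁻¹` supplies exactly the Christoffel term, so that only the covariant
  -- derivative `D` of `ξ` appears.
  have hPXz : ∀ w ∈ U, ∀ a, dzM a (fun w => (G w)⁻¹ * X w) w = (G w)⁻¹ * D a w := fun w hw a => by
    rw [dzM_mul hU hw hP hX, dzM_inv hU hw hG hpos, hDdef]
    simp only [Matrix.mul_sub, Matrix.mul_assoc, Matrix.neg_mul]
    abel
  have hPXbar : ∀ w ∈ U, ∀ a, dzbarM a (fun w => (G w)⁻¹ * X w) w =
      -((G w)⁻¹ * dzbarM a G w * ((G w)⁻¹ * X w)) := fun w hw a => by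
    rw [dzbarM_mul hU hw hP hX, dzbarM_inv hU hw hG hpos, hXh w hw]
    simp only [Matrix.mul_assoc, Matrix.neg_mul, Matrix.mul_zero, add_zero]
  set M : Cn n → Matrix Unit Unit ℂ := fun w => (X w)ᴴ * ((G w)⁻¹ * X w) with hMdef
  have hMbar : ∀ w ∈ U, ∀ b, dzbarM b M w = (D b w)ᴴ * ((G w)⁻¹ * X w) := fun w hw b => by
    rw [hMdef, dzbarM_mul hU hw hX.conjTranspose hPX, dzbarM_conjTranspose hU hw hX,
      hPXbar w hw, hDdef, conjTranspose_sub, conjTranspose_mul, conjTranspose_mul, hPH w hw,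
      ← hGbar w hw]
    simp only [Matrix.sub_mul, Matrix.mul_assoc, Matrix.mul_neg]
    abel
  set P := (G z)⁻¹ with hPdef
  set Y : Matrix (Fin n) Unit ℂ := P * X z with hYdef
  have hDbar : ∀ a b, dzbarM a (D b) z =
      -(dzbarM a (dzM b G) z * Y) + dzM b G z * (P * dzbarM a G z * Y) := fun a b => by
    rw [hDdef]
    rw [dzbarM_sub hU hz (hX.dzM hU b) ((hG.dzM hU b).mul hPX),
      dzbarM_mul hU hz (hG.dzM hU b) hPX, hPXbar z hz]
    have : dzbarM a (dzM b X) z = 0 := by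
      ext i j
      have h1 := dz_dzbar_comm hU (hX i j) hz b a
      have h2 : dz b (dzbar a fun w => X w i j) z = dz b (fun _ => 0) z :=
        dz_congr_on hU (fun y hy => hξh y hy i a) hz b
      rw [h2, dz_eq_wd, wd_const] at h1
      exact h1.symm
    rw [this, Matrix.mul_neg]
    abel
  have hGcomm : ∀ a b, (dzbarM a (dzM b G) z)ᴴ = dzM a (dzbarM b G) z := fun a b => by
    rw [← dzM_conjTranspose hU hz (hG.dzM hU b)]
    exact dzM_congr_on hU (fun y hy => (hGbar y hy b).symm) hz a
  have aux : ∀ (A B C P : Matrix (Fin n) (Fin n) ℂ) (Y : Matrix (Fin n) Unit ℂ),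
      (-(A * Y) + B * (P * C * Y))ᴴ = -(Yᴴ * Aᴴ) + Yᴴ * (Cᴴ * (Pᴴ * Bᴴ)) := fun A B C P Y => by
    simp only [conjTranspose_add, conjTranspose_neg, conjTranspose_mul, Matrix.mul_assoc]
  -- The Weitzenböck identity: the Hessian of `|ξ|²` is `⟨Dξ, Dξ⟩` plus the full curvature tensor
  -- evaluated on the dual vector `Y = G⁻¹ξ`.
  have hMab : ∀ a b, dzM a (dzbarM b M) z = (D b z)ᴴ * P * D a z +
      Yᴴ * (-dzM a (dzbarM b G) z + dzM a G z * P * dzbarM b G z) * Y := fun a b => by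
    rw [dzM_congr_on hU (fun w hw => hMbar w hw b) hz,
      dzM_mul hU hz (hD b).conjTranspose hPX, dzM_conjTranspose hU hz (hD b), hDbar, hPXz z hz,
      aux, hGcomm, hPH z hz, ← hGbar z hz, hGbar z hz a, conjTranspose_conjTranspose]
    simp only [Matrix.mul_add, Matrix.add_mul, Matrix.mul_assoc, Matrix.mul_neg, Matrix.neg_mul]
    abel
  set L := complexHessian (fun w => Real.log (G w).det.re) z with hLdef
  have hclosedbar : ∀ w ∈ U, ∀ i j k, dzbarM k G w i j = dzbarM j G w i k := fun w hw i j k => by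
    rw [hGbar w hw, hGbar w hw, conjTranspose_apply, conjTranspose_apply]
    exact congrArg star (hclosed w hw j i k)
  have hsymm2 : ∀ a b k l, dzM a (dzbarM b G) z k l = dzM k (dzbarM l G) z a b := by
    intro a b k l
    calc dzM a (dzbarM b G) z k l = dzbar b (fun w => dzM a G w k l) z :=
          dz_dzbar_comm hU (hG k l) hz a b
      _ = dzbar b (fun w => dzM k G w a l) z :=
          dzbar_congr_on hU (fun y hy => hclosed y hy k l a) hz b
      _ = dz k (fun w => dzbarM b G w a l) z := (dz_dzbar_comm hU (hG a l) hz k b).symm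
      _ = dz k (fun w => dzbarM l G w a b) z :=
          dz_congr_on hU (fun y hy => hclosedbar y hy a l b) hz k
  -- Closedness of the metric makes its first derivatives, and the mixed second derivatives as in
  -- `hsymm2`, symmetric under exchange of form and derivative indices. The trace of the curvature
  -- over the derivative indices is therefore the Ricci tensor, that is `-L`.
  have hKL : ∑ b, ∑ a, P b a • (-dzM a (dzbarM b G) z + dzM a G z * P * dzbarM b G z) = -L := by
    ext k l
    rw [hLdef, Matrix.neg_apply, complexHessian_log_det hU hz hG hpos]
    simp only [Matrix.sum_apply, Matrix.smul_apply, Matrix.add_apply, Matrix.neg_apply,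
      smul_eq_mul, mul_add, mul_neg, Finset.sum_add_distrib, Finset.sum_neg_distrib]
    have e1 : ∑ b, ∑ a, P b a * dzM a (dzbarM b G) z k l =
        (P * dzM k (dzbarM l G) z).trace := by
      simp only [Matrix.trace, Matrix.diag_apply, Matrix.mul_apply]
      exact Finset.sum_congr rfl fun b _ => Finset.sum_congr rfl fun a _ => by
        rw [hsymm2 a b k l]
    have e2 : ∑ b, ∑ a, P b a * (dzM a G z * P * dzbarM b G z) k l =
        (P * dzM k G z * P * dzbarM l G z).trace := by
      rw [Matrix.mul_assoc P, Matrix.mul_assoc P]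
      simp only [Matrix.trace, Matrix.diag_apply]
      refine Finset.sum_congr rfl fun b _ => ?_
      rw [Matrix.mul_apply]
      refine Finset.sum_congr rfl fun a _ => ?_
      congr 1
      rw [Matrix.mul_apply, Matrix.mul_apply]
      refine Finset.sum_congr rfl fun d _ => ?_
      rw [Matrix.mul_apply, Matrix.mul_apply, hclosedbar z hz d l b]
      congr 1
      exact Finset.sum_congr rfl fun c _ => by
        rw [show dzM a G z k c = dzM k G z a c from hclosed z hz k c a]
    rw [e1, e2]; ring
  -- the scalar function `u = |ξ|²`
  set u : Cn n → ℝ := fun w => formNormSq (G w) (ξ w) with hudef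
  have hu : ContDiffOn ℝ ∞ u U := contDiffOn_formNormSq hG hpos hξ
  have hupos : ∀ w ∈ U, 0 < u w := fun w hw => formNormSq_pos (hpos w hw) (hξ0 w hw)
  have huM : ∀ w ∈ U, (u w : ℂ) = M w () () := fun w hw => by
    change _ = ((X w)ᴴ * ((G w)⁻¹ * X w)) () ()
    rw [← Matrix.mul_assoc, replicateCol_sandwich]
    exact ofReal_formNormSq (hpos w hw) (ξ w)
  have hub : ∀ w ∈ U, ∀ b, dzbar b (fun w => (u w : ℂ)) w = dzbarM b M w () () :=
    fun w hw b => dzbar_congr_on hU huM hw b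
  have hHu : ∀ a b, complexHessian u z a b = dzM a (dzbarM b M) z () () := fun a b =>
    dz_congr_on hU (fun w hw => hub w hw b) hz a
  set Dm : Matrix (Fin n) (Fin n) ℂ := Matrix.of fun i a => D a z i () with hDm
  set y : Fin n → ℂ := P *ᵥ ξ z with hydef
  have hYy : Y = replicateCol Unit y := (replicateCol_mulVec _ _).symm
  have hua : ∀ b, star (dz b (fun w => (u w : ℂ)) z) = (Dmᴴ *ᵥ y) b := fun b => by
    have := dzbar_ofReal (hu.diffAt hU hz) b
    rw [hub z hz b, hMbar z hz b] at this
    rw [← starRingEnd_apply, ← this, ← hPdef, ← hYdef, hYy]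
    simp [Matrix.mul_apply, mulVec, dotProduct, hDm]
  have hrank : rankOne (fun i => dz i (fun w => (u w : ℂ)) z) =
      (Dmᴴ * rankOne y * Dm)ᵀ := by
    have e : Dmᴴ * rankOne y * Dm = rankOne (Dmᴴ *ᵥ y) := by
      rw [rankOne, rankOne, mul_vecMulVec, vecMulVec_mul, star_mulVec Dmᴴ y,
        conjTranspose_conjTranspose]
    ext a b
    rw [e, transpose_apply, rankOne, rankOne, vecMulVec_apply, vecMulVec_apply, Pi.star_apply,
      Pi.star_apply, hua b, ← hua a, star_star, mul_comm]
  have htrace : (P * complexHessian u z).trace =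
      (Pᵀ * (Dmᴴ * P * Dm)).trace - star y ⬝ᵥ (L *ᵥ y) := by
    have e1 : ∀ a b, ((D b z)ᴴ * P * D a z) () () = (Dmᴴ * P * Dm) b a := fun a b => by
      simp [Matrix.mul_apply, hDm]
    have e2 : ∀ K : Matrix (Fin n) (Fin n) ℂ, (Yᴴ * K * Y) () () = star y ⬝ᵥ (K *ᵥ y) := fun K => by
      rw [hYy, replicateCol_sandwich]
    have e3 : star y ⬝ᵥ ((-L) *ᵥ y) = ∑ b, ∑ a, P b a * (star y ⬝ᵥ
        ((-dzM a (dzbarM b G) z + dzM a G z * P * dzbarM b G z) *ᵥ y)) := by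
      rw [← hKL, sum_mulVec, dotProduct_sum]
      refine Finset.sum_congr rfl fun b _ => ?_
      rw [sum_mulVec, dotProduct_sum]
      refine Finset.sum_congr rfl fun a _ => ?_
      rw [smul_mulVec, dotProduct_smul, smul_eq_mul]
    rw [neg_mulVec, dotProduct_neg] at e3
    rw [sub_eq_add_neg, e3]
    have e4 : (Pᵀ * (Dmᴴ * P * Dm)).trace = ∑ b, ∑ a, P b a * (Dmᴴ * P * Dm) b a := by
      simp only [Matrix.trace, Matrix.diag_apply]
      have h1 : ∀ i, (Pᵀ * (Dmᴴ * P * Dm)) i i = ∑ b, P b i * (Dmᴴ * P * Dm) b i :=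
        fun i => Matrix.mul_apply
      rw [Finset.sum_congr rfl fun i _ => h1 i]
      exact Finset.sum_comm
    rw [e4, ← Finset.sum_add_distrib]
    simp only [Matrix.trace, Matrix.diag_apply]
    refine Finset.sum_congr rfl fun b _ => ?_
    rw [Matrix.mul_apply, ← Finset.sum_add_distrib]
    refine Finset.sum_congr rfl fun a _ => ?_
    rw [hHu, hMab, Matrix.add_apply, e1, e2, mul_add]
  have hlog := complexHessian_comp hU hu hz (φ := Real.log) (φ' := fun x => x⁻¹)
    (c := -(u z ^ 2)⁻¹) (fun w hw => Real.hasDerivAt_log (hupos w hw).ne')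
    (hasDerivAt_inv (hupos z hz).ne')
  have huz := hupos z hz
  have hPpos : P.PosDef := (hpos z hz).inv
  -- This is `|∂|ξ|²|² ≤ |ξ|² |Dξ|²`. It lets `|Dξ|²` absorb the negative gradient term in the
  -- Hessian of the logarithm.
  have hCS : 0 ≤ (Pᵀ * (Dmᴴ * (u z • P - rankOne y) * Dm)).trace.re :=
    trace_mul_re_nonneg hPpos.posSemidef.transpose
      ((cauchySchwarz_posSemidef hPpos (ξ z)).conjTranspose_mul_mul_same Dm)
  have hCS2 : (Pᵀ * (Dmᴴ * (u z • P - rankOne y) * Dm)).trace.re =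
      u z * (Pᵀ * (Dmᴴ * P * Dm)).trace.re - (Pᵀ * (Dmᴴ * rankOne y * Dm)).trace.re := by
    rw [Matrix.mul_sub, Matrix.sub_mul, trace_mul_sub_re, Matrix.mul_smul, Matrix.smul_mul,
      trace_mul_real_smul]
  rw [hCS2] at hCS
  have htr : (P * (Dmᴴ * rankOne y * Dm)ᵀ).trace = (Pᵀ * (Dmᴴ * rankOne y * Dm)).trace := by
    rw [← trace_transpose, transpose_mul, transpose_transpose, trace_mul_comm]
  rw [hlog, trace_mul_add_re, trace_mul_real_smul, trace_mul_real_smul, htrace, hrank, htr,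
    Complex.sub_re]
  set S := (Pᵀ * (Dmᴴ * P * Dm)).trace.re
  set R := (Pᵀ * (Dmᴴ * rankOne y * Dm)).trace.re
  set Q := (star y ⬝ᵥ (L *ᵥ y)).re
  change -Q / u z ≤ (u z)⁻¹ * (S - Q) + -(u z ^ 2)⁻¹ * R
  have : (u z)⁻¹ * (S - Q) + -(u z ^ 2)⁻¹ * R - (-Q / u z) = (u z * S - R) / u z ^ 2 := by
    field_simp; ring
  have h0 : 0 ≤ (u z * S - R) / u z ^ 2 := div_nonneg hCS (by positivity)
  linarith

end Bochner

/-! ### Second order conditions at a local maximum. -/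

section MaximumPrinciple

open Matrix

/-- A positive second derivative would make `x` a local minimum as well, so `g` would be constant
near `x` and the second derivative would vanish. -/
theorem deriv_deriv_nonpos_of_isLocalMax {g : ℝ → ℝ} {x : ℝ} (hmax : IsLocalMax g x)
    (hg : ∀ᶠ y in 𝓝 x, DifferentiableAt ℝ g y) : deriv (deriv g) x ≤ 0 := by
  by_contra! h
  have h1 : deriv g x = 0 := hmax.deriv_eq_zero
  have hmin : IsLocalMin g x := isLocalMin_of_deriv_deriv_pos h h1 hg.self_of_nhds.continuousAt
  have hconst : g =ᶠ[𝓝 x] fun _ => g x := by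
    filter_upwards [hmax, hmin] with y h1 h2 using le_antisymm h1 h2
  have h2 : deriv (deriv g) x = 0 := by
    have h3 : deriv g =ᶠ[𝓝 x] fun _ => 0 := by
      filter_upwards [hconst.eventuallyEq_nhds] with y hy
      rw [hy.deriv_eq]; simp
    rw [h3.deriv_eq]; simp
  linarith

variable {n : ℕ} {U : Set (Cn n)} {z : Cn n} {u : Cn n → ℝ}

theorem fderiv_fderiv_nonpos_of_isLocalMax (hU : IsOpen U) (hu : ContDiffOn ℝ ∞ u U) (hz : z ∈ U)
    (hmax : IsLocalMax u z) (p : Cn n) : fderiv ℝ (fun y => fderiv ℝ u y p) z p ≤ 0 := by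
  set ℓ : ℝ → Cn n := fun t => z + t • p with hℓ
  have hℓd : ∀ t, HasDerivAt ℓ p t := fun t => by
    exact (((hasDerivAt_id t).smul_const p).const_add z).congr_deriv (by simp)
  have hℓ0 : ℓ 0 = z := by simp [hℓ]
  have hℓc : ContinuousAt ℓ 0 := (hℓd 0).continuousAt
  have hev : ∀ᶠ t in 𝓝 (0 : ℝ), ℓ t ∈ U := hℓc.eventually (by rw [hℓ0]; exact hU.mem_nhds hz)
  have hd : ∀ᶠ t in 𝓝 (0 : ℝ), HasDerivAt (fun t => u (ℓ t)) (fderiv ℝ u (ℓ t) p) t := by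
    filter_upwards [hev] with t ht
    exact (hu.diffAt hU ht).hasFDerivAt.comp_hasDerivAt t (hℓd t)
  have hmax' : IsLocalMax (fun t => u (ℓ t)) 0 := by
    have : ∀ᶠ y in 𝓝 (ℓ 0), u y ≤ u (ℓ 0) := by rw [hℓ0]; exact hmax
    exact hℓc.eventually this
  have h := deriv_deriv_nonpos_of_isLocalMax hmax' (hd.mono fun t ht => ht.differentiableAt)
  have h2 : deriv (fun t => u (ℓ t)) =ᶠ[𝓝 0] fun t => fderiv ℝ u (ℓ t) p :=
    hd.mono fun t ht => ht.deriv
  rw [h2.deriv_eq] at h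
  have h3 : ContDiffOn ℝ ∞ (fun y => fderiv ℝ u y) U := hu.fderiv_of_isOpen hU (by simp)
  have h4 : DifferentiableAt ℝ (fun y => fderiv ℝ u y p) z :=
    (h3.diffAt hU hz).clm_apply (differentiableAt_const p)
  have h5 := HasFDerivAt.comp_hasDerivAt_of_eq (0 : ℝ) h4.hasFDerivAt (hℓd 0) hℓ0.symm
  have h6 : deriv (fun t => fderiv ℝ u (ℓ t) p) 0 = _ := h5.deriv
  rwa [h6] at h

theorem wd_wd_re (hU : IsOpen U) (hu : ContDiffOn ℝ ∞ u U) (hz : z ∈ U) (p q : Cn n) :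
    (wd p (-q) (wd p q fun w => (u w : ℂ)) z).re =
      fderiv ℝ (fun y => fderiv ℝ u y p) z p + fderiv ℝ (fun y => fderiv ℝ u y q) z q := by
  have h3 : ContDiffOn ℝ ∞ (fun y => fderiv ℝ u y) U := hu.fderiv_of_isOpen hU (by simp)
  have h4 : ∀ p, DifferentiableAt ℝ (fun y => fderiv ℝ u y p) z := fun p =>
    (h3.diffAt hU hz).clm_apply (differentiableAt_const p)
  have h1 : ∀ y ∈ U, wd p q (fun w => (u w : ℂ)) y =
      ((fderiv ℝ u y p : ℝ) : ℂ) + Complex.I * ((fderiv ℝ u y q : ℝ) : ℂ) := fun y hy => by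
    have h2 : HasFDerivAt (fun y => ((u y : ℝ) : ℂ)) (Complex.ofRealCLM.comp (fderiv ℝ u y)) y :=
      Complex.ofRealCLM.hasFDerivAt.comp y (hu.diffAt hU hy).hasFDerivAt
    simp [wd, h2.fderiv]
  rw [wd_congr_on hU h1 hz]
  have h5 : HasFDerivAt (fun y => ((fderiv ℝ u y p : ℝ) : ℂ) +
      Complex.I * ((fderiv ℝ u y q : ℝ) : ℂ)) (Complex.ofRealCLM.comp
        (fderiv ℝ (fun y => fderiv ℝ u y p) z) +
        Complex.I • Complex.ofRealCLM.comp (fderiv ℝ (fun y => fderiv ℝ u y q) z)) z :=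
    (Complex.ofRealCLM.hasFDerivAt.comp z (h4 p).hasFDerivAt).add
      ((Complex.ofRealCLM.hasFDerivAt.comp z (h4 q).hasFDerivAt).const_mul Complex.I)
  rw [wd, h5.fderiv]
  simp

/-- Restriction to a complex line reduces the claim to one variable, where the complex Hessian is a
sum of two second derivatives along real lines. -/
theorem posSemidef_neg_complexHessian_of_isLocalMax (hU : IsOpen U) (hu : ContDiffOn ℝ ∞ u U)
    (hz : z ∈ U) (hmax : IsLocalMax u z) : (-complexHessian u z).PosSemidef := by
  have hH := isHermitian_complexHessian hU hu hz
  refine PosSemidef.of_dotProduct_mulVec_nonneg hH.neg fun v => ?_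
  -- The Hessian pulls back as `Jᵀ H J̄`, so the value `v^* H v` is obtained on the line in the
  -- direction of the conjugate of `v`.
  set F : Cn 1 → Cn n := fun ζ => z + (ζ 0) • WithLp.toLp 2 (star v) with hF
  have hFs : ContDiff ℂ ∞ F := by
    have h1 : ContDiff ℂ ∞ fun ζ : Cn 1 => ζ 0 := contDiff_piLp_apply 2
    exact contDiff_const.add (h1.smul contDiff_const)
  have hF0 : F 0 = z := by simp [hF]
  have hV : IsOpen (F ⁻¹' U) := hU.preimage hFs.continuous
  have h0V : (0 : Cn 1) ∈ F ⁻¹' U := by rw [Set.mem_preimage, hF0]; exact hz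
  have hc := complexHessian_comp_holomorphic hV (hFs.contDiffOn (s := F ⁻¹' U)) h0V hU hu
    fun x hx => hx
  rw [hF0] at hc
  have hFd : HasFDerivAt F ((EuclideanSpace.proj (0 : Fin 1) : Cn 1 →L[ℂ] ℂ).smulRight
      (WithLp.toLp 2 (star v))) 0 :=
    ((EuclideanSpace.proj (0 : Fin 1) : Cn 1 →L[ℂ] ℂ).hasFDerivAt.smul_const _).const_add z
  have hJ : ∀ a, holJac F 0 a 0 = star (v a) := fun a => by
    simp [holJac, hFd.fderiv, stdVec]
  have hsm : ContDiffOn ℝ ∞ (fun w => u (F w)) (F ⁻¹' U) :=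
    hu.comp (hFs.restrict_scalars ℝ).contDiffOn fun x hx => hx
  have hmx : IsLocalMax (fun w => u (F w)) 0 := by
    have : ∀ᶠ y in 𝓝 (F 0), u y ≤ u (F 0) := by rw [hF0]; exact hmax
    exact hFs.continuous.continuousAt.eventually this
  have hre : (complexHessian (fun w => u (F w)) 0 0 0).re ≤ 0 := by
    rw [complexHessian_apply, dz_eq_wd, dzbar_eq_wd, wd_wd_re hV hsm h0V]
    exact add_nonpos (fderiv_fderiv_nonpos_of_isLocalMax hV hsm h0V hmx _)
      (fderiv_fderiv_nonpos_of_isLocalMax hV hsm h0V hmx _)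
  have hval : complexHessian (fun w => u (F w)) 0 0 0 =
      star v ⬝ᵥ (complexHessian u z *ᵥ v) := by
    rw [hc, Matrix.mul_assoc]
    simp only [Matrix.mul_apply, transpose_apply, map_apply, hJ, dotProduct, mulVec, Pi.star_apply,
      Complex.star_def, Complex.conj_conj]
  have him : (star v ⬝ᵥ (complexHessian u z *ᵥ v)).im = 0 := by
    have h := star_dotProduct v (complexHessian u z *ᵥ v)
    rw [star_mulVec, hH.eq, ← dotProduct_mulVec] at h
    exact Complex.conj_eq_iff_im.1 h.symm
  rw [neg_mulVec, dotProduct_neg, Complex.le_def, Complex.neg_re, Complex.neg_im, him, ← hval]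
  simpa using hre

end MaximumPrinciple

end ConicalKRF

namespace ConicalKRF

/-! ### The potential of the cone metric as a function of one real variable. -/

section ConePotential

variable {γ ε x : ℝ}

/-- The derivative of the potential `χ_{γε}` as a function of `σ`. -/
def conePotentialDeriv (γ ε : ℝ) (x : ℝ) : ℝ := dslope (fun r => (ε ^ 2 + r) ^ γ) 0 x / γ

/-- The potential `χ_{γε}` as a function of `σ`. -/
def conePotential (γ ε : ℝ) (x : ℝ) : ℝ :=
  1 / γ * ∫ r in (0 : ℝ)..x, ((ε ^ 2 + r) ^ γ - ε ^ (2 * γ)) / r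

theorem sq_rpow (hε : 0 < ε) : (ε ^ 2) ^ γ = ε ^ (2 * γ) := by
  rw [← Real.rpow_natCast, ← Real.rpow_mul hε.le]; norm_num

theorem mul_conePotentialDeriv (hε : 0 < ε) :
    x * conePotentialDeriv γ ε x = ((ε ^ 2 + x) ^ γ - ε ^ (2 * γ)) / γ := by
  have := sub_smul_dslope (fun r => (ε ^ 2 + r) ^ γ) 0 x
  simp only [sub_zero, add_zero, smul_eq_mul, sq_rpow hε] at this
  rw [conePotentialDeriv, ← mul_div_assoc, this]

/-- Away from `0` this is a quotient of smooth functions. At `0` it is the divided slope of an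
analytic function, hence analytic. -/
theorem contDiffOn_conePotentialDeriv (hε : 0 < ε) :
    ContDiffOn ℝ ∞ (conePotentialDeriv γ ε) (Set.Ioi (-ε ^ 2)) := by
  have hy : ∀ x ∈ Set.Ioi (-ε ^ 2), ContDiffAt ℝ ω (fun r => (ε ^ 2 + r) ^ γ) x := fun x hx =>
    (contDiffAt_const.add contDiffAt_id).rpow_const_of_ne (by
      have : -ε ^ 2 < x := hx
      simp only [id]; linarith)
  have h0 : (0 : ℝ) ∈ Set.Ioi (-ε ^ 2) := by
    have : 0 < ε ^ 2 := by positivity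
    simp only [Set.mem_Ioi]; linarith
  intro x hx
  refine ContDiffAt.contDiffWithinAt ?_
  unfold conePotentialDeriv
  refine ContDiffAt.div_const ?_ γ
  by_cases hx0 : x = 0
  · subst hx0
    obtain ⟨p, hp⟩ := (hy 0 h0).analyticAt
    have h1 : AnalyticAt ℝ (dslope (fun r => (ε ^ 2 + r) ^ γ) 0) 0 :=
      ⟨_, hp.has_fpower_series_dslope_fslope⟩
    exact h1.contDiffAt.of_le le_top
  · have h2 : ContDiffAt ℝ ∞ (fun x : ℝ => ((ε ^ 2 + x) ^ γ - (ε ^ 2 + 0) ^ γ) / x) x :=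
      (((hy x hx).of_le le_top).sub contDiffAt_const).div contDiffAt_id hx0
    refine h2.congr_of_eventuallyEq ?_
    filter_upwards [isOpen_ne.mem_nhds hx0] with y hy0
    rw [dslope_of_ne _ hy0, slope_def_field, sub_zero]

theorem hasDerivAt_conePotential (hγ : γ ≠ 0) (hε : 0 < ε) (hx : -ε ^ 2 < x) :
    HasDerivAt (conePotential γ ε) (conePotentialDeriv γ ε x) x := by
  have hc : ContinuousOn (dslope (fun r => (ε ^ 2 + r) ^ γ) 0) (Set.Ioi (-ε ^ 2)) := by
    have h1 := ((contDiffOn_conePotentialDeriv (γ := γ) hε).continuousOn).mul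
      (continuousOn_const (c := γ))
    refine h1.congr fun y _ => ?_
    show _ = conePotentialDeriv γ ε y * γ
    rw [conePotentialDeriv, div_mul_cancel₀ _ hγ]
  have h0 : (0 : ℝ) ∈ Set.Ioi (-ε ^ 2) := by
    have : 0 < ε ^ 2 := by positivity
    simp only [Set.mem_Ioi]; linarith
  have heq : ∀ x, conePotential γ ε x =
      1 / γ * ∫ r in (0 : ℝ)..x, dslope (fun r => (ε ^ 2 + r) ^ γ) 0 r := by
    intro x
    rw [conePotential]
    congr 1
    -- The two integrands may differ at `r = 0`, where division by zero gives `0`; the integral only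
    -- sees the open interval.
    refine intervalIntegral.integral_congr_uIoo fun r hr => ?_
    have hr0 : r ≠ 0 := by
      rintro rfl
      rw [Set.uIoo] at hr
      rcases le_total 0 x with h | h
      · simp [h] at hr
      · simp [h] at hr
    rw [dslope_of_ne _ hr0, slope_def_field, sub_zero, add_zero, sq_rpow hε]
  rw [show conePotential γ ε = fun x => 1 / γ * ∫ r in (0 : ℝ)..x,
    dslope (fun r => (ε ^ 2 + r) ^ γ) 0 r from funext heq]
  have hsub : Set.uIcc 0 x ⊆ Set.Ioi (-ε ^ 2) :=
    (Set.ordConnected_Ioi).uIcc_subset h0 hx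
  have h1 := (intervalIntegral.integral_hasDerivAt_right (hc.mono hsub).intervalIntegrable
    (hc.stronglyMeasurableAtFilter isOpen_Ioi x hx)
    (hc.continuousAt (isOpen_Ioi.mem_nhds hx))).const_mul (1 / γ)
  exact h1.congr_deriv (by rw [conePotentialDeriv]; ring)

theorem contDiffOn_conePotential (hγ : γ ≠ 0) (hε : 0 < ε) :
    ContDiffOn ℝ ∞ (conePotential γ ε) (Set.Ioi (-ε ^ 2)) := by
  rw [contDiffOn_infty_iff_deriv_of_isOpen isOpen_Ioi]
  exact ⟨fun x hx => (hasDerivAt_conePotential hγ hε hx).differentiableAt.differentiableWithinAt,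
    (contDiffOn_conePotentialDeriv hε).congr fun x hx => (hasDerivAt_conePotential hγ hε hx).deriv⟩

/-- Differentiate the identity of `mul_conePotentialDeriv`. The combination `F' + xF''`, for `F` the
potential, is the coefficient of the rank one part of the Hessian of `F(σ)`, and it equals the cone
weight. -/
theorem hasDerivAt_conePotentialDeriv (hγ : γ ≠ 0) (hε : 0 < ε) (hx : -ε ^ 2 < x) :
    ∃ c, HasDerivAt (conePotentialDeriv γ ε) c x ∧
      conePotentialDeriv γ ε x + x * c = (ε ^ 2 + x) ^ (γ - 1) := by
  have hd : DifferentiableAt ℝ (conePotentialDeriv γ ε) x :=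
    (contDiffOn_conePotentialDeriv hε).diffAt isOpen_Ioi hx
  refine ⟨_, hd.hasDerivAt, ?_⟩
  have h1 := (hasDerivAt_id x).mul hd.hasDerivAt
  have h3 : (id * conePotentialDeriv γ ε) = fun x => ((ε ^ 2 + x) ^ γ - ε ^ (2 * γ)) / γ :=
    funext fun x => mul_conePotentialDeriv hε
  rw [h3] at h1
  have h4 : HasDerivAt (fun x => ((ε ^ 2 + x) ^ γ - ε ^ (2 * γ)) / γ)
      ((1 * γ * (ε ^ 2 + x) ^ (γ - 1)) / γ) x :=
    ((((hasDerivAt_id x).const_add (ε ^ 2)).rpow_const (Or.inl (by simp only [id]; linarith))).sub_const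
      _).div_const γ
  have h5 := h1.unique h4
  simp only [id, one_mul] at h5
  rw [h5]; field_simp

theorem rpow_sub_rpow_nonneg (hγ : 0 < γ) (hε : 0 < ε) (hx : 0 ≤ x) :
    0 ≤ (ε ^ 2 + x) ^ γ - ε ^ (2 * γ) := by
  rw [← sq_rpow hε]
  have := Real.rpow_le_rpow (by positivity) (show ε ^ 2 ≤ ε ^ 2 + x by linarith) hγ.le
  linarith

/-- Subadditivity of `x ↦ x^γ` for `γ < 1`. The bound no longer involves `ε`. -/
theorem rpow_sub_rpow_le (hγ : 0 < γ) (hγ1 : γ < 1) (hε : 0 < ε) (hx : 0 ≤ x) :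
    (ε ^ 2 + x) ^ γ - ε ^ (2 * γ) ≤ x ^ γ := by
  rw [← sq_rpow hε]
  have h := NNReal.rpow_add_le_add_rpow ⟨ε ^ 2, by positivity⟩ ⟨x, hx⟩ hγ.le hγ1.le
  have h2 : (ε ^ 2 + x) ^ γ ≤ (ε ^ 2) ^ γ + x ^ γ := by exact_mod_cast h
  linarith

theorem conePotential_nonneg (hγ : 0 < γ) (hε : 0 < ε) (hx : 0 ≤ x) :
    0 ≤ conePotential γ ε x := by
  refine mul_nonneg (by positivity) (intervalIntegral.integral_nonneg hx fun r hr => ?_)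
  exact div_nonneg (rpow_sub_rpow_nonneg hγ hε hr.1) hr.1

/-- The integrand is dominated by `r^{γ-1}`, which is integrable at `0` because `γ > 0`; hence the
bound is uniform in `ε`. -/
theorem conePotential_le (hγ : 0 < γ) (hγ1 : γ < 1) (hε : 0 < ε) (hx : 0 ≤ x) :
    conePotential γ ε x ≤ x ^ γ / γ ^ 2 := by
  have hi : IntervalIntegrable (fun r : ℝ => r ^ (γ - 1)) MeasureTheory.volume 0 x :=
    intervalIntegral.intervalIntegrable_rpow' (by linarith)
  have h1 : ∫ r in (0 : ℝ)..x, ((ε ^ 2 + r) ^ γ - ε ^ (2 * γ)) / r ≤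
      ∫ r in (0 : ℝ)..x, r ^ (γ - 1) := by
    have hnn : ∀ r ∈ Set.Ioc 0 x, 0 ≤ ((ε ^ 2 + r) ^ γ - ε ^ (2 * γ)) / r := fun r hr =>
      div_nonneg (rpow_sub_rpow_nonneg hγ hε hr.1.le) hr.1.le
    have hle : ∀ r ∈ Set.Ioc 0 x, ((ε ^ 2 + r) ^ γ - ε ^ (2 * γ)) / r ≤ r ^ (γ - 1) := by
      intro r hr
      rw [Real.rpow_sub_one hr.1.ne']
      exact div_le_div_of_nonneg_right (rpow_sub_rpow_le hγ hγ1 hε hr.1.le) hr.1.le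
    rw [intervalIntegral.integral_of_le hx, intervalIntegral.integral_of_le hx]
    refine MeasureTheory.integral_mono_of_nonneg ?_
      ((intervalIntegrable_iff_integrableOn_Ioc_of_le hx).1 hi) ?_
    · exact (MeasureTheory.ae_restrict_mem measurableSet_Ioc).mono hnn
    · exact (MeasureTheory.ae_restrict_mem measurableSet_Ioc).mono hle
  rw [integral_rpow (Or.inl (by linarith)), sub_add_cancel, Real.zero_rpow hγ.ne', sub_zero] at h1
  calc conePotential γ ε x ≤ 1 / γ * (x ^ γ / γ) :=
        mul_le_mul_of_nonneg_left h1 (by positivity)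
    _ = _ := by field_simp

end ConePotential

/-! ### Hessians of functions of the norm of a holomorphic section in a local frame. -/

section LocalModel

open Matrix

variable {n : ℕ} {U : Set (Cn n)} {z : Cn n}

theorem dzbar_mul {f g : Cn n → ℂ} (hf : DifferentiableAt ℝ f z) (hg : DifferentiableAt ℝ g z)
    (i : Fin n) : dzbar i (fun w => f w * g w) z = dzbar i f z * g z + f z * dzbar i g z := by
  simp only [dzbar_eq_wd]; exact wd_mul hf hg

/-- The function is pluriharmonic: its ∂̄-derivative is the conjugate of the holomorphic function
`∂g/g`. This gives the independence of curvature and Ricci forms from frames and charts. -/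
theorem complexHessian_log_normSq (hU : IsOpen U) {g : Cn n → ℂ} (hg : ContDiffOn ℂ ∞ g U)
    (hg0 : ∀ w ∈ U, g w ≠ 0) (hz : z ∈ U) :
    complexHessian (fun w => Real.log (Complex.normSq (g w))) z = 0 := by
  have hgd : ∀ w ∈ U, DifferentiableAt ℂ g w := fun w hw =>
    (hg.contDiffAt (hU.mem_nhds hw)).differentiableAt (by simp)
  have hgR : ContDiffOn ℝ ∞ g U := hg.restrict_scalars ℝ
  have hgc : ContDiffOn ℝ ∞ (fun w => starRingEnd ℂ (g w)) U :=
    (Complex.conjCLE : ℂ →L[ℝ] ℂ).contDiff.comp_contDiffOn hgR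
  have hn : ∀ w, ((Complex.normSq (g w) : ℝ) : ℂ) = g w * starRingEnd ℂ (g w) := fun w =>
    (Complex.mul_conj _).symm
  have hns : ContDiffOn ℝ ∞ (fun w => Complex.normSq (g w)) U := by
    have := contDiffOn_re (hgR.mul hgc)
    refine this.congr fun w _ => ?_
    rw [← hn, Complex.ofReal_re]
  ext i j
  rw [complexHessian_apply]
  have hfd : ContDiffOn ℂ ∞ (fun w => fderiv ℂ g w (stdVec j)) U :=
    (hg.fderiv_of_isOpen hU (by simp)).clm_apply contDiffOn_const
  set q : Cn n → ℂ := fun w => fderiv ℂ g w (stdVec j) / g w with hq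
  have hqd : DifferentiableAt ℂ q z :=
    (((hfd.contDiffAt (hU.mem_nhds hz)).differentiableAt (by simp)).mul
      ((hasDerivAt_inv (hg0 z hz)).differentiableAt.comp z (hgd z hz))).congr_of_eventuallyEq
      (Filter.Eventually.of_forall fun w => div_eq_mul_inv _ _)
  rw [dz_congr_on hU (g := fun w => starRingEnd ℂ (q w)) _ hz]
  · rw [dz_conj (hqd.restrictScalars ℝ), dzbar_of_differentiableAt hqd]; simp
  · intro w hw
    have h0 : Complex.normSq (g w) ≠ 0 := by simpa using hg0 w hw
    rw [dzbar_comp_real (Real.hasDerivAt_log h0) (hns.diffAt hU hw),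
      dzbar_congr_on hU (fun y _ => hn y) hw, dzbar_mul (hgR.diffAt hU hw) (hgc.diffAt hU hw),
      dzbar_of_differentiableAt (hgd w hw), dzbar_conj (hgR.diffAt hU hw),
      dz_of_differentiableAt (hgd w hw), Complex.ofReal_inv, hn, zero_mul, zero_add, hq]
    have h1 := hg0 w hw
    have h2 : starRingEnd ℂ (g w) ≠ 0 := by simpa using h1
    simp only [map_div₀]
    field_simp

/-- Local data of a section of a Hermitian line bundle: the squared norm `a` of a holomorphic frame
and the holomorphic coefficient `S` of the section. -/
structure LocalSection (U : Set (Cn n)) (a : Cn n → ℝ) (S : Cn n → ℂ) : Prop where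
  isOpen : IsOpen U
  smooth : ContDiffOn ℝ ∞ a U
  pos : ∀ w ∈ U, 0 < a w
  holo : ContDiffOn ℂ ∞ S U

variable {a : Cn n → ℝ} {S : Cn n → ℂ}

/-- The connection form `∂ log a`. -/
def connForm (a : Cn n → ℝ) (w : Cn n) (i : Fin n) : ℂ :=
  dz i (fun w => ((Real.log (a w) : ℝ) : ℂ)) w

/-- The holomorphic differential `∂S`. -/
def holDiff (S : Cn n → ℂ) (w : Cn n) (i : Fin n) : ℂ := dz i S w

/-- The `(1,0)`-part of the covariant derivative of the section. -/
def covDiff (a : Cn n → ℝ) (S : Cn n → ℂ) (w : Cn n) (i : Fin n) : ℂ :=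
  holDiff S w i + S w * connForm a w i

/-- The squared norm of the section. -/
def sectionNormSq (a : Cn n → ℝ) (S : Cn n → ℂ) (w : Cn n) : ℝ := a w * Complex.normSq (S w)

namespace LocalSection


theorem differentiableAt (h : LocalSection U a S) {w : Cn n} (hw : w ∈ U) : DifferentiableAt ℂ S w :=
  (h.holo.contDiffAt (h.isOpen.mem_nhds hw)).differentiableAt (by simp)

theorem smooth_log (h : LocalSection U a S) : ContDiffOn ℝ ∞ (fun w => Real.log (a w)) U :=
  h.smooth.log fun w hw => (h.pos w hw).ne'

theorem smooth_section (h : LocalSection U a S) : ContDiffOn ℝ ∞ S U := h.holo.restrict_scalars ℝ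

theorem smooth_conj (h : LocalSection U a S) : ContDiffOn ℝ ∞ (fun w => starRingEnd ℂ (S w)) U :=
  (Complex.conjCLE : ℂ →L[ℝ] ℂ).contDiff.comp_contDiffOn h.smooth_section

theorem ofReal_sectionNormSq (_h : LocalSection U a S) (w : Cn n) : ((sectionNormSq a S w : ℝ) : ℂ) =
    a w * (S w * starRingEnd ℂ (S w)) := by
  rw [sectionNormSq, Complex.ofReal_mul, Complex.mul_conj]

theorem smooth_normSq (h : LocalSection U a S) : ContDiffOn ℝ ∞ (sectionNormSq a S) U := by
  have h1 := h.smooth.mul (contDiffOn_re (h.smooth_section.mul h.smooth_conj))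
  refine h1.congr fun w _ => ?_
  rw [sectionNormSq, Complex.mul_conj, Complex.ofReal_re]

theorem normSq_nonneg (h : LocalSection U a S) {w : Cn n} (hw : w ∈ U) : 0 ≤ sectionNormSq a S w :=
  mul_nonneg (h.pos w hw).le (Complex.normSq_nonneg _)

theorem smooth_connForm (h : LocalSection U a S) (i : Fin n) : ContDiffOn ℝ ∞ (fun w => connForm a w i) U :=
  contDiffOn_dz h.isOpen (contDiffOn_ofReal h.smooth_log) i

theorem smooth_holDiff (h : LocalSection U a S) (i : Fin n) : ContDiffOn ℝ ∞ (fun w => holDiff S w i) U :=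
  contDiffOn_dz h.isOpen h.smooth_section i

theorem smooth_covDiff (h : LocalSection U a S) (i : Fin n) : ContDiffOn ℝ ∞ (fun w => covDiff a S w i) U :=
  (h.smooth_holDiff i).add (h.smooth_section.mul (h.smooth_connForm i))

theorem dzbar_holDiff (h : LocalSection U a S) {w : Cn n} (hw : w ∈ U) (i j : Fin n) :
    dzbar j (fun w => holDiff S w i) w = 0 := by
  have h1 := dz_dzbar_comm h.isOpen h.smooth_section hw i j
  rw [dz_congr_on h.isOpen (g := fun _ => 0)
    (fun y hy => dzbar_of_differentiableAt (h.differentiableAt hy) j) hw, dz_eq_wd, wd_const] at h1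
  exact h1.symm

theorem dz_frame (h : LocalSection U a S) {w : Cn n} (hw : w ∈ U) (i : Fin n) :
    dz i (fun w => (a w : ℂ)) w = a w * connForm a w i := by
  rw [connForm, dz_comp_real (Real.hasDerivAt_log (h.pos w hw).ne') (h.smooth.diffAt h.isOpen hw),
    ← mul_assoc, ← Complex.ofReal_mul, mul_inv_cancel₀ (h.pos w hw).ne', Complex.ofReal_one, one_mul]

theorem dz_frame_mul_section (h : LocalSection U a S) {w : Cn n} (hw : w ∈ U) (i : Fin n) :
    dz i (fun w => (a w : ℂ) * S w) w = a w * covDiff a S w i := by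
  rw [dz_mul ((contDiffOn_ofReal h.smooth).diffAt h.isOpen hw) (h.smooth_section.diffAt h.isOpen hw),
    h.dz_frame hw, covDiff, holDiff]
  ring

/-- With `S` holomorphic, `∂` does not act on the conjugate of `S`, and `∂(aS) = a∇S`. The gradient
of the squared norm is thus proportional to `∇S`. -/
theorem dz_sectionNormSq (h : LocalSection U a S) {w : Cn n} (hw : w ∈ U) (i : Fin n) :
    dz i (fun w => ((sectionNormSq a S w : ℝ) : ℂ)) w =
      a w * starRingEnd ℂ (S w) * covDiff a S w i := by
  rw [dz_congr_on h.isOpen (g := fun w => (a w : ℂ) * S w * starRingEnd ℂ (S w)) (fun y _ => by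
    rw [h.ofReal_sectionNormSq, mul_assoc]) hw,
    dz_mul (((contDiffOn_ofReal h.smooth).mul h.smooth_section).diffAt h.isOpen hw)
      (h.smooth_conj.diffAt h.isOpen hw), h.dz_frame_mul_section hw,
    dz_conj (h.smooth_section.diffAt h.isOpen hw),
    dzbar_of_differentiableAt (h.differentiableAt hw)]
  simp; ring

theorem rankOne_dz_sectionNormSq (h : LocalSection U a S) {w : Cn n} (hw : w ∈ U) :
    rankOne (fun i => dz i (fun w => ((sectionNormSq a S w : ℝ) : ℂ)) w) =
      (sectionNormSq a S w * a w) • rankOne (covDiff a S w) := by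
  rw [funext fun i => h.dz_sectionNormSq hw i]
  ext i j
  simp only [rankOne, vecMulVec_apply, Pi.star_apply, Matrix.smul_apply, Complex.real_smul,
    star_mul', Complex.star_def, Complex.conj_ofReal, Complex.conj_conj,
    Complex.ofReal_mul, h.ofReal_sectionNormSq]
  ring

/-- Since `∂S` and `S` are holomorphic, the ∂̄-derivative of `∇S` comes only from `∂log a` and
equals `S ∂∂̄log a`. The rank one term is the semipositive form `β = √-1∂∂̄σ + σθ`. -/
theorem complexHessian_sectionNormSq (h : LocalSection U a S) (hz : z ∈ U) :
    complexHessian (sectionNormSq a S) z = a z • rankOne (covDiff a S z) +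
      sectionNormSq a S z • complexHessian (fun w => Real.log (a w)) z := by
  ext i j
  have hUo := h.isOpen
  have hcov : ∀ {w}, w ∈ U → ∀ i, DifferentiableAt ℝ (fun w => covDiff a S w i) w :=
    fun hw i => (h.smooth_covDiff i).diffAt hUo hw
  have hcovc : ∀ {w}, w ∈ U → ∀ i, DifferentiableAt ℝ
      (fun w => starRingEnd ℂ (covDiff a S w i)) w := fun hw i =>
    (Complex.conjCLE : ℂ →L[ℝ] ℂ).differentiableAt.comp _ (hcov hw i)
  rw [complexHessian_apply, dz_congr_on hUo
    (g := fun w => ((a w : ℂ) * S w) * starRingEnd ℂ (covDiff a S w j)) _ hz]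
  · rw [dz_mul (((contDiffOn_ofReal h.smooth).mul h.smooth_section).diffAt hUo hz) (hcovc hz j),
      h.dz_frame_mul_section hz, dz_conj (hcov hz j)]
    have h1 : dzbar i (fun w => covDiff a S w j) z =
        S z * complexHessian (fun w => Real.log (a w)) z j i := by
      have e1 : dzbar i (fun w => holDiff S w j + S w * connForm a w j) z =
          dzbar i (fun w => holDiff S w j) z + dzbar i (fun w => S w * connForm a w j) z := by
        simp only [dzbar_eq_wd]
        exact wd_add ((h.smooth_holDiff j).diffAt hUo hz)
          ((h.smooth_section.mul (h.smooth_connForm j)).diffAt hUo hz)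
      have e2 : dzbar i (fun w => S w * connForm a w j) z =
          dzbar i S z * connForm a z j + S z * dzbar i (fun w => connForm a w j) z := by
        simp only [dzbar_eq_wd]
        exact wd_mul (h.smooth_section.diffAt hUo hz) ((h.smooth_connForm j).diffAt hUo hz)
      have e3 : dzbar i (fun w => connForm a w j) z =
          complexHessian (fun w => Real.log (a w)) z j i :=
        (dz_dzbar_comm hUo (contDiffOn_ofReal h.smooth_log) hz j i).symm
      unfold covDiff
      rw [e1, h.dzbar_holDiff hz, e2, e3, dzbar_of_differentiableAt (h.differentiableAt hz)]
      ring
    have h2 : starRingEnd ℂ (complexHessian (fun w => Real.log (a w)) z j i) =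
        complexHessian (fun w => Real.log (a w)) z i j :=
      (isHermitian_complexHessian hUo h.smooth_log hz).apply i j
    rw [h1, map_mul, h2]
    simp only [Matrix.add_apply, Matrix.smul_apply, rankOne, vecMulVec_apply, Pi.star_apply,
      Complex.real_smul, h.ofReal_sectionNormSq, Complex.star_def]
    ring
  · intro w hw
    rw [dzbar_ofReal (h.smooth_normSq.diffAt hUo hw), h.dz_sectionNormSq hw]
    simp only [map_mul, Complex.conj_ofReal, Complex.conj_conj]

/-- The complex Hessian of a function of the squared norm of a section. -/
theorem complexHessian_comp_sectionNormSq (h : LocalSection U a S) (hz : z ∈ U) {φ φ' : ℝ → ℝ} {c : ℝ}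
    (h1 : ∀ x, 0 ≤ x → HasDerivAt φ (φ' x) x) (h2 : HasDerivAt φ' c (sectionNormSq a S z)) :
    complexHessian (fun w => φ (sectionNormSq a S w)) z =
      ((φ' (sectionNormSq a S z) + sectionNormSq a S z * c) * a z) • rankOne (covDiff a S z) +
      (φ' (sectionNormSq a S z) * sectionNormSq a S z) •
        complexHessian (fun w => Real.log (a w)) z := by
  rw [complexHessian_comp h.isOpen h.smooth_normSq hz (φ' := φ')
    (fun y hy => h1 _ (h.normSq_nonneg hy)) h2, h.complexHessian_sectionNormSq hz,
    h.rankOne_dz_sectionNormSq hz]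
  module

theorem complexHessian_conePotential (h : LocalSection U a S) (hz : z ∈ U) {γ ε : ℝ} (hγ : γ ≠ 0) (hε : 0 < ε) :
    complexHessian (fun w => conePotential γ ε (sectionNormSq a S w)) z =
      ((ε ^ 2 + sectionNormSq a S z) ^ (γ - 1) * a z) • rankOne (covDiff a S z) +
      (((ε ^ 2 + sectionNormSq a S z) ^ γ - ε ^ (2 * γ)) / γ) •
        complexHessian (fun w => Real.log (a w)) z := by
  have hε2 : 0 < ε ^ 2 := by positivity
  obtain ⟨c, hc, hc2⟩ := hasDerivAt_conePotentialDeriv hγ hε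
    (show -ε ^ 2 < sectionNormSq a S z by linarith [h.normSq_nonneg hz])
  rw [h.complexHessian_comp_sectionNormSq hz (φ := conePotential γ ε)
    (fun x hx => hasDerivAt_conePotential hγ hε (by linarith)) hc, hc2, mul_comm (conePotentialDeriv _ _ _),
    mul_conePotentialDeriv hε]

theorem complexHessian_log_add (h : LocalSection U a S) (hz : z ∈ U) {ε : ℝ} (hε : 0 < ε) :
    complexHessian (fun w => Real.log (ε ^ 2 + sectionNormSq a S w)) z =
      (ε ^ 2 / (ε ^ 2 + sectionNormSq a S z) ^ 2 * a z) • rankOne (covDiff a S z) +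
      (sectionNormSq a S z / (ε ^ 2 + sectionNormSq a S z)) •
        complexHessian (fun w => Real.log (a w)) z := by
  have hε2 : 0 < ε ^ 2 := by positivity
  have hσ := h.normSq_nonneg hz
  have h1 : ∀ x : ℝ, 0 ≤ x → HasDerivAt (fun x => Real.log (ε ^ 2 + x)) (ε ^ 2 + x)⁻¹ x :=
    fun x hx => by
      simpa using ((hasDerivAt_id x).const_add (ε ^ 2)).log (by simp only [id]; positivity)
  have h2 : HasDerivAt (fun x => (ε ^ 2 + x)⁻¹) (-1 / (ε ^ 2 + sectionNormSq a S z) ^ 2)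
      (sectionNormSq a S z) := by
    exact ((hasDerivAt_id (sectionNormSq a S z)).const_add (ε ^ 2)).inv (by
      simp only [id]; positivity)
  rw [h.complexHessian_comp_sectionNormSq hz h1 h2]
  have hpos : 0 < ε ^ 2 + sectionNormSq a S z := by positivity
  congr 2
  · field_simp; ring
  · field_simp

end LocalSection

end LocalModel

end ConicalKRF

namespace ConicalKRF

/-! ### Forms in charts and their behaviour under changes of charts. -/

section Forms

open Matrix

variable {n : ℕ} {X : Type*} [TopologicalSpace X] [ChartedSpace (Cn n) X]

theorem isOpen_transition_source (c c' : OpenPartialHomeomorph X (Cn n)) :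
    IsOpen (c.symm.trans c').source := (c.symm.trans c').open_source

theorem mem_transition_source {c c' : OpenPartialHomeomorph X (Cn n)} {z : Cn n} :
    z ∈ (c.symm.trans c').source ↔ z ∈ c.target ∧ c.symm z ∈ c'.source := by
  simp

/-- A function on `X` which is smooth in every chart. -/
def ChartSmooth (f : X → ℝ) : Prop :=
  ∀ c ∈ atlas (Cn n) X, ContDiffOn ℝ ∞ (fun w => f (c.symm w)) c.target

section Transition

variable [IsManifold 𝓘(ℂ, Cn n) ω X] {c c' : OpenPartialHomeomorph X (Cn n)} {z : Cn n}

theorem contDiffOn_transition (hc : c ∈ atlas (Cn n) X) (hc' : c' ∈ atlas (Cn n) X) :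
    ContDiffOn ℂ ω (fun y => c' (c.symm y)) (c.symm.trans c').source := by
  have h := contMDiffOn_of_mem_contDiffGroupoid
    (HasGroupoid.compatible (G := contDiffGroupoid ω 𝓘(ℂ, Cn n)) hc hc')
  exact contMDiffOn_iff_contDiffOn.1 h

theorem isManifold_real : IsManifold 𝓘(ℝ, Cn n) ∞ X :=
  isManifold_of_contDiffOn _ _ _ fun c c' hc hc' => by
    have h := ((contDiffOn_transition hc hc').restrict_scalars ℝ).of_le
      (show (∞ : WithTop ℕ∞) ≤ ω from le_top)
    simpa [Function.comp_def] using h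

theorem contDiffOn_of_contMDiffOn {f : X → ℝ} {O : Set X}
    (hf : ContMDiffOn 𝓘(ℝ, Cn n) 𝓘(ℝ, ℝ) ∞ f O) (hc : c ∈ atlas (Cn n) X) :
    ContDiffOn ℝ ∞ (fun w => f (c.symm w)) (c.target ∩ c.symm ⁻¹' O) := by
  have : IsManifold 𝓘(ℝ, Cn n) ∞ X := isManifold_real
  have h1 : ContMDiffOn 𝓘(ℝ, Cn n) 𝓘(ℝ, Cn n) ∞ c.symm c.target :=
    contMDiffOn_symm_of_mem_maximalAtlas (IsManifold.subset_maximalAtlas hc)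
  exact contMDiffOn_iff_contDiffOn.1 (hf.comp (h1.mono Set.inter_subset_left) fun x hx => hx.2)

theorem chartSmooth_of_contMDiff {f : X → ℝ} (hf : ContMDiff 𝓘(ℝ, Cn n) 𝓘(ℝ, ℝ) ∞ f) :
    ChartSmooth (n := n) f := fun c hc => by
  have := contDiffOn_of_contMDiffOn (O := Set.univ) hf.contMDiffOn hc
  simpa using this

theorem complexHessian_transition (hc : c ∈ atlas (Cn n) X) (hc' : c' ∈ atlas (Cn n) X)
    (hz : z ∈ (c.symm.trans c').source) {ρ ρ' : Cn n → ℝ} {V : Set (Cn n)} (hV : IsOpen V)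
    (hzV : c' (c.symm z) ∈ V) (hρ : ContDiffOn ℝ ∞ ρ' V)
    (heq : ∀ w ∈ (c.symm.trans c').source, c' (c.symm w) ∈ V → ρ w = ρ' (c' (c.symm w))) :
    complexHessian ρ z = (jac c c' z)ᵀ * complexHessian ρ' (c' (c.symm z)) *
      (jac c c' z).map (starRingEnd ℂ) := by
  have hF := (contDiffOn_transition hc hc').of_le (show (∞ : WithTop ℕ∞) ≤ ω from le_top)
  set W := (c.symm.trans c').source ∩ (fun y => c' (c.symm y)) ⁻¹' V
  have hW : IsOpen W := hF.continuousOn.isOpen_inter_preimage (isOpen_transition_source c c') hV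
  rw [complexHessian_congr_on hW (v := fun w => ρ' (c' (c.symm w))) (fun y hy => heq y hy.1 hy.2)
    ⟨hz, hzV⟩]
  exact complexHessian_comp_holomorphic hW (hF.mono Set.inter_subset_left) ⟨hz, hzV⟩ hV hρ
    fun y hy => hy.2

theorem contDiffOn_det_jac (hc : c ∈ atlas (Cn n) X) (hc' : c' ∈ atlas (Cn n) X) :
    ContDiffOn ℂ ∞ (fun w => (jac c c' w).det) (c.symm.trans c').source := by
  have hF := (contDiffOn_transition hc hc').of_le (show (∞ : WithTop ℕ∞) ≤ ω from le_top)
  have h1 : ContDiffOn ℂ ∞ (fun y => fderiv ℂ (fun y => c' (c.symm y)) y)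
      (c.symm.trans c').source := hF.fderiv_of_isOpen (isOpen_transition_source c c') (by simp)
  have h2 : ∀ a i, ContDiffOn ℂ ∞ (fun w => jac c c' w a i) (c.symm.trans c').source :=
    fun a i => (contDiff_piLp_apply (i := a) 2).comp_contDiffOn
      (h1.clm_apply (contDiffOn_const (c := stdVec i)))
  simp only [Matrix.det_apply']
  exact ContDiffOn.sum fun s _ => contDiffOn_const.mul (contDiffOn_prod fun i _ => h2 _ _)

end Transition

theorem conjTranspose_map_conj (J : Matrix (Fin n) (Fin n) ℂ) :
    (J.map (starRingEnd ℂ))ᴴ = Jᵀ := by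
  ext i j; simp

theorem posSemidef_pullback {A : Matrix (Fin n) (Fin n) ℂ} (hA : A.PosSemidef)
    (J : Matrix (Fin n) (Fin n) ℂ) : (Jᵀ * A * J.map (starRingEnd ℂ)).PosSemidef := by
  rw [← conjTranspose_map_conj]; exact hA.conjTranspose_mul_mul_same _

theorem det_pullback (A J : Matrix (Fin n) (Fin n) ℂ) :
    (Jᵀ * A * J.map (starRingEnd ℂ)).det = (Complex.normSq J.det : ℂ) * A.det := by
  have : (J.map (starRingEnd ℂ)).det = starRingEnd ℂ J.det :=
    ((starRingEnd ℂ).map_det J).symm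
  rw [det_mul, det_mul, det_transpose, this, ← Complex.mul_conj]; ring

theorem det_pullback_re (A J : Matrix (Fin n) (Fin n) ℂ) :
    (Jᵀ * A * J.map (starRingEnd ℂ)).det.re = Complex.normSq J.det * A.det.re := by
  rw [det_pullback, Complex.re_ofReal_mul]

theorem trace_inv_mul_pullback (A B J : Matrix (Fin n) (Fin n) ℂ) (hJ : J.det ≠ 0) :
    ((Jᵀ * A * J.map (starRingEnd ℂ))⁻¹ * (Jᵀ * B * J.map (starRingEnd ℂ))).trace =
      (A⁻¹ * B).trace := by
  have h1 : IsUnit Jᵀ.det := by rw [det_transpose]; exact Ne.isUnit hJ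
  have h2 : IsUnit (J.map (starRingEnd ℂ)).det := by
    have : (J.map (starRingEnd ℂ)).det = starRingEnd ℂ J.det := ((starRingEnd ℂ).map_det J).symm
    rw [this]; exact Ne.isUnit (by simpa using hJ)
  set K := J.map (starRingEnd ℂ)
  have e : (Jᵀ * A * K)⁻¹ * (Jᵀ * B * K) = K⁻¹ * (A⁻¹ * B * K) := by
    rw [Matrix.mul_inv_rev, Matrix.mul_inv_rev]
    calc K⁻¹ * (A⁻¹ * Jᵀ⁻¹) * (Jᵀ * B * K) = K⁻¹ * A⁻¹ * (Jᵀ⁻¹ * Jᵀ) * B * K := by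
          simp only [Matrix.mul_assoc]
      _ = _ := by rw [nonsing_inv_mul _ h1, Matrix.mul_one]; simp only [Matrix.mul_assoc]
  rw [e, trace_mul_comm, Matrix.mul_assoc, mul_nonsing_inv _ h2, Matrix.mul_one]

section IsForm

variable {α β : Coeff n X}

theorem IsForm.add (hα : IsForm α) (hβ : IsForm β) : IsForm (α + β) where
  hermitian c hc z hz := (hα.hermitian c hc z hz).add (hβ.hermitian c hc z hz)
  smooth c hc i j := (hα.smooth c hc i j).add (hβ.smooth c hc i j)
  transform c hc c' hc' z hz := by
    simp only [Pi.add_apply]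
    rw [hα.transform c hc c' hc' z hz, hβ.transform c hc c' hc' z hz, Matrix.mul_add,
      Matrix.add_mul]

theorem IsForm.fun_smul (hα : IsForm α) {f : X → ℝ} (hf : ChartSmooth (n := n) f) :
    IsForm (fun c z => f (c.symm z) • α c z : Coeff n X) where
  hermitian c hc z hz := by
    rw [IsHermitian, conjTranspose_smul, (hα.hermitian c hc z hz).eq]; simp
  smooth c hc i j := by
    have := (contDiffOn_ofReal (hf c hc)).mul (hα.smooth c hc i j)
    simpa [Matrix.smul_apply] using this
  transform c hc c' hc' z hz := by
    have h1 := (mem_transition_source.1 hz).2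
    rw [hα.transform c hc c' hc' z hz, c'.left_inv h1, Matrix.mul_smul, Matrix.smul_mul]

theorem IsForm.smul (hα : IsForm α) (t : ℝ) : IsForm (t • α) :=
  hα.fun_smul (f := fun _ => t) fun _ _ => contDiffOn_const

theorem IsForm.neg (hα : IsForm α) : IsForm (-α) := by
  have := hα.smul (-1); rwa [neg_one_smul] at this

theorem IsForm.sub (hα : IsForm α) (hβ : IsForm β) : IsForm (α - β) := by
  rw [sub_eq_add_neg]; exact hα.add hβ.neg

theorem IsForm.posSemidef_transfer (hα : IsForm α) {c c' : OpenPartialHomeomorph X (Cn n)}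
    (hc : c ∈ atlas (Cn n) X) (hc' : c' ∈ atlas (Cn n) X) {x : X} (hx : x ∈ c.source)
    (hx' : x ∈ c'.source) (h : (α c' (c' x)).PosSemidef) : (α c (c x)).PosSemidef := by
  have hz : c x ∈ (c.symm.trans c').source := by
    rw [mem_transition_source, c.left_inv hx]; exact ⟨c.map_source hx, hx'⟩
  rw [hα.transform c hc c' hc' _ hz, c.left_inv hx]
  exact posSemidef_pullback h _

theorem IsForm.det_transfer (hα : IsForm α) {c c' : OpenPartialHomeomorph X (Cn n)}
    (hc : c ∈ atlas (Cn n) X) (hc' : c' ∈ atlas (Cn n) X) {x : X} (hx : x ∈ c.source)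
    (hx' : x ∈ c'.source) : (α c (c x)).det.re =
      Complex.normSq (jac c c' (c x)).det * (α c' (c' x)).det.re := by
  have hz : c x ∈ (c.symm.trans c').source := by
    rw [mem_transition_source, c.left_inv hx]; exact ⟨c.map_source hx, hx'⟩
  rw [hα.transform c hc c' hc' _ hz, c.left_inv hx, det_pullback_re]

/-- A degenerate Jacobian would make the pulled back determinant of a positive form vanish. -/
theorem IsForm.jac_det_ne_zero (hα : IsForm α) (hpos : IsPositive α)
    {c c' : OpenPartialHomeomorph X (Cn n)} (hc : c ∈ atlas (Cn n) X) (hc' : c' ∈ atlas (Cn n) X)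
    {z : Cn n} (hz : z ∈ (c.symm.trans c').source) : (jac c c' z).det ≠ 0 := by
  intro h0
  have h1 := (det_re_pos (hpos c hc z (mem_transition_source.1 hz).1)).ne'
  rw [hα.transform c hc c' hc' z hz, det_pullback_re, h0] at h1
  simp at h1

theorem IsForm.trace_transfer (hα : IsForm α) (hpos : IsPositive α) (hβ : IsForm β)
    {c c' : OpenPartialHomeomorph X (Cn n)}
    (hc : c ∈ atlas (Cn n) X) (hc' : c' ∈ atlas (Cn n) X) {x : X} (hx : x ∈ c.source)
    (hx' : x ∈ c'.source) :
    ((α c (c x))⁻¹ * β c (c x)).trace = ((α c' (c' x))⁻¹ * β c' (c' x)).trace := by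
  have hz : c x ∈ (c.symm.trans c').source := by
    rw [mem_transition_source, c.left_inv hx]; exact ⟨c.map_source hx, hx'⟩
  rw [hα.transform c hc c' hc' _ hz, hβ.transform c hc c' hc' _ hz, c.left_inv hx]
  exact trace_inv_mul_pullback _ _ _ (hα.jac_det_ne_zero hpos hc hc' hz)

theorem traceForm_eq (hα : IsForm α) (hpos : IsPositive α) (hβ : IsForm β)
    {c : OpenPartialHomeomorph X (Cn n)} (hc : c ∈ atlas (Cn n) X) {x : X} (hx : x ∈ c.source) :
    traceForm α β x = ((α c (c x))⁻¹ * β c (c x)).trace.re := by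
  rw [traceForm, hα.trace_transfer hpos hβ (chart_mem_atlas _ x) hc (mem_chart_source _ x) hx]

theorem volumeRatio_eq (hα : IsForm α) (hβ : IsForm β) (hpos : IsPositive β)
    {c : OpenPartialHomeomorph X (Cn n)} (hc : c ∈ atlas (Cn n) X) {x : X} (hx : x ∈ c.source) :
    volumeRatio α β x = (α c (c x)).det.re / (β c (c x)).det.re := by
  have hz : chartAt (Cn n) x x ∈ ((chartAt (Cn n) x).symm.trans c).source := by
    rw [mem_transition_source, (chartAt (Cn n) x).left_inv (mem_chart_source _ x)]
    exact ⟨mem_chart_target _ x, hx⟩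
  rw [volumeRatio, hα.det_transfer (chart_mem_atlas _ x) hc (mem_chart_source _ x) hx,
    hβ.det_transfer (chart_mem_atlas _ x) hc (mem_chart_source _ x) hx]
  refine mul_div_mul_left _ _ ?_
  rw [Ne, Complex.normSq_eq_zero]
  exact hβ.jac_det_ne_zero hpos (chart_mem_atlas _ x) hc hz

/-- On a compact manifold every form is dominated by a multiple of a positive one. -/
theorem IsForm.exists_domination [CompactSpace X] (hα : IsForm α) (hβ : IsForm β)
    (hpos : IsPositive β) : ∃ C₀ : ℝ, 0 < C₀ ∧ ∀ C, C₀ ≤ C → ∀ c ∈ atlas (Cn n) X, ∀ z ∈ c.target,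
      (C • β c z - α c z).PosSemidef := by
  have key : ∃ C₀ : ℝ, 0 < C₀ ∧ ∀ C, C₀ ≤ C → ∀ x ∈ (Set.univ : Set X), ∀ c ∈ atlas (Cn n) X,
      x ∈ c.source → (C • β c (c x) - α c (c x)).PosSemidef := by
    refine isCompact_univ.induction_on (p := fun s => ∃ C₀ : ℝ, 0 < C₀ ∧ ∀ C, C₀ ≤ C → ∀ x ∈ s,
      ∀ c ∈ atlas (Cn n) X, x ∈ c.source → (C • β c (c x) - α c (c x)).PosSemidef) ?_ ?_ ?_ ?_
    · exact ⟨1, one_pos, fun C _ x hx => hx.elim⟩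
    · rintro s t hst ⟨C₀, h0, h⟩
      exact ⟨C₀, h0, fun C hC x hx => h C hC x (hst hx)⟩
    · rintro s t ⟨C₁, h1, h⟩ ⟨C₂, h2, h'⟩
      refine ⟨max C₁ C₂, lt_max_of_lt_left h1, fun C hC x hx => ?_⟩
      rcases hx with hx | hx
      · exact h C ((le_max_left _ _).trans hC) x hx
      · exact h' C ((le_max_right _ _).trans hC) x hx
    · intro x₀ _
      set c₀ := chartAt (Cn n) x₀
      have hc₀ : c₀ ∈ atlas (Cn n) X := chart_mem_atlas _ x₀
      obtain ⟨r, hr, hball⟩ := Metric.nhds_basis_closedBall.mem_iff.1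
        (c₀.open_target.mem_nhds (mem_chart_target (Cn n) x₀))
      obtain ⟨C₀, h0, h⟩ := ConicalKRF.exists_domination (isCompact_closedBall (c₀ x₀) r)
        (A := α c₀) (B := β c₀) (fun i j => ((hα.smooth c₀ hc₀ i j).continuousOn).mono hball)
        (fun i j => ((hβ.smooth c₀ hc₀ i j).continuousOn).mono hball)
        (fun y hy => hα.hermitian c₀ hc₀ y (hball hy)) (fun y hy => hpos c₀ hc₀ y (hball hy))
      refine ⟨c₀.source ∩ c₀ ⁻¹' Metric.ball (c₀ x₀) r, ?_, C₀, h0, fun C hC x hx c hc hxc => ?_⟩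
      · refine mem_nhdsWithin_of_mem_nhds ((c₀.continuousOn.isOpen_inter_preimage c₀.open_source
          Metric.isOpen_ball).mem_nhds ⟨mem_chart_source _ x₀, ?_⟩)
        exact Metric.mem_ball_self hr
      · exact ((hβ.smul C).sub hα).posSemidef_transfer hc hc₀ hxc hx.1
          (h C hC _ (Metric.ball_subset_closedBall hx.2))
  obtain ⟨C₀, h0, h⟩ := key
  refine ⟨C₀, h0, fun C hC c hc z hz => ?_⟩
  have := h C hC (c.symm z) trivial c hc (c.map_target hz)
  rwa [c.right_inv hz] at this

end IsForm

section Constructions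

variable [IsManifold 𝓘(ℂ, Cn n) ω X]

theorem isForm_ddbar {f : X → ℝ} (hf : ChartSmooth (n := n) f) : IsForm (ddbar f : Coeff n X) where
  hermitian c hc z hz := isHermitian_complexHessian c.open_target (hf c hc) hz
  smooth c hc i j := contDiffOn_complexHessian c.open_target (hf c hc) i j
  transform c hc c' hc' z hz := by
    have h1 := mem_transition_source.1 hz
    refine complexHessian_transition hc hc' hz c'.open_target (c'.map_source h1.2) (hf c' hc') ?_
    intro w hw _
    rw [c'.left_inv (mem_transition_source.1 hw).2]

theorem contDiffOn_log_volume {ω₀ : Coeff n X} (h₀ : IsForm ω₀) (hpos : IsPositive ω₀) {f : X → ℝ}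
    (hf : ChartSmooth (n := n) f) {c : OpenPartialHomeomorph X (Cn n)} (hc : c ∈ atlas (Cn n) X) :
    ContDiffOn ℝ ∞ (fun w => Real.log (Real.exp (-f (c.symm w)) * (ω₀ c w).det.re)) c.target :=
  ((hf c hc).neg.exp.mul (contDiffOn_re (contDiffOn_det (h₀.smooth c hc)))).log fun w hw =>
    (mul_pos (Real.exp_pos _) (det_re_pos (hpos c hc w hw))).ne'

/-- Under a change of charts `log det` changes by `log|det J|²`, which is pluriharmonic because the
transition map is holomorphic. -/
theorem isForm_ricciOfVolume {ω₀ : Coeff n X} (h₀ : IsForm ω₀) (hpos : IsPositive ω₀) {f : X → ℝ}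
    (hf : ChartSmooth (n := n) f) : IsForm (ricciOfVolume ω₀ f) where
  hermitian c hc z hz :=
    (isHermitian_complexHessian c.open_target (contDiffOn_log_volume h₀ hpos hf hc) hz).neg
  smooth c hc i j :=
    (contDiffOn_complexHessian c.open_target (contDiffOn_log_volume h₀ hpos hf hc) i j).neg
  transform c hc c' hc' z hz := by
    have hlog := contDiffOn_log_volume h₀ hpos hf hc'
    have hO := isOpen_transition_source c c'
    have hF := ((contDiffOn_transition hc hc').restrict_scalars ℝ).of_le
      (show (∞ : WithTop ℕ∞) ≤ ω from le_top)
    have hJ0 : ∀ w ∈ (c.symm.trans c').source, (jac c c' w).det ≠ 0 := fun w hw =>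
      h₀.jac_det_ne_zero hpos hc hc' hw
    have hdet := contDiffOn_det_jac hc hc'
    have hmaps : Set.MapsTo (fun y => c' (c.symm y)) (c.symm.trans c').source c'.target :=
      fun w hw => c'.map_source (mem_transition_source.1 hw).2
    set N : Cn n → ℝ := fun w => Real.log (Complex.normSq (jac c c' w).det)
    set V : Cn n → ℝ := fun w => Real.log (Real.exp (-f (c'.symm w)) * (ω₀ c' w).det.re)
    have hN : ContDiffOn ℝ ∞ N (c.symm.trans c').source := by
      have h1 : ContDiffOn ℝ ∞ (fun w => (jac c c' w).det) (c.symm.trans c').source :=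
        hdet.restrict_scalars ℝ
      have h2 := contDiffOn_re (h1.mul
        ((Complex.conjCLE : ℂ →L[ℝ] ℂ).contDiff.comp_contDiffOn h1))
      refine ContDiffOn.log (h2.congr fun w _ => ?_) fun w hw => by simpa using hJ0 w hw
      change _ = ((jac c c' w).det * starRingEnd ℂ (jac c c' w).det).re
      rw [Complex.mul_conj, Complex.ofReal_re]
    have hV : ContDiffOn ℝ ∞ (fun w => V (c' (c.symm w))) (c.symm.trans c').source :=
      hlog.comp hF hmaps
    have e1 : complexHessian (fun w => Real.log (Real.exp (-f (c.symm w)) * (ω₀ c w).det.re)) z =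
        complexHessian (fun w => N w + V (c' (c.symm w))) z := by
      refine complexHessian_congr_on hO (fun w hw => ?_) hz
      have hw' := mem_transition_source.1 hw
      have hd := det_re_pos (hpos c' hc' _ (hmaps hw))
      simp only [N, V]
      rw [c'.left_inv hw'.2, h₀.transform c hc c' hc' w hw, det_pullback_re,
        ← Real.log_mul (by simpa using hJ0 w hw) (mul_pos (Real.exp_pos _) hd).ne']
      congr 1; ring
    have e2 := complexHessian_log_normSq hO hdet hJ0 hz
    have e3 := complexHessian_transition hc hc' hz (ρ := fun w => V (c' (c.symm w))) (ρ' := V)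
      c'.open_target (hmaps hz) hlog fun w _ _ => rfl
    simp only [ricciOfVolume]
    rw [e1, complexHessian_add hO hN hV hz, e2, e3, zero_add, Matrix.mul_neg, Matrix.neg_mul]

end Constructions

end Forms

/-! ### Hermitian line bundles: frames, curvature and the norm of a section. -/

section LineBundle

open Matrix Bundle

variable {n : ℕ} {X : Type*} [TopologicalSpace X] [ChartedSpace (Cn n) X]
  [IsManifold 𝓘(ℂ, Cn n) ω X]
  {L : X → Type*} [∀ x, AddCommGroup (L x)] [∀ x, Module ℂ (L x)] [∀ x, TopologicalSpace (L x)]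
  [TopologicalSpace (Bundle.TotalSpace ℂ L)] [FiberBundle ℂ L] [VectorBundle ℂ ℂ L]
  [ContMDiffVectorBundle ω ℂ L 𝓘(ℂ, Cn n)]
  (h : HermitianMetric n L)

/-- The squared norm, in a chart, of the holomorphic frame given by a trivialization. -/
def frameNormSq (e : Trivialization ℂ (TotalSpace.proj : TotalSpace ℂ L → X))
    (c : OpenPartialHomeomorph X (Cn n)) (w : Cn n) : ℝ :=
  h.normSq (c.symm w) (e.symm (c.symm w) 1)

/-- The part of the target of a chart over which a trivialization is defined. -/
def chartDomain (e : Trivialization ℂ (TotalSpace.proj : TotalSpace ℂ L → X))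
    (c : OpenPartialHomeomorph X (Cn n)) : Set (Cn n) := c.target ∩ c.symm ⁻¹' e.baseSet

variable {e e' : Trivialization ℂ (TotalSpace.proj : TotalSpace ℂ L → X)}
  {c c' : OpenPartialHomeomorph X (Cn n)}

theorem isOpen_chartDomain : IsOpen (chartDomain e c) :=
  c.isOpen_inter_preimage_symm e.open_baseSet

variable [MemTrivializationAtlas e] [MemTrivializationAtlas e']

theorem contDiffOn_frameNormSq (hc : c ∈ atlas (Cn n) X) :
    ContDiffOn ℝ ∞ (frameNormSq h e c) (chartDomain e c) :=
  contDiffOn_of_contMDiffOn (h.smooth e) hc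

theorem symm_eq_smul {b : X} (hb : b ∈ e.baseSet) (v : ℂ) : e.symm b v = v • e.symm b 1 := by
  have h1 := (e.symmₗ ℂ b).map_smul v 1
  rw [Trivialization.symmₗ_apply _ hb, Trivialization.symmₗ_apply _ hb, smul_eq_mul, mul_one] at h1
  exact h1

theorem eq_smul_frame {b : X} (hb : b ∈ e.baseSet) (v : L b) :
    v = (e (TotalSpace.mk' ℂ b v)).2 • e.symm b 1 := by
  rw [← symm_eq_smul hb]
  exact (e.symm_apply_apply_mk hb v).symm

theorem frame_ne_zero {b : X} (hb : b ∈ e.baseSet) : e.symm b 1 ≠ 0 := by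
  intro h0
  have h1 : (e (TotalSpace.mk b (e.symm b 1))).2 = 1 := by rw [e.apply_mk_symm hb]
  have h2 : (e (TotalSpace.mk b (e.symm b 0))).2 = 0 := by rw [e.apply_mk_symm hb]
  rw [symm_eq_smul hb 0, zero_smul, ← h0, h1] at h2
  exact one_ne_zero h2

theorem frameNormSq_pos {w : Cn n} (hw : w ∈ chartDomain e c) : 0 < frameNormSq h e c w :=
  h.pos _ _ (frame_ne_zero hw.2)

theorem contDiffOn_comp_symm {f : X → ℂ} {O : Set X}
    (hf : ContMDiffOn 𝓘(ℂ, Cn n) 𝓘(ℂ, ℂ) ω f O) (hc : c ∈ atlas (Cn n) X) :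
    ContDiffOn ℂ ∞ (fun w => f (c.symm w)) (c.target ∩ c.symm ⁻¹' O) := by
  have h1 : ContMDiffOn 𝓘(ℂ, Cn n) 𝓘(ℂ, Cn n) ω c.symm c.target :=
    contMDiffOn_symm_of_mem_maximalAtlas (IsManifold.subset_maximalAtlas hc)
  exact (contMDiffOn_iff_contDiffOn.1
    (hf.comp (h1.mono Set.inter_subset_left) fun x hx => hx.2)).of_le le_top

/-- Two frames differ by a holomorphic function without zeros, whose `log|g|²` has zero Hessian. -/
theorem complexHessian_log_frameNormSq_eq (hc : c ∈ atlas (Cn n) X) {z : Cn n}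
    (hz : z ∈ chartDomain e c) (hz' : z ∈ chartDomain e' c) :
    complexHessian (fun w => Real.log (frameNormSq h e c w)) z =
      complexHessian (fun w => Real.log (frameNormSq h e' c w)) z := by
  set g : X → ℂ := fun b => (e.coordChangeL ℂ e' b : ℂ →L[ℂ] ℂ) 1 with hg
  have hgs : ContMDiffOn 𝓘(ℂ, Cn n) 𝓘(ℂ, ℂ) ω g (e.baseSet ∩ e'.baseSet) := by
    have h1 := contMDiffOn_coordChangeL (n := ω) (IB := 𝓘(ℂ, Cn n)) e e'
    exact h1.clm_apply contMDiffOn_const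
  have hge : ∀ b ∈ e.baseSet ∩ e'.baseSet, e.symm b 1 = g b • e'.symm b 1 := fun b hb => by
    have h1 : g b = (e' ⟨b, e.symm b 1⟩).2 := e.coordChangeL_apply e' hb 1
    rw [h1]
    exact eq_smul_frame hb.2 _
  have hg0 : ∀ b ∈ e.baseSet ∩ e'.baseSet, g b ≠ 0 := fun b hb h0 => by
    have := hge b hb
    rw [h0, zero_smul] at this
    exact frame_ne_zero hb.1 this
  set W := c.target ∩ c.symm ⁻¹' (e.baseSet ∩ e'.baseSet) with hW
  have hWo : IsOpen W := c.isOpen_inter_preimage_symm (e.open_baseSet.inter e'.open_baseSet)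
  have hzW : z ∈ W := ⟨hz.1, hz.2, hz'.2⟩
  have hgc := contDiffOn_comp_symm hgs hc
  have hgc0 : ∀ w ∈ W, g (c.symm w) ≠ 0 := fun w hw => hg0 _ hw.2
  have hfr : ContDiffOn ℝ ∞ (fun w => Real.log (frameNormSq h e' c w)) W :=
    ((contDiffOn_frameNormSq h hc).mono fun w hw => (⟨hw.1, hw.2.2⟩ : w ∈ chartDomain e' c)).log
      fun w hw => (frameNormSq_pos (e := e') h ⟨hw.1, hw.2.2⟩).ne'
  have hN : ContDiffOn ℝ ∞ (fun w => Real.log (Complex.normSq (g (c.symm w)))) W := by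
    have h1 : ContDiffOn ℝ ∞ (fun w => g (c.symm w)) W := hgc.restrict_scalars ℝ
    have h2 := contDiffOn_re (h1.mul
      ((Complex.conjCLE : ℂ →L[ℝ] ℂ).contDiff.comp_contDiffOn h1))
    refine ContDiffOn.log (h2.congr fun w _ => ?_) fun w hw => by simpa using hgc0 w hw
    change _ = (g (c.symm w) * starRingEnd ℂ (g (c.symm w))).re
    rw [Complex.mul_conj, Complex.ofReal_re]
  rw [complexHessian_congr_on hWo (v := fun w => Real.log (Complex.normSq (g (c.symm w))) +
    Real.log (frameNormSq h e' c w)) _ hzW, complexHessian_add hWo hN hfr hzW,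
    complexHessian_log_normSq hWo hgc hgc0 hzW, zero_add]
  intro w hw
  rw [← Real.log_mul (by simpa using hgc0 w hw)
    (frameNormSq_pos (e := e') h ⟨hw.1, hw.2.2⟩).ne', frameNormSq, hge _ hw.2, h.smul,
    Complex.normSq_eq_norm_sq, frameNormSq]

theorem curvature_eq (hc : c ∈ atlas (Cn n) X) {z : Cn n} (hz : z ∈ chartDomain e c) :
    h.curvature c z = -complexHessian (fun w => Real.log (frameNormSq h e c w)) z := by
  rw [complexHessian_log_frameNormSq_eq h (e' := trivializationAt ℂ L (c.symm z)) hc hz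
    ⟨hz.1, FiberBundle.mem_baseSet_trivializationAt' _⟩]
  rfl

theorem mem_chartDomain_trivializationAt {z : Cn n} (hz : z ∈ c.target) :
    z ∈ chartDomain (trivializationAt ℂ L (c.symm z)) c :=
  ⟨hz, FiberBundle.mem_baseSet_trivializationAt' _⟩

theorem contDiffOn_log_frameNormSq (hc : c ∈ atlas (Cn n) X) :
    ContDiffOn ℝ ∞ (fun w => Real.log (frameNormSq h e c w)) (chartDomain e c) :=
  (contDiffOn_frameNormSq h hc).log fun _ hw => (frameNormSq_pos h hw).ne'

theorem isForm_curvature : IsForm h.curvature where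
  hermitian c hc z hz := by
    have hm := mem_chartDomain_trivializationAt (L := L) hz
    rw [curvature_eq h hc hm]
    exact (isHermitian_complexHessian isOpen_chartDomain (contDiffOn_log_frameNormSq h hc) hm).neg
  smooth c hc i j := by
    intro z hz
    have hm := mem_chartDomain_trivializationAt (L := L) hz
    have h1 := (contDiffOn_complexHessian isOpen_chartDomain
      (contDiffOn_log_frameNormSq h (e := trivializationAt ℂ L (c.symm z)) hc) i j).neg
    refine ContDiffAt.contDiffWithinAt ((h1.contDiffAt
      (isOpen_chartDomain.mem_nhds hm)).congr_of_eventuallyEq ?_)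
    filter_upwards [isOpen_chartDomain.mem_nhds hm] with w hw
    rw [curvature_eq h hc hw]; rfl
  transform c hc c' hc' z hz := by
    have h1 := mem_transition_source.1 hz
    set e := trivializationAt ℂ L (c.symm z)
    have hm : z ∈ chartDomain e c := mem_chartDomain_trivializationAt (L := L) h1.1
    have hm' : c' (c.symm z) ∈ chartDomain e c' := by
      refine ⟨c'.map_source h1.2, ?_⟩
      rw [Set.mem_preimage, c'.left_inv h1.2]; exact hm.2
    rw [curvature_eq h hc hm, curvature_eq h hc' hm',
      complexHessian_transition hc hc' hz isOpen_chartDomain hm' (contDiffOn_log_frameNormSq h hc'),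
      Matrix.mul_neg, Matrix.neg_mul]
    intro w hw _
    simp only [frameNormSq]
    rw [c'.left_inv (mem_transition_source.1 hw).2]

variable (s : ContMDiffSection 𝓘(ℂ, Cn n) ℂ ω L)

/-- The coefficient of a section in a trivialization, read in a chart. -/
def sectionCoeff (e : Trivialization ℂ (TotalSpace.proj : TotalSpace ℂ L → X))
    (c : OpenPartialHomeomorph X (Cn n)) (w : Cn n) : ℂ :=
  (e (TotalSpace.mk' ℂ (c.symm w) (s (c.symm w)))).2

theorem localSection (hc : c ∈ atlas (Cn n) X) :
    LocalSection (chartDomain e c) (frameNormSq h e c) (sectionCoeff s e c) where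
  isOpen := isOpen_chartDomain
  smooth := contDiffOn_frameNormSq h hc
  pos _ hw := frameNormSq_pos h hw
  holo := contDiffOn_comp_symm
    ((e.contMDiffOn_section_baseSet_iff (IB := 𝓘(ℂ, Cn n)) (n := ω)).1
      (s.contMDiff.contMDiffOn)) hc

theorem normSq_section_eq {w : Cn n} (hw : w ∈ chartDomain e c) :
    h.normSq (c.symm w) (s (c.symm w)) =
      sectionNormSq (frameNormSq h e c) (sectionCoeff s e c) w := by
  rw [sectionNormSq, mul_comm, Complex.normSq_eq_norm_sq, frameNormSq, ← h.smul]
  congr 1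
  exact eq_smul_frame hw.2 _

theorem normSq_section_nonneg (x : X) : 0 ≤ h.normSq x (s x) := by
  by_cases hx : s x = 0
  · have := h.smul x 0 (0 : L x)
    rw [hx]; simp at this; rw [this]
  · exact (h.pos _ _ hx).le

theorem chartSmooth_normSq : ChartSmooth (n := n) fun x => h.normSq x (s x) := by
  intro c hc z hz
  have hm := mem_chartDomain_trivializationAt (L := L) hz
  have h1 := (localSection h s (e := trivializationAt ℂ L (c.symm z)) hc).smooth_normSq
  refine ContDiffAt.contDiffWithinAt ((h1.contDiffAt
      (isOpen_chartDomain.mem_nhds hm)).congr_of_eventuallyEq ?_)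
  filter_upwards [isOpen_chartDomain.mem_nhds hm] with w hw
  exact normSq_section_eq h s hw

end LineBundle

end ConicalKRF

namespace ConicalKRF

open Matrix

/-! ### The order on Hermitian matrices. -/

section Domination

variable {m : Type*} [Fintype m]

theorem posSemidef_real_smul {A : Matrix m m ℂ} (hA : A.PosSemidef) {c : ℝ} (hc : 0 ≤ c) :
    (c • A).PosSemidef := hA.smul hc

theorem posDef_real_smul {A : Matrix m m ℂ} (hA : A.PosDef) {c : ℝ} (hc : 0 < c) :
    (c • A).PosDef := hA.smul hc

/-- `A ≤ B` as Hermitian matrices. -/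
def MatLE (A B : Matrix m m ℂ) : Prop := (B - A).PosSemidef

variable {A B A' B' E : Matrix m m ℂ} {c d : ℝ}

theorem MatLE.refl (A : Matrix m m ℂ) : MatLE A A := by
  rw [MatLE, sub_self]; exact PosSemidef.zero

theorem MatLE.trans (h : MatLE A B) (h' : MatLE B E) : MatLE A E := by
  rw [MatLE, show E - A = (E - B) + (B - A) by abel]; exact h'.add h

theorem MatLE.add (h : MatLE A B) (h' : MatLE A' B') : MatLE (A + A') (B + B') := by
  rw [MatLE, show B + B' - (A + A') = (B - A) + (B' - A') by abel]; exact PosSemidef.add h h'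

theorem MatLE.smul (h : MatLE A B) (hc : 0 ≤ c) : MatLE (c • A) (c • B) := by
  rw [MatLE, ← smul_sub]; exact posSemidef_real_smul h hc

theorem MatLE.smul_le (hA : A.PosSemidef) (h : c ≤ d) : MatLE (c • A) (d • A) := by
  rw [MatLE, ← sub_smul]; exact posSemidef_real_smul hA (sub_nonneg.2 h)

/-- Multiplication of a matrix, which is bounded on both sides, by a bounded number. -/
theorem MatLE.smul_of_abs_le (hB : B.PosSemidef) (h : MatLE A B) (h' : MatLE (-A) B)
    (hc : |c| ≤ d) : MatLE (c • A) (d • B) := by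
  rcases le_total 0 c with h0 | h0
  · rw [abs_of_nonneg h0] at hc
    exact (h.smul h0).trans (MatLE.smul_le hB hc)
  · rw [abs_of_nonpos h0] at hc
    rw [show c • A = (-c) • (-A) by module]
    exact (h'.smul (by linarith)).trans (MatLE.smul_le hB hc)

theorem MatLE.posDef (h : MatLE A B) (hA : A.PosDef) : B.PosDef := by
  have := hA.add_posSemidef h
  rwa [add_sub_cancel] at this

theorem MatLE.trace_le [DecidableEq m] {P : Matrix m m ℂ} (h : MatLE A B) (hP : P.PosSemidef) :
    (P * A).trace.re ≤ (P * B).trace.re := trace_mul_le hP h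

end Domination

/-! ### Norms of defining sections and the model cone metric. -/

variable {n : ℕ} {X : Type*} [TopologicalSpace X] [ChartedSpace (Cn n) X]

theorem ChartSmooth.continuous {f : X → ℝ} (hf : ChartSmooth (n := n) f) : Continuous f := by
  rw [continuous_iff_continuousAt]
  intro x
  set c := chartAt (Cn n) x
  have h1 : ContinuousAt (fun w => f (c.symm w)) (c x) :=
    ((hf c (chart_mem_atlas _ x)).continuousOn).continuousAt
      (c.open_target.mem_nhds (mem_chart_target _ x))
  have h2 : ContinuousAt (fun y => f (c.symm (c y))) x :=
    ContinuousAt.comp (f := c) (g := fun w => f (c.symm w)) h1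
      (c.continuousAt (mem_chart_source _ x))
  refine h2.congr ?_
  filter_upwards [c.open_source.mem_nhds (mem_chart_source _ x)] with y hy
  rw [c.left_inv hy]

/-- In the chart `c`, over `U`, the function `σ` is the squared norm of a holomorphic function `S`
with respect to a metric `a`, whose curvature form is `θ`. -/
structure IsLocalNorm (σ : X → ℝ) (θ : Coeff n X) (c : OpenPartialHomeomorph X (Cn n))
    (U : Set (Cn n)) (a : Cn n → ℝ) (S : Cn n → ℂ) : Prop where
  localSection : LocalSection U a S
  subset : U ⊆ c.target
  norm_eq : ∀ w ∈ U, σ (c.symm w) = sectionNormSq a S w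
  curv_eq : ∀ w ∈ U, θ c w = -complexHessian (fun v => Real.log (a v)) w

/-- `σ` is the squared norm of a defining section of a smooth divisor, for a Hermitian metric with
curvature form `θ`. -/
structure IsDivisorNorm (σ : X → ℝ) (θ : Coeff n X) : Prop where
  smooth : ChartSmooth (n := n) σ
  isForm : IsForm θ
  nonneg : ∀ x, 0 ≤ σ x
  exists_local : ∀ c ∈ atlas (Cn n) X, ∀ z ∈ c.target, ∃ U a S, IsLocalNorm σ θ c U a S ∧ z ∈ U
  transversal : ∀ x, ∃ U a S, IsLocalNorm σ θ (chartAt (Cn n) x) U a S ∧ chartAt (Cn n) x x ∈ U ∧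
    (S (chartAt (Cn n) x x) = 0 → holDiff S (chartAt (Cn n) x x) ≠ 0)

/-- The form `√-1∂∂̄σ + σθ`. -/
def divisorForm (σ : X → ℝ) (θ : Coeff n X) : Coeff n X :=
  fun c z => ddbar σ c z + σ (c.symm z) • θ c z

/-- The weight `(ε² + σ)^{γ-1}`. -/
def coneWeight (γ ε x : ℝ) : ℝ := (ε ^ 2 + x) ^ (γ - 1)

/-- The model form `ω₀ + (ε² + σ)^{γ-1} (√-1∂∂̄σ + σθ)` of a metric with cone singularities. -/
def modelForm (ω₀ : Coeff n X) (σ : X → ℝ) (θ : Coeff n X) (γ ε : ℝ) : Coeff n X :=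
  fun c z => ω₀ c z + coneWeight γ ε (σ (c.symm z)) • divisorForm σ θ c z

theorem coneWeight_pos {γ ε x : ℝ} (hε : 0 < ε) (hx : 0 ≤ x) : 0 < coneWeight γ ε x :=
  Real.rpow_pos_of_pos (by positivity) _

namespace IsLocalNorm

variable {σ : X → ℝ} {θ : Coeff n X} {c : OpenPartialHomeomorph X (Cn n)} {U : Set (Cn n)}
  {a : Cn n → ℝ} {S : Cn n → ℂ} {z : Cn n}

theorem divisorForm_eq (h : IsLocalNorm σ θ c U a S) (hz : z ∈ U) :
    divisorForm σ θ c z = a z • rankOne (covDiff a S z) := by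
  rw [divisorForm, ddbar, complexHessian_congr_on h.localSection.isOpen h.norm_eq hz,
    h.localSection.complexHessian_sectionNormSq hz, h.norm_eq z hz, h.curv_eq z hz]
  module

/-- Separates the Hessian into a semipositive part, which carries the unbounded weight, and a
multiple of `θ` whose coefficient stays bounded as `ε → 0`. The choice of `k₀` and the comparison
with the model metric rest on this. -/
theorem ddbar_chi_eq (h : IsLocalNorm σ θ c U a S) (hz : z ∈ U) {γ ε : ℝ} (hγ : γ ≠ 0)
    (hε : 0 < ε) : ddbar (chi σ γ ε) c z =
      coneWeight γ ε (σ (c.symm z)) • divisorForm σ θ c z -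
        (((ε ^ 2 + σ (c.symm z)) ^ γ - ε ^ (2 * γ)) / γ) • θ c z := by
  rw [h.divisorForm_eq hz, ddbar, complexHessian_congr_on h.localSection.isOpen
    (v := fun w => conePotential γ ε (sectionNormSq a S w))
    (fun w hw => by rw [← h.norm_eq w hw]; rfl) hz,
    h.localSection.complexHessian_conePotential hz hγ hε, h.norm_eq z hz, h.curv_eq z hz, coneWeight]
  module

theorem ddbar_log_eq (h : IsLocalNorm σ θ c U a S) (hz : z ∈ U) {ε : ℝ} (hε : 0 < ε) :
    ddbar (fun x => Real.log (ε ^ 2 + σ x)) c z =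
      (ε ^ 2 / (ε ^ 2 + σ (c.symm z)) ^ 2) • divisorForm σ θ c z -
        (σ (c.symm z) / (ε ^ 2 + σ (c.symm z))) • θ c z := by
  rw [h.divisorForm_eq hz, ddbar, complexHessian_congr_on h.localSection.isOpen
    (v := fun w => Real.log (ε ^ 2 + sectionNormSq a S w))
    (fun w hw => by rw [← h.norm_eq w hw]) hz,
    h.localSection.complexHessian_log_add hz hε, h.norm_eq z hz, h.curv_eq z hz]
  module

end IsLocalNorm

namespace IsDivisorNorm

variable {σ : X → ℝ} {θ : Coeff n X} {c : OpenPartialHomeomorph X (Cn n)} {z : Cn n} {γ ε : ℝ}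

theorem posSemidef_divisorForm (h : IsDivisorNorm σ θ) (hc : c ∈ atlas (Cn n) X)
    (hz : z ∈ c.target) : (divisorForm σ θ c z).PosSemidef := by
  obtain ⟨U, a, S, hl, hzU⟩ := h.exists_local c hc z hz
  rw [hl.divisorForm_eq hzU]
  exact posSemidef_real_smul (rankOne_posSemidef _) (hl.localSection.pos z hzU).le

theorem isForm_divisorForm [IsManifold 𝓘(ℂ, Cn n) ω X] (h : IsDivisorNorm σ θ) :
    IsForm (divisorForm σ θ) :=
  (isForm_ddbar h.smooth).add (h.isForm.fun_smul h.smooth)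

theorem ddbar_chi_eq (h : IsDivisorNorm σ θ) (hc : c ∈ atlas (Cn n) X) (hz : z ∈ c.target)
    (hγ : γ ≠ 0) (hε : 0 < ε) : ddbar (chi σ γ ε) c z =
      coneWeight γ ε (σ (c.symm z)) • divisorForm σ θ c z -
        (((ε ^ 2 + σ (c.symm z)) ^ γ - ε ^ (2 * γ)) / γ) • θ c z := by
  obtain ⟨U, a, S, hl, hzU⟩ := h.exists_local c hc z hz
  exact hl.ddbar_chi_eq hzU hγ hε

theorem ddbar_log_eq (h : IsDivisorNorm σ θ) (hc : c ∈ atlas (Cn n) X) (hz : z ∈ c.target)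
    (hε : 0 < ε) : ddbar (fun x => Real.log (ε ^ 2 + σ x)) c z =
      (ε ^ 2 / (ε ^ 2 + σ (c.symm z)) ^ 2) • divisorForm σ θ c z -
        (σ (c.symm z) / (ε ^ 2 + σ (c.symm z))) • θ c z := by
  obtain ⟨U, a, S, hl, hzU⟩ := h.exists_local c hc z hz
  exact hl.ddbar_log_eq hzU hε

theorem chartSmooth_comp (h : IsDivisorNorm σ θ) {F : ℝ → ℝ} {V : Set ℝ}
    (hF : ContDiffOn ℝ ∞ F V) (hV : ∀ x, 0 ≤ x → x ∈ V) :
    ChartSmooth (n := n) fun x => F (σ x) := fun c hc =>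
  hF.comp (h.smooth c hc) fun _ _ => hV _ (h.nonneg _)

theorem chartSmooth_chi (h : IsDivisorNorm σ θ) (hγ : γ ≠ 0) (hε : 0 < ε) :
    ChartSmooth (n := n) (chi σ γ ε) :=
  h.chartSmooth_comp (contDiffOn_conePotential hγ hε) fun x hx => by
    have : 0 < ε ^ 2 := by positivity
    simp only [Set.mem_Ioi]; linarith

theorem chartSmooth_log (h : IsDivisorNorm σ θ) (hε : 0 < ε) :
    ChartSmooth (n := n) fun x => Real.log (ε ^ 2 + σ x) :=
  h.chartSmooth_comp (F := fun x => Real.log (ε ^ 2 + x)) (V := Set.Ici 0)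
    ((contDiffOn_const.add contDiffOn_id).log fun x hx => by
      have : 0 ≤ x := hx
      simp only [id]; positivity) fun x hx => hx

theorem chartSmooth_coneWeight (h : IsDivisorNorm σ θ) (hε : 0 < ε) :
    ChartSmooth (n := n) fun x => coneWeight γ ε (σ x) :=
  h.chartSmooth_comp (F := coneWeight γ ε) (V := Set.Ici 0) (fun x hx => by
      have : 0 ≤ x := hx
      exact ((contDiffAt_const.add contDiffAt_id).rpow_const_of_ne
        (by simp only [id]; positivity)).contDiffWithinAt) fun x hx => hx

theorem isForm_modelForm [IsManifold 𝓘(ℂ, Cn n) ω X] (h : IsDivisorNorm σ θ) {ω₀ : Coeff n X}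
    (h₀ : IsForm ω₀) (hε : 0 < ε) : IsForm (modelForm ω₀ σ θ γ ε) :=
  h₀.add (h.isForm_divisorForm.fun_smul (h.chartSmooth_coneWeight hε))

theorem isForm_coneApprox [IsManifold 𝓘(ℂ, Cn n) ω X] (h : IsDivisorNorm σ θ) {ω₀ : Coeff n X}
    (h₀ : IsForm ω₀) (hγ : γ ≠ 0) (hε : 0 < ε) (k : ℝ) : IsForm (coneApprox ω₀ σ k γ ε) :=
  h₀.add ((isForm_ddbar (h.chartSmooth_chi hγ hε)).smul k)

theorem modelForm_posDef (h : IsDivisorNorm σ θ) {ω₀ : Coeff n X} (hpos : IsPositive ω₀)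
    (hε : 0 < ε) : IsPositive (modelForm ω₀ σ θ γ ε) := fun c hc z hz =>
  (hpos c hc z hz).add_posSemidef
    (posSemidef_real_smul (h.posSemidef_divisorForm hc hz) (coneWeight_pos hε (h.nonneg _)).le)

theorem le_modelForm (h : IsDivisorNorm σ θ) (ω₀ : Coeff n X) (hε : 0 < ε)
    (hc : c ∈ atlas (Cn n) X) (hz : z ∈ c.target) : MatLE (ω₀ c z) (modelForm ω₀ σ θ γ ε c z) := by
  rw [MatLE, modelForm, add_sub_cancel_left]
  exact posSemidef_real_smul (h.posSemidef_divisorForm hc hz) (coneWeight_pos hε (h.nonneg _)).le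

theorem exists_norm_le [CompactSpace X] (h : IsDivisorNorm σ θ) : ∃ B, 0 < B ∧ ∀ x, σ x ≤ B := by
  obtain ⟨B, hB⟩ := isCompact_univ.bddAbove_image h.smooth.continuous.continuousOn
  exact ⟨max B 1, by positivity, fun x => (hB ⟨x, trivial, rfl⟩).trans (le_max_left _ _)⟩

/-- The section and its covariant derivative do not vanish simultaneously. -/
theorem exists_lower_bound [CompactSpace X] [IsManifold 𝓘(ℂ, Cn n) ω X] (h : IsDivisorNorm σ θ)
    {ω₀ : Coeff n X} (h₀ : IsForm ω₀) (hpos : IsPositive ω₀) :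
    ∃ m, 0 < m ∧ ∀ c ∈ atlas (Cn n) X, ∀ z ∈ c.target,
      m ≤ σ (c.symm z) + ((ω₀ c z)⁻¹ * divisorForm σ θ c z).trace.re := by
  have key : ∃ m : ℝ, 0 < m ∧ ∀ x ∈ (Set.univ : Set X), ∀ c ∈ atlas (Cn n) X, x ∈ c.source →
      m ≤ σ x + ((ω₀ c (c x))⁻¹ * divisorForm σ θ c (c x)).trace.re := by
    refine isCompact_univ.induction_on (p := fun s => ∃ m : ℝ, 0 < m ∧ ∀ x ∈ s,
      ∀ c ∈ atlas (Cn n) X, x ∈ c.source →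
        m ≤ σ x + ((ω₀ c (c x))⁻¹ * divisorForm σ θ c (c x)).trace.re) ?_ ?_ ?_ ?_
    · exact ⟨1, one_pos, fun x hx => hx.elim⟩
    · rintro s t hst ⟨m, h0, hm⟩
      exact ⟨m, h0, fun x hx => hm x (hst hx)⟩
    · rintro s t ⟨m₁, h1, hm₁⟩ ⟨m₂, h2, hm₂⟩
      refine ⟨min m₁ m₂, lt_min h1 h2, fun x hx c hc hxc => ?_⟩
      rcases hx with hx | hx
      · exact (min_le_left _ _).trans (hm₁ x hx c hc hxc)
      · exact (min_le_right _ _).trans (hm₂ x hx c hc hxc)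
    · intro x₀ _
      obtain ⟨U, a, S, hl, hxU, htr⟩ := h.transversal x₀
      set c₀ := chartAt (Cn n) x₀
      have hc₀ : c₀ ∈ atlas (Cn n) X := chart_mem_atlas _ x₀
      set u : Cn n → ℝ := fun z => σ (c₀.symm z) + ((ω₀ c₀ z)⁻¹ * divisorForm σ θ c₀ z).trace.re
      have hu : ContinuousOn u c₀.target := by
        have h1 := SmoothMat.inv (U := c₀.target) (h₀.smooth c₀ hc₀) (hpos c₀ hc₀)
        have h2 := h1.mul (h.isForm_divisorForm.smooth c₀ hc₀)
        have h3 : ContDiffOn ℝ ∞ (fun z => ((ω₀ c₀ z)⁻¹ * divisorForm σ θ c₀ z).trace) c₀.target := by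
          simp only [trace, diag_apply]
          exact ContDiffOn.sum fun i _ => h2 i i
        exact ((h.smooth c₀ hc₀).add (contDiffOn_re h3)).continuousOn
      have hx₀ : c₀ x₀ ∈ c₀.target := mem_chart_target _ x₀
      -- Off the divisor `σ` is positive. On it `∇S = ∂S ≠ 0` by transversality, so the trace is
      -- positive.
      have hu0 : 0 < u (c₀ x₀) := by
        have ha := hl.localSection.pos _ hxU
        have hP := (hpos c₀ hc₀ _ hx₀).inv
        simp only [u]
        rw [hl.divisorForm_eq hxU, hl.norm_eq _ hxU, sectionNormSq, trace_mul_real_smul,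
          trace_mul_rankOne]
        by_cases hS : S (c₀ x₀) = 0
        · have hτ : covDiff a S (c₀ x₀) ≠ 0 := by
            have : covDiff a S (c₀ x₀) = holDiff S (c₀ x₀) := by
              ext i; simp [covDiff, hS]
            rw [this]; exact htr hS
          rw [hS, map_zero, mul_zero, zero_add]
          exact mul_pos ha (hP.re_dotProduct_pos hτ)
        · have h1 := hP.posSemidef.dotProduct_mulVec_nonneg (covDiff a S (c₀ x₀))
          exact add_pos_of_pos_of_nonneg (mul_pos ha (Complex.normSq_pos.2 hS))
            (mul_nonneg ha.le (Complex.le_def.1 h1).1)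
      have hev : ∀ᶠ z in 𝓝 (c₀ x₀), u (c₀ x₀) / 2 < u z :=
        (hu.continuousAt (c₀.open_target.mem_nhds hx₀)).eventually (lt_mem_nhds (half_lt_self hu0))
      refine ⟨c₀.source ∩ c₀ ⁻¹' {z | u (c₀ x₀) / 2 < u z}, ?_, u (c₀ x₀) / 2, half_pos hu0, ?_⟩
      · exact mem_nhdsWithin_of_mem_nhds (Filter.inter_mem
          (c₀.open_source.mem_nhds (mem_chart_source _ x₀))
          ((c₀.continuousAt (mem_chart_source _ x₀)).eventually hev))
      · intro x hx c hc hxc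
        have h1 : u (c₀ x₀) / 2 < u (c₀ x) := hx.2
        simp only [u] at h1
        rw [c₀.left_inv hx.1] at h1
        rw [h₀.trace_transfer hpos h.isForm_divisorForm hc hc₀ hxc hx.1]
        exact h1.le
  obtain ⟨m, h0, hm⟩ := key
  refine ⟨m, h0, fun c hc z hz => ?_⟩
  have := hm (c.symm z) trivial c hc (c.map_target hz)
  rwa [c.right_inv hz] at this

/-- The model is a perturbation of `ω₀` of rank at most one, so the matrix determinant lemma gives
its volume exactly. -/
theorem det_modelForm (h : IsDivisorNorm σ θ) {ω₀ : Coeff n X} (hpos : IsPositive ω₀)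
    (hc : c ∈ atlas (Cn n) X) (hz : z ∈ c.target) : (modelForm ω₀ σ θ γ ε c z).det.re =
      (ω₀ c z).det.re * (1 + coneWeight γ ε (σ (c.symm z)) *
        ((ω₀ c z)⁻¹ * divisorForm σ θ c z).trace.re) := by
  obtain ⟨U, a, S, hl, hzU⟩ := h.exists_local c hc z hz
  rw [modelForm, hl.divisorForm_eq hzU, smul_smul, det_add_smul_rankOne (hpos c hc z hz),
    trace_mul_real_smul, trace_mul_rankOne, mul_assoc]

/-- The volume form of the model metric is bounded below by a multiple of the weight. -/
theorem exists_det_modelForm_lower [CompactSpace X] [IsManifold 𝓘(ℂ, Cn n) ω X]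
    (h : IsDivisorNorm σ θ) {ω₀ : Coeff n X} (h₀ : IsForm ω₀) (hpos : IsPositive ω₀)
    (hγ : γ < 1) : ∃ m, 0 < m ∧ ∀ ε, 0 < ε → ∀ c ∈ atlas (Cn n) X, ∀ z ∈ c.target,
      m * coneWeight γ ε (σ (c.symm z)) * (ω₀ c z).det.re ≤
        (modelForm ω₀ σ θ γ ε c z).det.re := by
  obtain ⟨m, hm, hb⟩ := h.exists_lower_bound h₀ hpos
  -- One of `σ` and the trace of the divisor form is at least `m/2`. In the first case the weight is
  -- at most `(m/2)^{γ-1}`, so the summand `1` suffices; in the second the rank one term dominates.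
  refine ⟨min ((m / 2) ^ (1 - γ)) (m / 2), lt_min (by positivity) (by positivity),
    fun ε hε c hc z hz => ?_⟩
  have hd := det_re_pos (hpos c hc z hz)
  have hσ := h.nonneg (c.symm z)
  have hw := coneWeight_pos (γ := γ) hε hσ
  have ht : 0 ≤ ((ω₀ c z)⁻¹ * divisorForm σ θ c z).trace.re :=
    trace_mul_re_nonneg (hpos c hc z hz).inv.posSemidef (h.posSemidef_divisorForm hc hz)
  have hsum := hb c hc z hz
  rw [h.det_modelForm hpos hc hz, mul_comm (ω₀ c z).det.re]
  refine mul_le_mul_of_nonneg_right ?_ hd.le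
  by_cases hcase : m / 2 ≤ σ (c.symm z)
  · have h1 : (m / 2) ^ (1 - γ) * coneWeight γ ε (σ (c.symm z)) ≤ 1 := by
      have e : coneWeight γ ε (σ (c.symm z)) = ((ε ^ 2 + σ (c.symm z)) ^ (1 - γ))⁻¹ := by
        rw [coneWeight, ← Real.rpow_neg (by positivity), neg_sub]
      rw [e, ← div_eq_mul_inv]
      refine div_le_one_of_le₀ (Real.rpow_le_rpow (by positivity) ?_ (by linarith)) (by positivity)
      nlinarith [sq_nonneg ε]
    calc _ ≤ (m / 2) ^ (1 - γ) * coneWeight γ ε (σ (c.symm z)) := by gcongr; exact min_le_left _ _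
      _ ≤ 1 := h1
      _ ≤ _ := le_add_of_nonneg_right (mul_nonneg hw.le ht)
  · push Not at hcase
    calc _ ≤ (m / 2) * coneWeight γ ε (σ (c.symm z)) := by gcongr; exact min_le_right _ _
      _ ≤ coneWeight γ ε (σ (c.symm z)) * ((ω₀ c z)⁻¹ * divisorForm σ θ c z).trace.re := by
        rw [mul_comm]; gcongr; linarith
      _ ≤ _ := by linarith

end IsDivisorNorm

end ConicalKRF

namespace ConicalKRF

open Matrix

/-! ### Rank one forms and norms of covectors. -/

section RankOne

variable {n : ℕ} {ξ τ : Fin n → ℂ} {G : Matrix (Fin n) (Fin n) ℂ}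

theorem formNormSq_eq_trace (G : Matrix (Fin n) (Fin n) ℂ) (ξ : Fin n → ℂ) :
    formNormSq G ξ = (G⁻¹ * rankOne ξ).trace.re := by
  rw [trace_mul_rankOne, formNormSq]

theorem rankOne_smul (s : ℂ) (v : Fin n → ℂ) : rankOne (s • v) = Complex.normSq s • rankOne v := by
  ext i j
  simp only [rankOne, vecMulVec_apply, Pi.smul_apply, Pi.star_apply, smul_eq_mul, star_mul',
    Matrix.smul_apply, Complex.real_smul, ← Complex.mul_conj, Complex.star_def]
  ring

theorem rankOne_add_le (u v : Fin n → ℂ) :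
    MatLE (rankOne (u + v)) ((2 : ℝ) • rankOne u + (2 : ℝ) • rankOne v) := by
  have : (2 : ℝ) • rankOne u + (2 : ℝ) • rankOne v - rankOne (u + v) = rankOne (u - v) := by
    ext i j
    simp only [rankOne, vecMulVec_apply, Pi.star_apply, Matrix.smul_apply, Complex.real_smul,
      Matrix.sub_apply, Matrix.add_apply, Pi.add_apply, Pi.sub_apply, star_add, star_sub]
    push_cast; ring
  rw [MatLE, this]; exact rankOne_posSemidef _

theorem sum_rankOne_single : ∑ i : Fin n, rankOne (Pi.single i (1 : ℂ)) = 1 := by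
  ext a b
  simp only [Matrix.sum_apply, rankOne, vecMulVec_apply, Pi.star_apply, Pi.single_apply,
    Matrix.one_apply]
  by_cases h : a = b
  · subst h; simp
  · simp [h]

/-- Turns a lower bound on `R` into a bound for its contribution to the time derivative of
`log|ξ|²`, by Cauchy-Schwarz on the dual vector. -/
theorem neg_dotProduct_div_le {R W : Matrix (Fin n) (Fin n) ℂ} {C : ℝ} (hG : G.PosDef)
    (hW : W.PosSemidef) (hC : 0 ≤ C) (hR : MatLE (-R) (C • W)) (hξ : ξ ≠ 0) :
    -(star (G⁻¹ *ᵥ ξ) ⬝ᵥ (R *ᵥ (G⁻¹ *ᵥ ξ))).re / formNormSq G ξ ≤ C * (G⁻¹ * W).trace.re := by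
  have hu := formNormSq_pos hG hξ
  have h1 := dotProduct_le_mul_trace hG.inv (posSemidef_real_smul hW hC) ξ
  have h2 := hR.dotProduct_mulVec_nonneg (G⁻¹ *ᵥ ξ)
  have h3 := (Complex.le_def.1 h2).1
  rw [sub_neg_eq_add, Matrix.add_mulVec, dotProduct_add, Complex.add_re, Complex.zero_re] at h3
  rw [trace_mul_real_smul] at h1
  have h4 : (star ξ ⬝ᵥ (G⁻¹ *ᵥ ξ)).re = formNormSq G ξ := rfl
  rw [h4] at h1
  rw [div_le_iff₀ hu]
  nlinarith

/-- Projecting onto `ξ` decreases the distance to `ξ`. -/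
theorem formNormSq_sub_div_le (hG : G.PosDef) (hξ : ξ ≠ 0) :
    formNormSq G τ - (star (G⁻¹ *ᵥ ξ) ⬝ᵥ (rankOne τ *ᵥ (G⁻¹ *ᵥ ξ))).re / formNormSq G ξ ≤
      formNormSq G (τ - ξ) := by
  have hu := formNormSq_pos hG hξ
  set P := G⁻¹ with hP
  have hPH : Pᴴ = P := hG.inv.isHermitian
  set c : ℂ := star τ ⬝ᵥ (P *ᵥ ξ) with hc
  have hc' : star ξ ⬝ᵥ (P *ᵥ τ) = starRingEnd ℂ c := by
    have : star c = star (P *ᵥ ξ) ⬝ᵥ τ := by rw [hc, star_dotProduct, star_star]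
    rw [starRingEnd_apply, this, star_mulVec, hPH, ← dotProduct_mulVec]
  have h1 : star (P *ᵥ ξ) ⬝ᵥ (rankOne τ *ᵥ (P *ᵥ ξ)) = (Complex.normSq c : ℂ) := by
    rw [rankOne, vecMulVec_mulVec, dotProduct_smul, ← hc]
    have : star (P *ᵥ ξ) ⬝ᵥ τ = star c := by rw [hc, star_dotProduct]
    rw [this, ← Complex.mul_conj]
    simp [mul_comm]
  have h2 : formNormSq G (τ - ξ) = formNormSq G τ - 2 * c.re + formNormSq G ξ := by
    simp only [formNormSq, ← hP]
    rw [Matrix.mulVec_sub, star_sub, sub_dotProduct, dotProduct_sub, dotProduct_sub, hc', ← hc]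
    simp only [Complex.sub_re, Complex.conj_re]; ring
  -- After multiplication by `|ξ|²` the claim is `(Re c - |ξ|²)² + (Im c)² ≥ 0`.
  rw [h1, h2, Complex.ofReal_re, sub_le_iff_le_add, ← sub_le_iff_le_add', le_div_iff₀ hu,
    Complex.normSq_apply]
  nlinarith [sq_nonneg (c.re - formNormSq G ξ), sq_nonneg c.im]

end RankOne

/-! ### Local test forms with weights. -/

variable {n : ℕ} {X : Type*} [TopologicalSpace X] [ChartedSpace (Cn n) X]

/-- The form `(1-γ)(θ + √-1∂∂̄ log (ε² + σ)) + η`. -/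
def twistForm (σ : X → ℝ) (θ η : Coeff n X) (γ ε : ℝ) : Coeff n X :=
  fun c z => (1 - γ) • (θ c z + ddbar (fun x => Real.log (ε ^ 2 + σ x)) c z) + η c z

variable (n X) in
/-- A local holomorphic `(1,0)`-form over a coordinate ball, and a family of weights for its squared
norm. -/
structure LocalTest where
  chart : OpenPartialHomeomorph X (Cn n)
  domain : Set (Cn n)
  center : Cn n
  radius : ℝ
  covector : Cn n → Fin n → ℂ
  weight : ℝ → Cn n → ℝ

namespace LocalTest

/-- The function `|w - center|² / radius²`. -/
def cutoff (T : LocalTest n X) (w : Cn n) : ℝ := ‖w - T.center‖ ^ 2 / T.radius ^ 2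

/-- The weighted squared norm of the covector. -/
def value (T : LocalTest n X) (ε : ℝ) (G : Matrix (Fin n) (Fin n) ℂ) (w : Cn n) : ℝ :=
  Real.exp (T.weight ε w) * formNormSq G (T.covector w)

/-- Estimates, uniform in `ε`, for the weighted squared norm of the covector. -/
structure IsAdmissible (T : LocalTest n X) (ω₀ : Coeff n X) (σ : X → ℝ) (θ η : Coeff n X)
    (γ C : ℝ) : Prop where
  mem_atlas : T.chart ∈ atlas (Cn n) X
  isOpen : IsOpen T.domain
  domain_subset : T.domain ⊆ T.chart.target
  radius_pos : 0 < T.radius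
  subset_domain : Metric.closedBall T.center T.radius ⊆ T.domain
  smooth : ∀ i, ContDiffOn ℝ ∞ (fun w => T.covector w i) T.domain
  holo : ∀ w ∈ T.domain, ∀ i j, dzbar j (fun v => T.covector v i) w = 0
  ne_zero : ∀ w ∈ T.domain, T.covector w ≠ 0
  smooth_weight : ∀ ε ∈ Set.Ioo (0 : ℝ) 1, ContDiffOn ℝ ∞ (T.weight ε) T.domain
  -- No test exceeds the trace of the model by more than the factor `C`. Together with the lower
  -- bound in `HasTests` this makes tests comparable at a common point.
  upper : ∀ ε ∈ Set.Ioo (0 : ℝ) 1, ∀ w ∈ Metric.closedBall T.center T.radius,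
    MatLE (Real.exp (T.weight ε w) • rankOne (T.covector w))
      (C • modelForm ω₀ σ θ γ ε T.chart w)
  -- The left side bounds `(∂_t - Δ)(ψ + log|ξ|²)` along the flow after the Bochner inequality has
  -- removed the Ricci terms. The metric `G` is arbitrary here: no bound on the solution is used.
  evolution : ∀ ε ∈ Set.Ioo (0 : ℝ) 1, ∀ w ∈ Metric.closedBall T.center T.radius,
    ∀ G : Matrix (Fin n) (Fin n) ℂ, G.PosDef →
      -(star (G⁻¹ *ᵥ T.covector w) ⬝ᵥ (twistForm σ θ η γ ε T.chart w *ᵥ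
        (G⁻¹ *ᵥ T.covector w))).re / formNormSq G (T.covector w) -
          (G⁻¹ * complexHessian (T.weight ε) w).trace.re ≤ C * (G⁻¹ * ω₀ T.chart w).trace.re
  cutoff_le : ∀ w ∈ Metric.closedBall T.center T.radius,
    MatLE (complexHessian T.cutoff w) (C • ω₀ T.chart w)

variable {T : LocalTest n X} {ω₀ : Coeff n X} {σ : X → ℝ} {θ η : Coeff n X} {γ C C' : ℝ}

theorem contDiff_cutoff (T : LocalTest n X) : ContDiff ℝ ∞ T.cutoff :=
  ((contDiff_norm_sq ℂ).comp (contDiff_id.sub contDiff_const)).div_const _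

theorem IsAdmissible.mono (h : T.IsAdmissible ω₀ σ θ η γ C) (hd : IsDivisorNorm σ θ)
    (hpos : IsPositive ω₀) (hC : C ≤ C') : T.IsAdmissible ω₀ σ θ η γ C' :=
  have hω : ∀ w ∈ Metric.closedBall T.center T.radius, (ω₀ T.chart w).PosDef := fun w hw =>
    hpos _ h.mem_atlas w (h.domain_subset (h.subset_domain hw))
  { h with
    upper := fun ε hε w hw => (h.upper ε hε w hw).trans (MatLE.smul_le
      (hd.modelForm_posDef hpos hε.1 _ h.mem_atlas w
        (h.domain_subset (h.subset_domain hw))).posSemidef hC)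
    evolution := fun ε hε w hw G hG => (h.evolution ε hε w hw G hG).trans
      (mul_le_mul_of_nonneg_right hC
        (trace_mul_re_nonneg hG.inv.posSemidef (hω w hw).posSemidef))
    cutoff_le := fun w hw => (h.cutoff_le w hw).trans (MatLE.smul_le (hω w hw).posSemidef hC) }

end LocalTest

/-- Finitely many local tests which control the trace over a subset of `X`. -/
def HasTests (ω₀ : Coeff n X) (σ : X → ℝ) (θ η : Coeff n X) (γ : ℝ) (s : Set X) : Prop :=
  ∃ 𝒯 : Set (LocalTest n X), 𝒯.Finite ∧ ∃ C : ℝ, 0 < C ∧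
    (∀ T ∈ 𝒯, T.IsAdmissible ω₀ σ θ η γ C) ∧
    ∀ x ∈ s, ∀ ε ∈ Set.Ioo (0 : ℝ) 1, ∀ G : Coeff n X, IsPositive G → ∃ T ∈ 𝒯,
      x ∈ T.chart.source ∧ T.chart x ∈ Metric.ball T.center (T.radius / 2) ∧
      ((G T.chart (T.chart x))⁻¹ * modelForm ω₀ σ θ γ ε T.chart (T.chart x)).trace.re ≤
        C * T.value ε (G T.chart (T.chart x)) (T.chart x)

/-! ### Admissibility of the coordinate differentials and of the differential of the defining
function. -/

section Existence

variable {ω₀ : Coeff n X} {σ : X → ℝ} {θ η : Coeff n X} {γ : ℝ}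

/-- The curvature combines with that of the logarithm into a bounded multiple of `θ`. Whatever is
unbounded as `ε → 0` is a nonnegative multiple of the divisor form. -/
theorem IsDivisorNorm.twistForm_eq (h : IsDivisorNorm σ θ) {c : OpenPartialHomeomorph X (Cn n)}
    (hc : c ∈ atlas (Cn n) X) {z : Cn n} (hz : z ∈ c.target) {ε : ℝ} (hε : 0 < ε) :
    twistForm σ θ η γ ε c z = ((1 - γ) * (ε ^ 2 / (ε ^ 2 + σ (c.symm z)))) • θ c z + η c z +
      ((1 - γ) * (ε ^ 2 / (ε ^ 2 + σ (c.symm z)) ^ 2)) • divisorForm σ θ c z := by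
  have h0 : 0 < ε ^ 2 + σ (c.symm z) := by have := h.nonneg (c.symm z); positivity
  have e : ε ^ 2 / (ε ^ 2 + σ (c.symm z)) = 1 - σ (c.symm z) / (ε ^ 2 + σ (c.symm z)) := by
    field_simp; ring
  rw [twistForm, h.ddbar_log_eq hc hz hε, e]
  module

/-- Constants which bound the given forms on `X`. -/
structure IsBound (ω₀ : Coeff n X) (σ : X → ℝ) (θ η : Coeff n X) (B : ℝ) : Prop where
  pos : 0 < B
  norm_le : ∀ x, σ x ≤ B
  curv_le : ∀ c ∈ atlas (Cn n) X, ∀ z ∈ c.target, MatLE (θ c z) (B • ω₀ c z)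
  neg_curv_le : ∀ c ∈ atlas (Cn n) X, ∀ z ∈ c.target, MatLE (-θ c z) (B • ω₀ c z)
  neg_form_le : ∀ c ∈ atlas (Cn n) X, ∀ z ∈ c.target, MatLE (-η c z) (B • ω₀ c z)

theorem IsDivisorNorm.exists_isBound [CompactSpace X] (h : IsDivisorNorm σ θ) (hη : IsForm η)
    (h₀ : IsForm ω₀) (hpos : IsPositive ω₀) : ∃ B, IsBound ω₀ σ θ η B := by
  obtain ⟨B₁, -, h1⟩ := h.exists_norm_le
  obtain ⟨B₂, h2p, h2⟩ := h.isForm.exists_domination h₀ hpos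
  obtain ⟨B₃, -, h3⟩ := h.isForm.neg.exists_domination h₀ hpos
  obtain ⟨B₄, -, h4⟩ := hη.neg.exists_domination h₀ hpos
  have e1 : B₁ ≤ max (max B₁ B₂) (max B₃ B₄) := le_max_of_le_left (le_max_left _ _)
  have e2 : B₂ ≤ max (max B₁ B₂) (max B₃ B₄) := le_max_of_le_left (le_max_right _ _)
  have e3 : B₃ ≤ max (max B₁ B₂) (max B₃ B₄) := le_max_of_le_right (le_max_left _ _)
  have e4 : B₄ ≤ max (max B₁ B₂) (max B₃ B₄) := le_max_of_le_right (le_max_right _ _)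
  exact ⟨_, h2p.trans_le e2, fun x => (h1 x).trans e1, h2 _ e2, h3 _ e3, h4 _ e4⟩

theorem abs_one_sub_mul_le {t : ℝ} (hγ : γ ∈ Set.Ioo (0 : ℝ) 1) (h0 : 0 ≤ t) (h1 : t ≤ 1) :
    |(1 - γ) * t| ≤ 1 := by
  rw [abs_of_nonneg (mul_nonneg (by linarith [hγ.2]) h0)]
  nlinarith [hγ.1, hγ.2]

/-- The lower bound for the smooth part of the twisting form. -/
theorem IsBound.neg_twist_le {B : ℝ} (hB : IsBound ω₀ σ θ η B) (hpos : IsPositive ω₀)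
    {c : OpenPartialHomeomorph X (Cn n)}
    (hc : c ∈ atlas (Cn n) X) {z : Cn n} (hz : z ∈ c.target) {t : ℝ} (ht : |t| ≤ 1) :
    MatLE (-(t • θ c z + η c z)) ((2 * B) • ω₀ c z) := by
  have hω := posSemidef_real_smul (hpos c hc z hz).posSemidef hB.pos.le
  have h1 := MatLE.smul_of_abs_le hω (hB.neg_curv_le c hc z hz)
    (by rw [neg_neg]; exact hB.curv_le c hc z hz) ht
  have h2 := h1.add (hB.neg_form_le c hc z hz)
  convert h2 using 1 <;> module

variable {c : OpenPartialHomeomorph X (Cn n)} {U : Set (Cn n)} {z₀ : Cn n} {r : ℝ}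

/-- The test given by a coordinate differential. -/
def constTest (c : OpenPartialHomeomorph X (Cn n)) (U : Set (Cn n)) (z₀ : Cn n) (r : ℝ)
    (i : Fin n) : LocalTest n X := ⟨c, U, z₀, r, fun _ => Pi.single i 1, fun _ _ => 0⟩

/-- The test given by the differential of the defining function. -/
def diffTest (σ : X → ℝ) (γ : ℝ) (c : OpenPartialHomeomorph X (Cn n)) (U : Set (Cn n)) (z₀ : Cn n)
    (r : ℝ) (S : Cn n → ℂ) : LocalTest n X :=
  ⟨c, U, z₀, r, holDiff S, fun ε w => (γ - 1) * Real.log (ε ^ 2 + σ (c.symm w))⟩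

theorem exists_cutoff_le (h₀ : IsForm ω₀) (hpos : IsPositive ω₀) (hc : c ∈ atlas (Cn n) X)
    (hball : Metric.closedBall z₀ r ⊆ c.target) : ∃ C₀ : ℝ, 0 < C₀ ∧ ∀ C, C₀ ≤ C →
      ∀ w ∈ Metric.closedBall z₀ r,
        MatLE (complexHessian (fun w : Cn n => ‖w - z₀‖ ^ 2 / r ^ 2) w) (C • ω₀ c w) := by
  have hs : ContDiffOn ℝ ∞ (fun w : Cn n => ‖w - z₀‖ ^ 2 / r ^ 2) Set.univ :=
    (((contDiff_norm_sq ℂ).comp (contDiff_id.sub contDiff_const)).div_const _).contDiffOn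
  exact exists_domination (isCompact_closedBall z₀ r)
    (fun i j => (contDiffOn_complexHessian isOpen_univ hs i j).continuousOn.mono (Set.subset_univ _))
    (fun i j => ((h₀.smooth c hc i j).continuousOn).mono hball)
    (fun y _ => isHermitian_complexHessian isOpen_univ hs (Set.mem_univ y))
    (fun y hy => hpos c hc y (hball hy))

theorem exists_rankOne_le (h₀ : IsForm ω₀) (hpos : IsPositive ω₀) (hc : c ∈ atlas (Cn n) X)
    (hball : Metric.closedBall z₀ r ⊆ c.target) {v : Cn n → Fin n → ℂ}
    (hv : ∀ i, ContinuousOn (fun w => v w i) (Metric.closedBall z₀ r)) : ∃ C₀ : ℝ, 0 < C₀ ∧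
      ∀ C, C₀ ≤ C → ∀ w ∈ Metric.closedBall z₀ r, MatLE (rankOne (v w)) (C • ω₀ c w) :=
  exists_domination (isCompact_closedBall z₀ r)
    (fun i j => (hv i).mul (Complex.continuous_conj.comp_continuousOn (hv j)))
    (fun i j => ((h₀.smooth c hc i j).continuousOn).mono hball)
    (fun _ _ => (rankOne_posSemidef _).isHermitian) (fun y hy => hpos c hc y (hball hy))

theorem exists_le_one (h₀ : IsForm ω₀) (hc : c ∈ atlas (Cn n) X)
    (hball : Metric.closedBall z₀ r ⊆ c.target) : ∃ C₀ : ℝ, 0 < C₀ ∧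
      ∀ C, C₀ ≤ C → ∀ w ∈ Metric.closedBall z₀ r, MatLE (ω₀ c w) (C • 1) :=
  exists_domination (isCompact_closedBall z₀ r)
    (fun i j => ((h₀.smooth c hc i j).continuousOn).mono hball)
    (fun _ _ => continuousOn_const)
    (fun y hy => h₀.hermitian c hc y (hball hy)) (fun _ _ => PosDef.one)

/-- With weight zero only a lower bound for the twisting form is needed, and its unbounded part may
be dropped because it is semipositive. -/
theorem exists_isAdmissible_constTest (h : IsDivisorNorm σ θ) (h₀ : IsForm ω₀)
    (hpos : IsPositive ω₀) (hγ : γ ∈ Set.Ioo (0 : ℝ) 1) {B : ℝ} (hB : IsBound ω₀ σ θ η B)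
    (hc : c ∈ atlas (Cn n) X) (hU : IsOpen U) (hUc : U ⊆ c.target) (hr : 0 < r)
    (hball : Metric.closedBall z₀ r ⊆ U) (i : Fin n) :
    ∃ C, 0 < C ∧ (constTest c U z₀ r i).IsAdmissible ω₀ σ θ η γ C := by
  have hbc := hball.trans hUc
  obtain ⟨C₁, -, h1⟩ := exists_rankOne_le h₀ hpos hc hbc (v := fun _ => Pi.single i 1)
    (fun _ => continuousOn_const)
  obtain ⟨C₂, h2p, h2⟩ := exists_cutoff_le h₀ hpos hc hbc
  set C := max (max C₁ C₂) (2 * B) with hC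
  have e1 : C₁ ≤ C := le_max_of_le_left (le_max_left _ _)
  have e2 : C₂ ≤ C := le_max_of_le_left (le_max_right _ _)
  have e3 : 2 * B ≤ C := le_max_right _ _
  have hne : (Pi.single i 1 : Fin n → ℂ) ≠ 0 := fun h0 => by
    have := congrFun h0 i
    simp at this
  have hC0 : 0 < C := h2p.trans_le e2
  refine ⟨C, hC0, ?_⟩
  constructor
  case mem_atlas => exact hc
  case isOpen => exact hU
  case domain_subset => exact hUc
  case radius_pos => exact hr
  case subset_domain => exact hball
  case smooth => exact fun j => contDiffOn_const
  case holo => exact fun w _ a b => by simp [constTest, dzbar]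
  case ne_zero => exact fun w _ => hne
  case smooth_weight => exact fun ε _ => contDiffOn_const
  case upper =>
    intro ε hε w hw
    have hw' := hbc hw
    simp only [constTest, Real.exp_zero, one_smul]
    exact (h1 C e1 w hw).trans ((h.le_modelForm ω₀ hε.1 hc hw').smul hC0.le)
  case evolution =>
    intro ε hε w hw G hG
    have hw' := hbc hw
    have hω := (hpos c hc w hw').posSemidef
    have hσ := h.nonneg (c.symm w)
    have hε2 : 0 < ε ^ 2 := pow_pos hε.1 2
    have hR : MatLE (-twistForm σ θ η γ ε c w) ((2 * B) • ω₀ c w) := by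
      have h3 := hB.neg_twist_le hpos hc hw' (abs_one_sub_mul_le hγ
        (t := ε ^ 2 / (ε ^ 2 + σ (c.symm w))) (by positivity)
        (div_le_one_of_le₀ (by linarith) (by positivity)))
      refine MatLE.trans ?_ h3
      rw [h.twistForm_eq hc hw' hε.1, MatLE, neg_sub_neg, add_sub_cancel_left]
      exact posSemidef_real_smul (h.posSemidef_divisorForm hc hw')
        (mul_nonneg (by linarith [hγ.2]) (by positivity))
    have h4 := neg_dotProduct_div_le hG hω (by linarith [hB.pos]) hR hne
    have h5 : complexHessian ((constTest c U z₀ r i).weight ε) w = 0 := complexHessian_const 0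
    rw [h5, Matrix.mul_zero, trace_zero, Complex.zero_re, sub_zero]
    exact h4.trans (mul_le_mul_of_nonneg_right e3 (trace_mul_re_nonneg hG.inv.posSemidef hω))
  case cutoff_le => exact h2 C e2

theorem exp_weight {γ ε x : ℝ} (hε : 0 < ε) (hx : 0 ≤ x) :
    Real.exp ((γ - 1) * Real.log (ε ^ 2 + x)) = coneWeight γ ε x := by
  rw [coneWeight, Real.rpow_def_of_pos (by positivity), mul_comm]

/-- The product is at most `(ε²+x)^γ`. It controls the errors carrying a factor `|S|²` when `∇S` is
replaced by `∂S`. -/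
theorem coneWeight_mul_le {γ ε x B : ℝ} (hγ : 0 < γ) (hε : ε ∈ Set.Ioo (0 : ℝ) 1) (hx : 0 ≤ x)
    (hxB : x ≤ B) : coneWeight γ ε x * x ≤ (1 + B) ^ γ := by
  have h0 : 0 < ε ^ 2 + x := by have := pow_pos hε.1 2; positivity
  have h1 : coneWeight γ ε x * (ε ^ 2 + x) = (ε ^ 2 + x) ^ γ := by
    rw [coneWeight, ← Real.rpow_add_one h0.ne', sub_add_cancel]
  have h2 : (ε ^ 2 + x) ^ γ ≤ (1 + B) ^ γ :=
    Real.rpow_le_rpow h0.le (by nlinarith [hε.1, hε.2]) hγ.le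
  have h3 := coneWeight_pos (γ := γ) hε.1 hx
  nlinarith [mul_pos h3 (pow_pos hε.1 2)]

theorem IsLocalNorm.covDiff_eq {a : Cn n → ℝ} {S : Cn n → ℂ} (w : Cn n) :
    covDiff a S w = holDiff S w + S w • connForm a w := by
  ext i; simp [covDiff]

theorem complexHessian_diffTest_weight (h : IsDivisorNorm σ θ) (hc : c ∈ atlas (Cn n) X)
    {w : Cn n} (hw : w ∈ c.target) {ε : ℝ} (hε : 0 < ε) {S : Cn n → ℂ} :
    complexHessian ((diffTest σ γ c U z₀ r S).weight ε) w =
      (γ - 1) • ddbar (fun x => Real.log (ε ^ 2 + σ x)) c w :=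
  complexHessian_const_mul (u := fun w => Real.log (ε ^ 2 + σ (c.symm w))) c.open_target
    ((h.chartSmooth_log hε) c hc) (γ - 1) hw

-- The weight contributes the unbounded term `κ a |∇S|²_G` to `-Δψ`, with `κ = (1-γ) ε²/(ε²+σ)²`.
-- The twisting form contributes `-κ a |⟨∇S, ξ⟩|²/|ξ|²` for `ξ = ∂S`. Their sum is at most `κ a |∇S
-- - ∂S|² = κ a |S|² |∂log a|²` by projection onto `ξ`, and `κ a |S|² ≤ 1`.
set_option maxHeartbeats 1000000 in
theorem IsLocalNorm.exists_isAdmissible_diffTest {a : Cn n → ℝ} {S : Cn n → ℂ} {V : Set (Cn n)}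
    (hl : IsLocalNorm σ θ c V a S)
    (h : IsDivisorNorm σ θ) (h₀ : IsForm ω₀)
    (hpos : IsPositive ω₀) (hγ : γ ∈ Set.Ioo (0 : ℝ) 1) {B : ℝ} (hB : IsBound ω₀ σ θ η B)
    (hc : c ∈ atlas (Cn n) X) (hU : IsOpen U) (hUV : U ⊆ V) (hr : 0 < r)
    (hball : Metric.closedBall z₀ r ⊆ U) (hS : ∀ w ∈ U, holDiff S w ≠ 0) :
    ∃ C, 0 < C ∧ (diffTest σ γ c U z₀ r S).IsAdmissible ω₀ σ θ η γ C := by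
  have hUc := hUV.trans hl.subset
  have hbc := hball.trans hUc
  have hbV := hball.trans hUV
  have hls := hl.localSection
  obtain ⟨C₁, h1p, h1'⟩ := exists_rankOne_le h₀ hpos hc hbc (v := connForm a)
    (fun i => (hls.smooth_connForm i).continuousOn.mono hbV)
  have h1 := h1' C₁ le_rfl
  obtain ⟨C₂, h2p, h2⟩ := exists_cutoff_le h₀ hpos hc hbc
  obtain ⟨A, hA⟩ := ((isCompact_closedBall z₀ r).image_of_continuousOn
    ((hls.smooth.continuousOn.mono hbV).inv₀
      fun w hw => (hls.pos w (hbV hw)).ne')).bddAbove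
  have hA' : ∀ w ∈ Metric.closedBall z₀ r, (a w)⁻¹ ≤ A := fun w hw => hA ⟨w, hw, rfl⟩
  have hA0 : 0 < A := (inv_pos.2 (hls.pos z₀ (hbV (Metric.mem_closedBall_self hr.le)))).trans_le
    (hA' _ (Metric.mem_closedBall_self hr.le))
  set Q := (1 + B) ^ γ with hQ
  have hQ0 : 0 < Q := Real.rpow_pos_of_pos (by linarith [hB.pos]) _
  -- `C₃` serves the upper bound and `C₄` the evolution inequality. The three terms of `C₄` come
  -- from the bounded part of the twist, from the curvature in `Δψ`, and from the error `∇S - ∂S`.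
  set C₃ := 2 * A + 2 * (Q * A) * C₁ with hC₃
  set C₄ := 2 * B + B + C₁ with hC₄
  set C := max (max C₃ C₄) C₂ with hC
  have e2 : C₂ ≤ C := le_max_right _ _
  have e3 : C₃ ≤ C := le_max_of_le_left (le_max_left _ _)
  have e4 : C₄ ≤ C := le_max_of_le_left (le_max_right _ _)
  have hC0 : 0 < C := h2p.trans_le e2
  refine ⟨C, hC0, ?_⟩
  constructor
  case mem_atlas => exact hc
  case isOpen => exact hU
  case domain_subset => exact hUc
  case radius_pos => exact hr
  case subset_domain => exact hball
  case smooth => exact fun j => (hls.smooth_holDiff j).mono hUV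
  case holo => exact fun w hw a b => hls.dzbar_holDiff (hUV hw) a b
  case ne_zero => exact hS
  case smooth_weight =>
    exact fun ε hε => (((h.chartSmooth_log hε.1) c hc).mono hUc).const_smul (γ - 1)
  case upper =>
    intro ε hε w hw
    have hw' := hbc hw
    have hσ := h.nonneg (c.symm w)
    have ha := hls.pos w (hbV hw)
    have hW := coneWeight_pos (γ := γ) hε.1 hσ
    have hω := (hpos c hc w hw').posSemidef
    have hτ := hl.divisorForm_eq (hbV hw)
    have hs : Complex.normSq (S w) = (a w)⁻¹ * σ (c.symm w) := by
      rw [hl.norm_eq w (hbV hw), sectionNormSq, inv_mul_cancel_left₀ ha.ne']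
    have e : holDiff S w = covDiff a S w + (-S w) • connForm a w := by
      rw [IsLocalNorm.covDiff_eq]; module
    simp only [diffTest]
    rw [exp_weight hε.1 hσ, e, modelForm]
    set W := coneWeight γ ε (σ (c.symm w))
    have s1 : MatLE (W • rankOne (covDiff a S w + (-S w) • connForm a w))
        (W • ((2 : ℝ) • rankOne (covDiff a S w) + (2 : ℝ) • rankOne ((-S w) • connForm a w))) :=
      (rankOne_add_le _ _).smul hW.le
    have s2 : rankOne (covDiff a S w) = (a w)⁻¹ • divisorForm σ θ c w := by
      rw [hτ, smul_smul, inv_mul_cancel₀ ha.ne', one_smul]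
    rw [rankOne_smul, Complex.normSq_neg, hs, s2] at s1
    have s3 : MatLE ((2 * (W * (a w)⁻¹)) • divisorForm σ θ c w)
        ((2 * (W * A)) • divisorForm σ θ c w) :=
      MatLE.smul_le (h.posSemidef_divisorForm hc hw') (by gcongr; exact hA' w hw)
    have hq : W * ((a w)⁻¹ * σ (c.symm w)) ≤ Q * A := by
      calc W * ((a w)⁻¹ * σ (c.symm w)) = (W * σ (c.symm w)) * (a w)⁻¹ := by ring
        _ ≤ Q * A := by
          gcongr
          · exact coneWeight_mul_le hγ.1 hε hσ (hB.norm_le _)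
          · exact hA' w hw
    have s4 : MatLE ((2 * (W * ((a w)⁻¹ * σ (c.symm w)))) • rankOne (connForm a w))
        ((2 * (Q * A) * C₁) • ω₀ c w) := by
      have t1 := MatLE.smul_le (rankOne_posSemidef (connForm a w))
        (c := 2 * (W * ((a w)⁻¹ * σ (c.symm w)))) (d := 2 * (Q * A)) (by linarith)
      have t2 := (h1 w hw).smul (c := 2 * (Q * A)) (by positivity)
      rw [smul_smul] at t2
      exact t1.trans t2
    have hA3 : 2 * A ≤ C := by
      have : 0 ≤ 2 * (Q * A) * C₁ := by positivity
      linarith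
    have hC3' : 2 * (Q * A) * C₁ ≤ C := by linarith
    have s5 := (MatLE.smul_le hω hC3').add
      (MatLE.smul_le (posSemidef_real_smul (h.posSemidef_divisorForm hc hw') hW.le) hA3)
    rw [smul_add]
    refine s1.trans (MatLE.trans ?_ s5)
    have s6 := s4.add s3
    convert s6 using 1 <;> module
  case evolution =>
    intro ε hε w hw G hG
    have hw' := hbc hw
    have hω := (hpos c hc w hw').posSemidef
    have hσ := h.nonneg (c.symm w)
    have ha := hls.pos w (hbV hw)
    have hε2 : 0 < ε ^ 2 := pow_pos hε.1 2
    have hτ := hl.divisorForm_eq (hbV hw)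
    have hξ := hS w (hball hw)
    set t := σ (c.symm w) with ht
    have hns : a w * Complex.normSq (S w) = t := (hl.norm_eq w (hbV hw)).symm
    have hP := hG.inv.posSemidef
    have htr0 := trace_mul_re_nonneg hP hω
    have hHess : complexHessian ((diffTest σ γ c U z₀ r S).weight ε) w =
        (γ - 1) • ddbar (fun x => Real.log (ε ^ 2 + σ x)) c w :=
      complexHessian_diffTest_weight h hc hw' hε.1
    rw [hHess, h.ddbar_log_eq hc hw' hε.1]
    change -(star (G⁻¹ *ᵥ holDiff S w) ⬝ᵥ (twistForm σ θ η γ ε c w *ᵥ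
      (G⁻¹ *ᵥ holDiff S w))).re / formNormSq G (holDiff S w) - _ ≤ C * (G⁻¹ * ω₀ c w).trace.re
    rw [h.twistForm_eq hc hw' hε.1, ← ht, hτ]
    set κ := (1 - γ) * (ε ^ 2 / (ε ^ 2 + t) ^ 2) with hκ
    have hκ0 : 0 ≤ κ := mul_nonneg (by linarith [hγ.2]) (by positivity)
    set R' := ((1 - γ) * (ε ^ 2 / (ε ^ 2 + t))) • θ c w + η c w with hR'
    have hRle : MatLE (-R') ((2 * B) • ω₀ c w) :=
      hB.neg_twist_le hpos hc hw' (abs_one_sub_mul_le hγ (by positivity)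
        (div_le_one_of_le₀ (by linarith) (by positivity)))
    have k1 := neg_dotProduct_div_le hG hω (by linarith [hB.pos]) hRle hξ
    have k2 := formNormSq_sub_div_le (τ := covDiff a S w) hG hξ
    have k3 : formNormSq G (covDiff a S w - holDiff S w) ≤
        Complex.normSq (S w) * (C₁ * (G⁻¹ * ω₀ c w).trace.re) := by
      have e : covDiff a S w - holDiff S w = S w • connForm a w := by
        rw [IsLocalNorm.covDiff_eq]; module
      rw [e, formNormSq_eq_trace, rankOne_smul, trace_mul_real_smul]
      have := (h1 w hw).trace_le hP
      rw [trace_mul_real_smul] at this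
      exact mul_le_mul_of_nonneg_left this (Complex.normSq_nonneg _)
    -- Since `a|S|² = σ`, this follows from `ε² σ ≤ (ε² + σ)²`.
    have k4 : κ * a w * Complex.normSq (S w) ≤ 1 := by
      rw [mul_assoc, hns, hκ]
      have : ε ^ 2 / (ε ^ 2 + t) ^ 2 * t ≤ 1 := by
        rw [div_mul_eq_mul_div]
        exact div_le_one_of_le₀ (by nlinarith) (by positivity)
      have h0 : 0 ≤ ε ^ 2 / (ε ^ 2 + t) ^ 2 * t := by positivity
      rw [mul_assoc]
      exact (le_abs_self _).trans (abs_one_sub_mul_le hγ h0 this)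
    have k5 : ((1 - γ) * (t / (ε ^ 2 + t))) * -(G⁻¹ * θ c w).trace.re ≤
        B * (G⁻¹ * ω₀ c w).trace.re := by
      have hab := abs_one_sub_mul_le hγ (t := t / (ε ^ 2 + t)) (by positivity)
        (div_le_one_of_le₀ (by linarith) (by positivity))
      have := (MatLE.smul_of_abs_le (posSemidef_real_smul hω hB.pos.le)
        (hB.neg_curv_le c hc w hw') (by rw [neg_neg]; exact hB.curv_le c hc w hw') hab).trace_le hP
      rw [one_smul, trace_mul_real_smul, trace_mul_real_smul, Matrix.mul_neg, trace_neg,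
        Complex.neg_re] at this
      exact this
    have e1 : (star (G⁻¹ *ᵥ holDiff S w) ⬝ᵥ ((R' + κ • (a w • rankOne (covDiff a S w))) *ᵥ
        (G⁻¹ *ᵥ holDiff S w))).re = (star (G⁻¹ *ᵥ holDiff S w) ⬝ᵥ (R' *ᵥ
        (G⁻¹ *ᵥ holDiff S w))).re + κ * a w * (star (G⁻¹ *ᵥ holDiff S w) ⬝ᵥ
        (rankOne (covDiff a S w) *ᵥ (G⁻¹ *ᵥ holDiff S w))).re := by
      rw [Matrix.add_mulVec, dotProduct_add, Complex.add_re, smul_smul, Matrix.smul_mulVec,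
        dotProduct_smul, Complex.real_smul, Complex.re_ofReal_mul]
    have e2 : (G⁻¹ * ((γ - 1) • ((ε ^ 2 / (ε ^ 2 + t) ^ 2) • (a w • rankOne (covDiff a S w)) -
        (t / (ε ^ 2 + t)) • θ c w))).trace.re = -(κ * a w * formNormSq G (covDiff a S w)) +
        (1 - γ) * (t / (ε ^ 2 + t)) * (G⁻¹ * θ c w).trace.re := by
      rw [trace_mul_real_smul, trace_mul_sub_re, trace_mul_real_smul, trace_mul_real_smul,
        trace_mul_real_smul, ← formNormSq_eq_trace, hκ]
      ring
    rw [e1, e2]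
    set q := (star (G⁻¹ *ᵥ holDiff S w) ⬝ᵥ
        (rankOne (covDiff a S w) *ᵥ (G⁻¹ *ᵥ holDiff S w))).re
    set u := formNormSq G (holDiff S w)
    -- The difference of the two unbounded terms, controlled by the projection inequality `k2` and
    -- the size `k3` of the connection term.
    have k6 := mul_le_mul_of_nonneg_left (k2.trans k3) (mul_nonneg hκ0 ha.le)
    have k7 : κ * a w * (Complex.normSq (S w) * (C₁ * (G⁻¹ * ω₀ c w).trace.re)) ≤
        C₁ * (G⁻¹ * ω₀ c w).trace.re := by
      rw [← mul_assoc]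
      exact mul_le_of_le_one_left (by positivity) k4
    have k8 : C₄ * (G⁻¹ * ω₀ c w).trace.re ≤ C * (G⁻¹ * ω₀ c w).trace.re :=
      mul_le_mul_of_nonneg_right e4 htr0
    have e3 : κ * a w * (formNormSq G (covDiff a S w) - q / u) =
        κ * a w * formNormSq G (covDiff a S w) - κ * a w * q / u := by ring
    rw [neg_add, add_div, neg_div u (κ * a w * q)]
    rw [e3] at k6
    rw [hC₄] at k8
    linarith
  case cutoff_le => exact h2 C e2

end Existence

end ConicalKRF

namespace ConicalKRF

open Matrix

/-! ### Finite families of tests which control the trace of the model metric. -/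

section TestFamily

variable {n : ℕ} {X : Type*} [TopologicalSpace X] [ChartedSpace (Cn n) X]
  {ω₀ : Coeff n X} {σ : X → ℝ} {θ η : Coeff n X} {γ : ℝ}
  {c : OpenPartialHomeomorph X (Cn n)} {U V : Set (Cn n)} {z₀ : Cn n} {r : ℝ}

theorem exists_le_formNormSq_single (hn : 0 < n) {G : Matrix (Fin n) (Fin n) ℂ} {y K : ℝ}
    (hK : 0 ≤ K) (h : y ≤ K * (G⁻¹ * 1).trace.re) :
    ∃ i : Fin n, y ≤ K * n * formNormSq G (Pi.single i 1) := by
  have : Nonempty (Fin n) := ⟨⟨0, hn⟩⟩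
  obtain ⟨i, hi⟩ := Finite.exists_max fun i : Fin n => formNormSq G (Pi.single i 1)
  refine ⟨i, h.trans ?_⟩
  rw [mul_assoc]
  refine mul_le_mul_of_nonneg_left ?_ hK
  rw [← sum_rankOne_single, Matrix.mul_sum, trace_sum, Complex.re_sum]
  simp only [← formNormSq_eq_trace]
  calc _ ≤ ∑ _j : Fin n, formNormSq G (Pi.single i 1) := Finset.sum_le_sum fun j _ => hi j
    _ = _ := by simp

theorem exists_isAdmissible_constTests (h : IsDivisorNorm σ θ) (h₀ : IsForm ω₀)
    (hpos : IsPositive ω₀) (hγ : γ ∈ Set.Ioo (0 : ℝ) 1) {B : ℝ} (hB : IsBound ω₀ σ θ η B)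
    (hc : c ∈ atlas (Cn n) X) (hU : IsOpen U) (hUc : U ⊆ c.target) (hr : 0 < r)
    (hball : Metric.closedBall z₀ r ⊆ U) :
    ∃ C, 0 < C ∧ ∀ C', C ≤ C' → ∀ i, (constTest c U z₀ r i).IsAdmissible ω₀ σ θ η γ C' := by
  choose C hC0 hC using exists_isAdmissible_constTest h h₀ hpos hγ hB hc hU hUc hr hball
  refine ⟨1 + ∑ i, C i, add_pos_of_pos_of_nonneg one_pos (Finset.sum_nonneg fun i _ => (hC0 i).le),
    fun C' hC' i => (hC i).mono h hpos ?_⟩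
  have := Finset.single_le_sum (fun j _ => (hC0 j).le) (Finset.mem_univ i)
  linarith

theorem test_nhds (hr : 0 < r) {x₀ : X} (hx : x₀ ∈ c.source) :
    c.source ∩ c ⁻¹' Metric.ball (c x₀) (r / 2) ∈ 𝓝 x₀ :=
  Filter.inter_mem (c.open_source.mem_nhds hx)
    ((c.continuousAt hx).preimage_mem_nhds (Metric.ball_mem_nhds _ (half_pos hr)))

/-- Away from the divisor the weight is bounded, so the model is at most a multiple of the Euclidean
form and the coordinate differentials suffice. -/
theorem hasTests_of_ne_zero (hn : 0 < n) (h : IsDivisorNorm σ θ) (h₀ : IsForm ω₀)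
    (hpos : IsPositive ω₀) (hγ : γ ∈ Set.Ioo (0 : ℝ) 1) {B : ℝ} (hB : IsBound ω₀ σ θ η B)
    (hβ : IsForm (divisorForm σ θ)) {x₀ : X} (hx : σ x₀ ≠ 0) :
    ∃ s ∈ 𝓝 x₀, HasTests ω₀ σ θ η γ s := by
  set c := chartAt (Cn n) x₀
  have hc : c ∈ atlas (Cn n) X := chart_mem_atlas _ x₀
  have hx₀ : c x₀ ∈ c.target := mem_chart_target _ x₀
  set δ := σ x₀ / 2 with hδ
  have hδ0 : 0 < δ := half_pos ((h.nonneg x₀).lt_of_ne' hx)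
  set U := c.target ∩ (fun w => σ (c.symm w)) ⁻¹' Set.Ioi δ with hUdef
  have hU : IsOpen U := (h.smooth c hc).continuousOn.isOpen_inter_preimage c.open_target isOpen_Ioi
  have hxU : c x₀ ∈ U := by
    refine ⟨hx₀, ?_⟩
    simp only [Set.mem_preimage, Set.mem_Ioi]
    rw [c.left_inv (mem_chart_source _ x₀), hδ]
    linarith
  obtain ⟨r, hr, hball⟩ := Metric.nhds_basis_closedBall.mem_iff.1 (hU.mem_nhds hxU)
  have hbc : Metric.closedBall (c x₀) r ⊆ c.target := hball.trans Set.inter_subset_left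
  obtain ⟨C₁, h1p, h1⟩ := exists_isAdmissible_constTests h h₀ hpos hγ hB hc hU
    Set.inter_subset_left hr hball
  obtain ⟨C₂, h2p, h2⟩ := exists_le_one h₀ hc hbc
  obtain ⟨C₃, h3p, h3⟩ : ∃ C₀ : ℝ, 0 < C₀ ∧ ∀ C, C₀ ≤ C → ∀ w ∈ Metric.closedBall (c x₀) r,
      MatLE (divisorForm σ θ c w) (C • 1) :=
    exists_domination (isCompact_closedBall _ r)
      (fun i j => ((hβ.smooth c hc i j).continuousOn).mono hbc)
      (fun _ _ => continuousOn_const) (fun y hy => hβ.hermitian c hc y (hbc hy))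
      (fun _ _ => PosDef.one)
  set K := C₂ + δ ^ (γ - 1) * C₃ with hK
  have hK0 : 0 < K := by positivity
  refine ⟨_, test_nhds hr (mem_chart_source (Cn n) x₀), Set.range (constTest c U (c x₀) r),
    Set.finite_range _, max C₁ (K * n), lt_max_of_lt_left h1p, ?_, ?_⟩
  · rintro T ⟨i, rfl⟩
    exact h1 _ (le_max_left _ _) i
  · intro x hxs ε hε G hG
    have hw : c x ∈ Metric.closedBall (c x₀) r :=
      Metric.closedBall_subset_closedBall (half_le_self hr.le) (Metric.ball_subset_closedBall hxs.2)
    have hGp := hG c hc _ (hbc hw)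
    have hσ := h.nonneg (c.symm (c x))
    have hW : coneWeight γ ε (σ (c.symm (c x))) ≤ δ ^ (γ - 1) := by
      refine Real.rpow_le_rpow_of_nonpos hδ0 ?_ (by linarith [hγ.2])
      have : δ < σ (c.symm (c x)) := (hball hw).2
      nlinarith [sq_nonneg ε]
    have hle : MatLE (modelForm ω₀ σ θ γ ε c (c x)) (K • 1) := by
      rw [hK, add_smul, mul_smul]
      refine (h2 _ le_rfl _ hw).add ?_
      exact (MatLE.smul_le (h.posSemidef_divisorForm hc (hbc hw)) hW).trans
        ((h3 _ le_rfl _ hw).smul (by positivity))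
    have htr := hle.trace_le hGp.inv.posSemidef
    rw [trace_mul_real_smul] at htr
    obtain ⟨i, hi⟩ := exists_le_formNormSq_single hn hK0.le htr
    refine ⟨_, ⟨i, rfl⟩, hxs.1, hxs.2, hi.trans ?_⟩
    simp only [LocalTest.value, constTest, Real.exp_zero, one_mul]
    exact mul_le_mul_of_nonneg_right (le_max_right _ _)
      (hGp.inv.posSemidef.re_dotProduct_nonneg _)

/-- Up to a factor 2, `∇S ∇S^*` is bounded by `∂S ∂S^*` plus `|S|²` times the square of the
connection form. The weight times `a|S|²` is bounded, so the model is at most a multiple of the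
Euclidean form plus the weighted square of `∂S`. -/
theorem hasTests_of_holDiff_ne_zero (hn : 0 < n) (h : IsDivisorNorm σ θ) (h₀ : IsForm ω₀)
    (hpos : IsPositive ω₀) (hγ : γ ∈ Set.Ioo (0 : ℝ) 1) {B : ℝ} (hB : IsBound ω₀ σ θ η B)
    {x₀ : X} {a : Cn n → ℝ} {S : Cn n → ℂ} (hl : IsLocalNorm σ θ (chartAt (Cn n) x₀) V a S)
    (hxV : chartAt (Cn n) x₀ x₀ ∈ V) (hx : holDiff S (chartAt (Cn n) x₀ x₀) ≠ 0) :
    ∃ s ∈ 𝓝 x₀, HasTests ω₀ σ θ η γ s := by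
  set c := chartAt (Cn n) x₀
  have hc : c ∈ atlas (Cn n) X := chart_mem_atlas _ x₀
  have hls := hl.localSection
  set U := V ∩ (fun w => holDiff S w) ⁻¹' {0}ᶜ with hUdef
  have hU : IsOpen U := (continuousOn_pi.2 fun i => (hls.smooth_holDiff i).continuousOn
    ).isOpen_inter_preimage hls.isOpen isOpen_compl_singleton
  have hUV : U ⊆ V := Set.inter_subset_left
  obtain ⟨r, hr, hball⟩ := Metric.nhds_basis_closedBall.mem_iff.1 (hU.mem_nhds ⟨hxV, hx⟩)
  have hbV := hball.trans hUV
  have hbc : Metric.closedBall (c x₀) r ⊆ c.target := hbV.trans hl.subset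
  obtain ⟨C₁, h1p, h1⟩ := exists_isAdmissible_constTests h h₀ hpos hγ hB hc hU
    (hUV.trans hl.subset) hr hball
  obtain ⟨C₂, h2p, h2⟩ := hl.exists_isAdmissible_diffTest h h₀ hpos hγ hB hc hU hUV hr hball
    fun w hw => hw.2
  obtain ⟨C₃, h3p, h3⟩ := exists_le_one h₀ hc hbc
  obtain ⟨C₄, h4p, h4⟩ := exists_rankOne_le h₀ hpos hc hbc (v := connForm a)
    (fun i => (hls.smooth_connForm i).continuousOn.mono hbV)
  obtain ⟨A, hA⟩ := ((isCompact_closedBall (c x₀) r).image_of_continuousOn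
    (hls.smooth.continuousOn.mono hbV)).bddAbove
  have hA' : ∀ w ∈ Metric.closedBall (c x₀) r, a w ≤ A := fun w hw => hA ⟨w, hw, rfl⟩
  have hA0 : 0 < A := (hls.pos _ hxV).trans_le (hA' _ (Metric.mem_closedBall_self hr.le))
  set Q := (1 + B) ^ γ with hQ
  have hQ0 : 0 < Q := Real.rpow_pos_of_pos (by linarith [hB.pos]) _
  set K := (1 + 2 * Q * C₄) * C₃ with hK
  have hK0 : 0 < K := by positivity
  set C := max (max C₁ C₂) (max (2 * K * n) (4 * A)) with hC
  have e1 : C₁ ≤ C := le_max_of_le_left (le_max_left _ _)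
  have e2 : C₂ ≤ C := le_max_of_le_left (le_max_right _ _)
  have e3 : 2 * K * n ≤ C := le_max_of_le_right (le_max_left _ _)
  have e4 : 4 * A ≤ C := le_max_of_le_right (le_max_right _ _)
  refine ⟨_, test_nhds hr (mem_chart_source (Cn n) x₀),
    insert (diffTest σ γ c U (c x₀) r S) (Set.range (constTest c U (c x₀) r)),
    (Set.finite_range _).insert _, C, h1p.trans_le e1, ?_, ?_⟩
  · rintro T (rfl | ⟨i, rfl⟩)
    · exact h2.mono h hpos e2
    · exact h1 _ e1 i
  · intro x hxs ε hε G hG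
    have hw : c x ∈ Metric.closedBall (c x₀) r :=
      Metric.closedBall_subset_closedBall (half_le_self hr.le) (Metric.ball_subset_closedBall hxs.2)
    have hGp := hG c hc _ (hbc hw)
    set w := c x
    have hσ := h.nonneg (c.symm w)
    have hP := hGp.inv.posSemidef
    set W := coneWeight γ ε (σ (c.symm w)) with hW
    have hW0 : 0 < W := coneWeight_pos hε.1 hσ
    have hω := (hpos c hc w (hbc hw)).posSemidef
    have ha := hls.pos w (hbV hw)
    have hle : MatLE (modelForm ω₀ σ θ γ ε c w)
        (K • 1 + (2 * A) • (W • rankOne (holDiff S w))) := by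
      have s0 : MatLE (rankOne (covDiff a S w)) ((2 : ℝ) • rankOne (holDiff S w) +
          (2 * Complex.normSq (S w)) • rankOne (connForm a w)) := by
        have := rankOne_add_le (holDiff S w) (S w • connForm a w)
        rwa [← IsLocalNorm.covDiff_eq, rankOne_smul, smul_smul] at this
      have s1 := s0.smul (c := W * a w) (by positivity)
      have s2 : MatLE ((W * a w * 2) • rankOne (holDiff S w))
          ((2 * A * W) • rankOne (holDiff S w)) := by
        refine MatLE.smul_le (rankOne_posSemidef _) ?_
        nlinarith [hA' w hw]
      have hq : W * a w * (2 * Complex.normSq (S w)) ≤ 2 * Q := by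
        have h5 := coneWeight_mul_le hγ.1 hε hσ (hB.norm_le (c.symm w))
        have h6 : a w * Complex.normSq (S w) = σ (c.symm w) := (hl.norm_eq w (hbV hw)).symm
        calc W * a w * (2 * Complex.normSq (S w)) = 2 * (W * (a w * Complex.normSq (S w))) := by
              ring
          _ ≤ 2 * Q := by rw [h6]; linarith
      have s3 := (MatLE.smul_le (rankOne_posSemidef (connForm a w)) hq).trans
        ((h4 C₄ le_rfl w hw).smul (c := 2 * Q) (by positivity))
      have s4 := ((h3 C₃ le_rfl w hw).smul (c := 1 + 2 * Q * C₄) (by positivity))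
      have s5 : MatLE (W • divisorForm σ θ c w)
          ((2 * A * W) • rankOne (holDiff S w) + (2 * Q) • C₄ • ω₀ c w) := by
        rw [hl.divisorForm_eq (hbV hw), smul_smul]
        refine s1.trans ?_
        rw [smul_add, smul_smul, smul_smul]
        exact s2.add s3
      rw [modelForm]
      refine ((MatLE.refl (ω₀ c w)).add s5).trans ?_
      have s6 := s4.add (MatLE.refl ((2 * A * W) • rankOne (holDiff S w)))
      convert s6 using 1 <;> module
    have htr := hle.trace_le hP
    rw [trace_mul_add_re, trace_mul_real_smul, trace_mul_real_smul, trace_mul_real_smul,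
      ← formNormSq_eq_trace] at htr
    set y := ((G c w)⁻¹ * modelForm ω₀ σ θ γ ε c w).trace.re
    -- Either the Euclidean part accounts for at least half of `y`, and some coordinate differential
    -- works, or the weighted square of `∂S` accounts for at least half.
    by_cases hcase : y ≤ (2 * K) * ((G c w)⁻¹ * 1).trace.re
    · obtain ⟨i, hi⟩ := exists_le_formNormSq_single hn (by positivity) hcase
      refine ⟨_, Set.mem_insert_of_mem _ ⟨i, rfl⟩, hxs.1, hxs.2, hi.trans ?_⟩
      simp only [LocalTest.value, constTest, Real.exp_zero, one_mul]
      exact mul_le_mul_of_nonneg_right e3 (hP.re_dotProduct_nonneg _)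
    · refine ⟨_, Set.mem_insert _ _, hxs.1, hxs.2, ?_⟩
      have e : (diffTest σ γ c U (c x₀) r S).value ε (G c w) w =
          W * formNormSq (G c w) (holDiff S w) := by
        simp only [LocalTest.value, diffTest]; rw [exp_weight hε.1 hσ]
      change y ≤ C * (diffTest σ γ c U (c x₀) r S).value ε (G c w) w
      rw [e]
      have hu : 0 ≤ W * formNormSq (G c w) (holDiff S w) :=
        mul_nonneg hW0.le (hP.re_dotProduct_nonneg _)
      calc y ≤ 4 * A * (W * formNormSq (G c w) (holDiff S w)) := by push Not at hcase; linarith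
        _ ≤ _ := mul_le_mul_of_nonneg_right e4 hu

theorem hasTests_univ [CompactSpace X] [IsManifold 𝓘(ℂ, Cn n) ω X] (hn : 0 < n)
    (h : IsDivisorNorm σ θ) (h₀ : IsForm ω₀) (hpos : IsPositive ω₀) (hη : IsForm η)
    (hγ : γ ∈ Set.Ioo (0 : ℝ) 1) : HasTests ω₀ σ θ η γ Set.univ := by
  obtain ⟨B, hB⟩ := h.exists_isBound hη h₀ hpos
  refine isCompact_univ.induction_on (p := HasTests ω₀ σ θ η γ) ?_ ?_ ?_ ?_
  · exact ⟨∅, Set.finite_empty, 1, one_pos, fun T hT => hT.elim, fun x hx => hx.elim⟩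
  · rintro s t hst ⟨𝒯, hf, C, hC, h1, h2⟩
    exact ⟨𝒯, hf, C, hC, h1, fun x hx => h2 x (hst hx)⟩
  · rintro s t ⟨𝒯, hf, C, hC, h1, h2⟩ ⟨𝒯', hf', C', hC', h1', h2'⟩
    refine ⟨𝒯 ∪ 𝒯', hf.union hf', max C C', lt_max_of_lt_left hC, ?_, ?_⟩
    · rintro T (hT | hT)
      · exact (h1 T hT).mono h hpos (le_max_left _ _)
      · exact (h1' T hT).mono h hpos (le_max_right _ _)
    · have hval : ∀ (T : LocalTest n X) (x : X), T.chart ∈ atlas (Cn n) X → x ∈ T.chart.source →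
          ∀ ε, ∀ G : Coeff n X, IsPositive G → 0 ≤ T.value ε (G T.chart (T.chart x)) (T.chart x) :=
        fun T x hT hx ε G hG => mul_nonneg (Real.exp_pos _).le
          ((hG T.chart hT _ (T.chart.map_source hx)).inv.posSemidef.re_dotProduct_nonneg _)
      intro x hx ε hε G hG
      rcases hx with hx | hx
      · obtain ⟨T, hT, hs, hb, hle⟩ := h2 x hx ε hε G hG
        exact ⟨T, Or.inl hT, hs, hb, hle.trans (mul_le_mul_of_nonneg_right (le_max_left _ _)
          (hval T x (h1 T hT).mem_atlas hs ε G hG))⟩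
      · obtain ⟨T, hT, hs, hb, hle⟩ := h2' x hx ε hε G hG
        exact ⟨T, Or.inr hT, hs, hb, hle.trans (mul_le_mul_of_nonneg_right (le_max_right _ _)
          (hval T x (h1' T hT).mem_atlas hs ε G hG))⟩
  · intro x₀ _
    have key : ∃ s ∈ 𝓝 x₀, HasTests ω₀ σ θ η γ s := by
      -- On the divisor the coefficient `S` vanishes, and transversality gives `∂S ≠ 0` there;
      -- elsewhere `σ` is positive.
      by_cases hx : σ x₀ = 0
      · obtain ⟨V, a, S, hl, hxV, htr⟩ := h.transversal x₀
        refine hasTests_of_holDiff_ne_zero hn h h₀ hpos hγ hB hl hxV (htr ?_)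
        have h1 := hl.norm_eq _ hxV
        rw [(chartAt (Cn n) x₀).left_inv (mem_chart_source _ x₀), hx, sectionNormSq] at h1
        have h2 := (mul_eq_zero.1 h1.symm).resolve_left (hl.localSection.pos _ hxV).ne'
        exact Complex.normSq_eq_zero.1 h2
      · exact hasTests_of_ne_zero hn h h₀ hpos hγ hB h.isForm_divisorForm hx
    obtain ⟨s, hs, hT⟩ := key
    exact ⟨s, mem_nhdsWithin_of_mem_nhds hs, hT⟩

end TestFamily

/-! ### Norms of transversally vanishing sections as divisor norms. -/

section DefiningSection

open Bundle

variable {n : ℕ} {X : Type*} [TopologicalSpace X] [ChartedSpace (Cn n) X]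
  [IsManifold 𝓘(ℂ, Cn n) ω X]
  {L : X → Type*} [∀ x, AddCommGroup (L x)] [∀ x, Module ℂ (L x)] [∀ x, TopologicalSpace (L x)]
  [TopologicalSpace (Bundle.TotalSpace ℂ L)] [FiberBundle ℂ L] [VectorBundle ℂ ℂ L]
  [ContMDiffVectorBundle ω ℂ L 𝓘(ℂ, Cn n)]
  (h : HermitianMetric n L) (s : ContMDiffSection 𝓘(ℂ, Cn n) ℂ ω L) {D : Set X}

theorem isLocalNorm_frame {c : OpenPartialHomeomorph X (Cn n)} (hc : c ∈ atlas (Cn n) X)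
    (e : Trivialization ℂ (TotalSpace.proj : TotalSpace ℂ L → X)) [MemTrivializationAtlas e] :
    IsLocalNorm (fun x => h.normSq x (s x)) h.curvature c (chartDomain e c) (frameNormSq h e c)
      (sectionCoeff s e c) where
  localSection := localSection h s hc
  subset := Set.inter_subset_left
  norm_eq _ hw := normSq_section_eq h s hw
  curv_eq _ hw := curvature_eq h hc hw

theorem linear_eq_zero_of_stdVec {F : Cn n →L[ℂ] ℂ} (hF : ∀ i, F (stdVec i) = 0) : F = 0 := by
  ext v
  have hv : v = ∑ i, v i • (stdVec i : Cn n) := by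
    ext j
    simp [stdVec, Pi.single_apply]
  rw [hv, map_sum]
  simp [hF]

theorem holDiff_ne_zero (hs : IsDefiningSection n s D) {x : X} (hx : s x = 0) :
    holDiff (sectionCoeff s (trivializationAt ℂ L x) (chartAt (Cn n) x)) (chartAt (Cn n) x x) ≠ 0 := by
  intro h0
  have htr := hs.transversal x ((hs.zeroSet x).2 hx)
  set f : X → ℂ := fun y => (trivializationAt ℂ L x (TotalSpace.mk' ℂ y (s y))).2
  by_cases hf : MDifferentiableAt 𝓘(ℂ, Cn n) 𝓘(ℂ, ℂ) f x
  · apply htr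
    rw [hf.mfderiv]
    have hd : DifferentiableAt ℂ (sectionCoeff s (trivializationAt ℂ L x) (chartAt (Cn n) x))
        (chartAt (Cn n) x x) := by
      have := hf.differentiableWithinAt_writtenInExtChartAt
      simp only [writtenInExtChartAt, modelWithCornersSelf_coe, Set.range_id] at this
      exact differentiableWithinAt_univ.1 this
    have h1 : fderivWithin ℂ (writtenInExtChartAt 𝓘(ℂ, Cn n) 𝓘(ℂ, ℂ) x f)
        (Set.range 𝓘(ℂ, Cn n)) (extChartAt 𝓘(ℂ, Cn n) x x) =
        fderiv ℂ (sectionCoeff s (trivializationAt ℂ L x) (chartAt (Cn n) x))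
          (chartAt (Cn n) x x) := by
      simp [writtenInExtChartAt, Function.comp_def]
      rfl
    refine h1.trans (linear_eq_zero_of_stdVec fun i => ?_)
    rw [← dz_of_differentiableAt hd]
    exact congrFun h0 i
  -- Without differentiability the manifold derivative is `0` by convention, which contradicts
  -- transversality too.
  · exact htr (mfderiv_zero_of_not_mdifferentiableAt hf)

theorem IsDefiningSection.isDivisorNorm (hs : IsDefiningSection n s D) :
    IsDivisorNorm (fun x => h.normSq x (s x)) h.curvature where
  smooth := chartSmooth_normSq h s
  isForm := isForm_curvature h
  nonneg := normSq_section_nonneg h s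
  exists_local c hc z hz := ⟨_, _, _, isLocalNorm_frame h s hc (trivializationAt ℂ L (c.symm z)),
    mem_chartDomain_trivializationAt hz⟩
  transversal x := by
    have hx : (chartAt (Cn n) x).symm (chartAt (Cn n) x x) = x :=
      (chartAt (Cn n) x).left_inv (mem_chart_source _ x)
    have hm : chartAt (Cn n) x x ∈ chartDomain (trivializationAt ℂ L x) (chartAt (Cn n) x) := by
      refine ⟨mem_chart_target _ x, ?_⟩
      rw [Set.mem_preimage, hx]
      exact FiberBundle.mem_baseSet_trivializationAt' x
    refine ⟨_, _, _, isLocalNorm_frame h s (chart_mem_atlas _ x) (trivializationAt ℂ L x), hm,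
      fun hS => holDiff_ne_zero s hs ?_⟩
    have h1 := eq_smul_frame (e := trivializationAt ℂ L x) hm.2
      (s ((chartAt (Cn n) x).symm (chartAt (Cn n) x x)))
    rw [sectionCoeff] at hS
    rw [hS, zero_smul, hx] at h1
    exact h1

end DefiningSection

end ConicalKRF

namespace ConicalKRF

open Matrix

/-! ### Functions of space and time restricted to slices. -/

section Slice

variable {n : ℕ} {O : Set (ℝ × Cn n)} {t : ℝ} {z : Cn n}

theorem wd_slice {F : ℝ × Cn n → ℂ} (hF : DifferentiableAt ℝ F (t, z)) (p q : Cn n) :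
    wd p q (fun w => F (t, w)) z = wd ((0 : ℝ), p) ((0 : ℝ), q) F (t, z) := by
  have h1 : HasFDerivAt (fun w : Cn n => (t, w)) (ContinuousLinearMap.inr ℝ ℝ (Cn n)) z :=
    hasFDerivAt_prodMk_right t z
  have h2 : HasFDerivAt (fun w => F (t, w))
      ((fderiv ℝ F (t, z)).comp (ContinuousLinearMap.inr ℝ ℝ (Cn n))) z :=
    hF.hasFDerivAt.comp z h1
  simp only [wd, h2.fderiv, ContinuousLinearMap.comp_apply, ContinuousLinearMap.inr_apply]

theorem hasDerivAt_slice {F : ℝ × Cn n → ℂ} (hF : DifferentiableAt ℝ F (t, z)) :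
    HasDerivAt (fun τ => F (τ, z)) (wd ((1 : ℝ), (0 : Cn n)) 0 F (t, z)) t := by
  have h1 : HasDerivAt (fun τ : ℝ => (τ, z)) ((1 : ℝ), (0 : Cn n)) t :=
    (hasDerivAt_id t).prodMk (hasDerivAt_const t z)
  have h2 := hF.hasFDerivAt.comp_hasDerivAt t h1
  exact h2.congr_deriv (by simp [wd])

theorem isOpen_slice (hO : IsOpen O) (t : ℝ) : IsOpen {w | (t, w) ∈ O} :=
  hO.preimage (by fun_prop)

theorem contDiffOn_slice {E : Type*} [NormedAddCommGroup E] [NormedSpace ℝ E] {F : ℝ × Cn n → E}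
    (hF : ContDiffOn ℝ ∞ F O) (t : ℝ) : ContDiffOn ℝ ∞ (fun w => F (t, w)) {w | (t, w) ∈ O} :=
  hF.comp (contDiff_const.prodMk contDiff_id).contDiffOn fun _ hw => hw

/-- The iterated Wirtinger derivative in the space directions. -/
def spaceHessian (i j : Fin n) (F : ℝ × Cn n → ℂ) : ℝ × Cn n → ℂ :=
  wd ((0 : ℝ), (1 / 2 : ℝ) • stdVec i) ((0 : ℝ), -((1 / 2 : ℝ) • (Complex.I • stdVec i)))
    (wd ((0 : ℝ), (1 / 2 : ℝ) • stdVec j) ((0 : ℝ), (1 / 2 : ℝ) • (Complex.I • stdVec j)) F)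

variable {Φ V : ℝ × Cn n → ℝ}

theorem complexHessian_slice (hO : IsOpen O) (hΦ : ContDiffOn ℝ ∞ Φ O) (hz : (t, z) ∈ O)
    (i j : Fin n) : complexHessian (fun w => Φ (t, w)) z i j =
      spaceHessian i j (fun p => (Φ p : ℂ)) (t, z) := by
  have hc := contDiffOn_ofReal hΦ
  rw [complexHessian_apply, dz_congr_on (isOpen_slice hO t) (g := fun w =>
    wd ((0 : ℝ), (1 / 2 : ℝ) • stdVec j) ((0 : ℝ), (1 / 2 : ℝ) • (Complex.I • stdVec j))
      (fun p => (Φ p : ℂ)) (t, w)) _ hz]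
  · rw [dz_eq_wd, wd_slice ((ContDiffOn.wd hO hc).diffAt hO hz)]
    rfl
  · intro w hw
    rw [dzbar_eq_wd]
    exact wd_slice (hc.diffAt hO hw) _ _

theorem smoothMat_complexHessian_slice (hO : IsOpen O) (hΦ : ContDiffOn ℝ ∞ Φ O) :
    SmoothMat (fun p : ℝ × Cn n => complexHessian (fun w => Φ (p.1, w)) p.2) O := fun i j =>
  (ContDiffOn.wd hO (ContDiffOn.wd hO (contDiffOn_ofReal hΦ))).congr fun _ hp =>
    complexHessian_slice hO hΦ hp i j

theorem ofReal_eq_wd_of_hasDerivAt (hO : IsOpen O) (hΦ : ContDiffOn ℝ ∞ Φ O)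
    (hV : ∀ p ∈ O, HasDerivAt (fun τ => Φ (τ, p.2)) (V p) p.1) {p : ℝ × Cn n} (hp : p ∈ O) :
    (V p : ℂ) = wd ((1 : ℝ), (0 : Cn n)) 0 (fun p => (Φ p : ℂ)) p :=
  (hV p hp).ofReal_comp.unique (hasDerivAt_slice ((contDiffOn_ofReal hΦ).diffAt hO hp))

/-- The time derivative is a directional derivative of the jointly smooth `Φ`, hence jointly smooth
itself. -/
theorem contDiffOn_of_hasDerivAt (hO : IsOpen O) (hΦ : ContDiffOn ℝ ∞ Φ O)
    (hV : ∀ p ∈ O, HasDerivAt (fun τ => Φ (τ, p.2)) (V p) p.1) : ContDiffOn ℝ ∞ V O := by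
  have h1 : ContDiffOn ℝ ∞ (fun p => (V p : ℂ)) O :=
    (ContDiffOn.wd hO (contDiffOn_ofReal hΦ)).congr
      fun _ hp => ofReal_eq_wd_of_hasDerivAt hO hΦ hV hp
  simpa using contDiffOn_re h1

/-- The time derivative of the complex Hessian is the complex Hessian of the time derivative. -/
theorem hasDerivAt_complexHessian (hO : IsOpen O) (hΦ : ContDiffOn ℝ ∞ Φ O)
    (hV : ∀ p ∈ O, HasDerivAt (fun τ => Φ (τ, p.2)) (V p) p.1) (hz : (t, z) ∈ O) (i j : Fin n) :
    HasDerivAt (fun τ => complexHessian (fun w => Φ (τ, w)) z i j)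
      (complexHessian (fun w => V (t, w)) z i j) t := by
  have hc := contDiffOn_ofReal hΦ
  have h1 : ContDiffOn ℝ ∞ (spaceHessian i j fun p => (Φ p : ℂ)) O :=
    ContDiffOn.wd hO (ContDiffOn.wd hO hc)
  have h2 := hasDerivAt_slice (h1.diffAt hO hz)
  have h3 : complexHessian (fun w => V (t, w)) z i j =
      wd ((1 : ℝ), (0 : Cn n)) 0 (spaceHessian i j fun p => (Φ p : ℂ)) (t, z) := by
    rw [complexHessian_slice hO (contDiffOn_of_hasDerivAt hO hΦ hV) hz, spaceHessian, spaceHessian,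
      wd_comm hO (ContDiffOn.wd hO hc) hz]
    refine wd_congr_on hO (fun p hp => ?_) hz
    rw [wd_comm hO hc hp]
    exact wd_congr_on hO (fun p hp => ofReal_eq_wd_of_hasDerivAt hO hΦ hV hp) hp
  rw [h3]
  refine h2.congr_of_eventuallyEq ?_
  have : ∀ᶠ τ in 𝓝 t, (τ, z) ∈ O :=
    (show Continuous fun τ : ℝ => (τ, z) by fun_prop).continuousAt.eventually (hO.mem_nhds hz)
  filter_upwards [this] with τ hτ
  exact complexHessian_slice hO hΦ hτ i j

end Slice

/-! ### Time derivatives of determinants and of norms of covectors. -/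

section TimeDerivative

variable {n : ℕ} {G : ℝ → Matrix (Fin n) (Fin n) ℂ} {G' : Matrix (Fin n) (Fin n) ℂ} {t : ℝ}

theorem hasDerivAt_log_det (hG : ∀ i j, HasDerivAt (fun s => G s i j) (G' i j) t)
    (hpos : (G t).PosDef) :
    HasDerivAt (fun s => Real.log (G s).det.re) ((G t)⁻¹ * G').trace.re t := by
  have h1 := hasDerivAt_det hG (posDef_det_ne_zero hpos)
  have h2' := (Complex.reCLM.hasFDerivAt (x := (G t).det)).comp_hasDerivAt t h1
  have h2 : HasDerivAt (fun s => (G s).det.re) ((G t).det * ((G t)⁻¹ * G').trace).re t := h2'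
  have h3 := h2.log (det_re_pos hpos).ne'
  rw [← ofReal_det_re hpos.isHermitian, Complex.re_ofReal_mul, Complex.ofReal_re,
    mul_div_cancel_left₀ _ (det_re_pos hpos).ne'] at h3
  exact h3

theorem hasDerivAt_formNormSq {I : Set ℝ} (hI : IsOpen I) (ht : t ∈ I) (hGs : SmoothMat G I)
    (hG : ∀ i j, HasDerivAt (fun s => G s i j) (G' i j) t) (hpos : ∀ s ∈ I, (G s).PosDef)
    (ξ : Fin n → ℂ) : HasDerivAt (fun s => formNormSq (G s) ξ)
      (-(star ((G t)⁻¹ *ᵥ ξ) ⬝ᵥ (G' *ᵥ ((G t)⁻¹ *ᵥ ξ))).re) t := by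
  have h0 : ∀ s ∈ I, (G s).det ≠ 0 := fun s hs => posDef_det_ne_zero (hpos s hs)
  have hw : ∀ {f : ℝ → ℂ}, DifferentiableAt ℝ f t → wd (1 : ℝ) 0 f t = deriv f t := fun _ => by
    simp [wd]
  have h1 : wdM (1 : ℝ) 0 G t = G' := by
    ext i j
    rw [wdM_apply, hw (hG i j).differentiableAt]; exact (hG i j).deriv
  have h2 : ∀ i j, HasDerivAt (fun s => (G s)⁻¹ i j) ((-((G t)⁻¹ * G' * (G t)⁻¹)) i j) t := by
    intro i j
    have hd := (contDiffOn_matrix_inv hGs h0 i j).diffAt hI ht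
    rw [← h1, ← wdM_inv hI hGs h0 ht, wdM_apply, hw hd]
    exact hd.hasDerivAt
  have h3 : HasDerivAt (fun s => star ξ ⬝ᵥ ((G s)⁻¹ *ᵥ ξ))
      (star ξ ⬝ᵥ ((-((G t)⁻¹ * G' * (G t)⁻¹)) *ᵥ ξ)) t := by
    simp only [dotProduct, mulVec]
    exact HasDerivAt.fun_sum fun i _ => HasDerivAt.const_mul _
      (HasDerivAt.fun_sum fun j _ => (h2 i j).mul_const _)
  have h4 := (Complex.reCLM.hasFDerivAt (x := star ξ ⬝ᵥ ((G t)⁻¹ *ᵥ ξ))).comp_hasDerivAt t h3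
  refine h4.congr_deriv ?_
  have hPH : (G t)⁻¹ᴴ = (G t)⁻¹ := (hpos t ht).inv.isHermitian
  rw [star_mulVec, hPH, ← dotProduct_mulVec, Matrix.mulVec_mulVec, Matrix.mulVec_mulVec,
    Matrix.neg_mulVec, dotProduct_neg]
  simp

/-- At a maximum over the past the time derivative is nonnegative. -/
theorem nonneg_of_hasDerivAt_of_le {g : ℝ → ℝ} {g' a t : ℝ} (hat : a < t) (hg : HasDerivAt g g' t)
    (hmax : ∀ s ∈ Set.Icc a t, g s ≤ g t) : 0 ≤ g' := by
  have h1 : Filter.Tendsto (slope g t) (𝓝[<] t) (𝓝 g') :=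
    (hasDerivAt_iff_tendsto_slope.1 hg).mono_left
      (nhdsWithin_mono _ fun s hs => ne_of_lt hs)
  refine ge_of_tendsto h1 ?_
  filter_upwards [Ioo_mem_nhdsLT hat] with s hs
  rw [slope_def_field]
  exact div_nonneg_of_nonpos (by linarith [hmax s ⟨hs.1.le, hs.2.le⟩]) (by linarith [hs.2])

end TimeDerivative

/-! ### Closedness of the forms entering the flow. -/

section Closed

variable {n : ℕ} {X : Type*} [TopologicalSpace X] [ChartedSpace (Cn n) X] {α β : Coeff n X}

theorem dz_comm {U : Set (Cn n)} {z : Cn n} (hU : IsOpen U) {f : Cn n → ℂ}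
    (hf : ContDiffOn ℝ ∞ f U) (hz : z ∈ U) (i j : Fin n) :
    dz i (dz j f) z = dz j (dz i f) z := by
  simp only [dz_eq_wd]; exact wd_comm hU hf hz

theorem complexHessian_closed {U : Set (Cn n)} {z : Cn n} (hU : IsOpen U) {u : Cn n → ℝ}
    (hu : ContDiffOn ℝ ∞ u U) (hz : z ∈ U) (i j k : Fin n) :
    dz k (fun w => complexHessian u w i j) z = dz i (fun w => complexHessian u w k j) z := by
  simp only [complexHessian_apply]
  exact dz_comm hU (contDiffOn_dzbar hU (contDiffOn_ofReal hu) j) hz k i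

theorem IsClosedForm.add (hα : IsClosedForm α) (hβ : IsClosedForm β) (h1 : IsForm α)
    (h2 : IsForm β) : IsClosedForm (α + β) := by
  intro c hc z hz i j k
  have hd : ∀ {κ : Coeff n X}, IsForm κ → ∀ i j, DifferentiableAt ℝ (fun w => κ c w i j) z :=
    fun hκ i j => (hκ.smooth c hc i j).diffAt c.open_target hz
  simp only [Pi.add_apply, Matrix.add_apply]
  simp only [dz_eq_wd] at *
  rw [wd_add (hd h1 _ _) (hd h2 _ _), wd_add (hd h1 _ _) (hd h2 _ _)]
  have e1 := hα c hc z hz i j k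
  have e2 := hβ c hc z hz i j k
  simp only [dz_eq_wd] at e1 e2
  rw [e1, e2]

theorem IsClosedForm.smul (hα : IsClosedForm α) (h1 : IsForm α) (t : ℝ) :
    IsClosedForm (t • α) := by
  intro c hc z hz i j k
  have hd : ∀ i j, DifferentiableAt ℝ (fun w => α c w i j) z :=
    fun i j => (h1.smooth c hc i j).diffAt c.open_target hz
  simp only [Pi.smul_apply, Matrix.smul_apply, Complex.real_smul]
  have e1 := hα c hc z hz i j k
  simp only [dz_eq_wd] at e1 ⊢
  rw [wd_const_mul _ (hd _ _), wd_const_mul _ (hd _ _), e1]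

theorem IsClosedForm.neg (hα : IsClosedForm α) (h1 : IsForm α) : IsClosedForm (-α) := by
  have := hα.smul h1 (-1); rwa [neg_one_smul] at this

theorem isClosedForm_ddbar {u : X → ℝ} (hu : ChartSmooth (n := n) u) :
    IsClosedForm (ddbar u : Coeff n X) := fun c hc _ hz i j k =>
  complexHessian_closed c.open_target (hu c hc) hz i j k

theorem isClosedForm_ricciOfVolume [IsManifold 𝓘(ℂ, Cn n) ω X] {ω₀ : Coeff n X} (h₀ : IsForm ω₀) (hpos : IsPositive ω₀)
    {f : X → ℝ} (hf : ChartSmooth (n := n) f) : IsClosedForm (ricciOfVolume ω₀ f) := by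
  intro c hc z hz i j k
  have hs := (contDiffOn_log_volume h₀ hpos hf hc).neg
  have h1 := complexHessian_closed c.open_target hs hz i j k
  have h2 : ∀ i j, dz k (fun w => ricciOfVolume ω₀ f c w i j) z = _ := fun i j =>
    dz_congr_on c.open_target (fun w hw => congrFun (congrFun
      (complexHessian_neg c.open_target (contDiffOn_log_volume h₀ hpos hf hc) hw).symm i) j) hz k
  have h3 : ∀ k i j, dz k (fun w => ricciOfVolume ω₀ f c w i j) z = _ := fun k i j =>
    dz_congr_on c.open_target (fun w hw => congrFun (congrFun
      (complexHessian_neg c.open_target (contDiffOn_log_volume h₀ hpos hf hc) hw).symm i) j) hz k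
  rw [h3, h3]
  exact h1

theorem IsDivisorNorm.isClosedForm {σ : X → ℝ} {θ : Coeff n X} (h : IsDivisorNorm σ θ) :
    IsClosedForm θ := by
  intro c hc z hz i j k
  obtain ⟨U, a, S, hl, hzU⟩ := h.exists_local c hc z hz
  have hU := hl.localSection.isOpen
  have hs := hl.localSection.smooth_log
  have h1 := complexHessian_closed hU hs.neg hzU i j k
  have h3 : ∀ k i j, dz k (fun w => θ c w i j) z = _ := fun k i j =>
    dz_congr_on hU (fun w hw => congrFun (congrFun
      ((hl.curv_eq w hw).trans (complexHessian_neg hU hs hw).symm) i) j) hzU k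
  rw [h3, h3]
  exact h1

variable {ω₀ θ η : Coeff n X} {σ f : X → ℝ} {γ : ℝ}

theorem isForm_nu [IsManifold 𝓘(ℂ, Cn n) ω X] (h₀ : IsForm ω₀) (hpos : IsPositive ω₀)
    (hf : ChartSmooth (n := n) f) (hθ : IsForm θ) (hη : IsForm η) : IsForm (nu ω₀ θ η f γ) :=
  ((isForm_ricciOfVolume h₀ hpos hf).neg.add (hθ.smul _)).add hη

theorem isClosedForm_nu [IsManifold 𝓘(ℂ, Cn n) ω X] (h₀ : IsForm ω₀) (hpos : IsPositive ω₀)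
    (hf : ChartSmooth (n := n) f) (h : IsDivisorNorm σ θ) (hη : IsForm η) (hηc : IsClosedForm η) :
    IsClosedForm (nu ω₀ θ η f γ) := by
  have hr := isForm_ricciOfVolume h₀ hpos hf
  exact (((isClosedForm_ricciOfVolume h₀ hpos hf).neg hr).add (h.isClosedForm.smul h.isForm _)
    hr.neg (h.isForm.smul _)).add hηc (hr.neg.add (h.isForm.smul _)) hη

end Closed

end ConicalKRF

namespace ConicalKRF

open Matrix

/-! ### The evolution of the test quantity along the flow. -/

variable {n : ℕ} {X : Type*} [TopologicalSpace X] [ChartedSpace (Cn n) X]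

/-- The evolving metric of the flow. -/
def flowMetric (ω₀ θ η : Coeff n X) (f : X → ℝ) (γ : ℝ) (φ : ℝ → X → ℝ) (t : ℝ) : Coeff n X :=
  evolvingForm ω₀ (nu ω₀ θ η f γ) t (φ t)

/-- The right hand side of the flow equation. -/
def flowSpeed (ω₀ : Coeff n X) (σ : X → ℝ) (θ η : Coeff n X) (f : X → ℝ) (γ ε : ℝ) (φ : ℝ → X → ℝ)
    (t : ℝ) (x : X) : ℝ :=
  Real.log (volumeRatio (flowMetric ω₀ θ η f γ φ t) ω₀ x) + f x + (1 - γ) * Real.log (ε ^ 2 + σ x)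

/-- A solution of the approximate flow, together with the data of the equation. -/
structure ConicalFlow (ω₀ : Coeff n X) (σ : X → ℝ) (θ η : Coeff n X) (f : X → ℝ) (γ ε T : ℝ)
    (ψ : X → ℝ) (φ : ℝ → X → ℝ) : Prop where
  kahler : IsKahler ω₀
  norm : IsDivisorNorm σ θ
  form : IsForm η
  closed : IsClosedForm η
  smooth_density : ChartSmooth (n := n) f
  gamma_mem : γ ∈ Set.Ioo (0 : ℝ) 1
  eps_mem : ε ∈ Set.Ioo (0 : ℝ) 1
  flow : IsFlow ω₀ (nu ω₀ θ η f γ) f σ γ ε T ψ φ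

namespace ConicalFlow

variable [IsManifold 𝓘(ℂ, Cn n) ω X] {ω₀ : Coeff n X} {σ : X → ℝ} {θ η : Coeff n X} {f : X → ℝ}
  {γ ε T : ℝ} {ψ : X → ℝ} {φ : ℝ → X → ℝ} {c : OpenPartialHomeomorph X (Cn n)} {z : Cn n} {t : ℝ}

theorem isOpen_cylinder (T : ℝ) (c : OpenPartialHomeomorph X (Cn n)) :
    IsOpen (Set.Ioo 0 T ×ˢ c.target) := isOpen_Ioo.prod c.open_target

/-- Endpoints are excluded so that space-time derivatives are taken on an open set. The estimates
start at `t₀ > 0` and end before `T`, so nothing is lost. -/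
theorem contDiffOn_potential (h : ConicalFlow ω₀ σ θ η f γ ε T ψ φ) (hc : c ∈ atlas (Cn n) X) :
    ContDiffOn ℝ ∞ (fun p : ℝ × Cn n => φ p.1 (c.symm p.2)) (Set.Ioo 0 T ×ˢ c.target) := by
  have : IsManifold 𝓘(ℝ, Cn n) ∞ X := isManifold_real
  have h1 : ContMDiffOn 𝓘(ℝ, Cn n) 𝓘(ℝ, Cn n) ∞ c.symm c.target :=
    contMDiffOn_symm_of_mem_maximalAtlas (IsManifold.subset_maximalAtlas hc)
  have h2 : ContMDiffOn 𝓘(ℝ, ℝ × Cn n) 𝓘(ℝ, Cn n) ∞ (fun p : ℝ × Cn n => c.symm p.2)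
      (Set.Ioo 0 T ×ˢ c.target) :=
    h1.comp (contDiff_snd.contMDiff.contMDiffOn) fun p hp => hp.2
  have h3 : ContMDiffOn 𝓘(ℝ, ℝ × Cn n) 𝓘(ℝ, ℝ) ∞ (fun p : ℝ × Cn n => p.1)
      (Set.Ioo 0 T ×ˢ c.target) := contDiff_fst.contMDiff.contMDiffOn
  exact contMDiffOn_iff_contDiffOn.1 (h.flow.smooth.comp (h3.prodMk h2)
    fun p hp => ⟨⟨hp.1.1.le, hp.1.2.le⟩, trivial⟩)

theorem chartSmooth_potential (h : ConicalFlow ω₀ σ θ η f γ ε T ψ φ) (ht : t ∈ Set.Ioo 0 T) :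
    ChartSmooth (n := n) (φ t) := fun _ hc =>
  (contDiffOn_slice (h.contDiffOn_potential hc) t).mono fun _ hw => ⟨ht, hw⟩

theorem isForm_nu (h : ConicalFlow ω₀ σ θ η f γ ε T ψ φ) : IsForm (nu ω₀ θ η f γ) :=
  ConicalKRF.isForm_nu h.kahler.isForm h.kahler.pos h.smooth_density h.norm.isForm h.form

theorem isForm_metric (h : ConicalFlow ω₀ σ θ η f γ ε T ψ φ) (ht : t ∈ Set.Ioo 0 T) :
    IsForm (flowMetric ω₀ θ η f γ φ t) :=
  (h.kahler.isForm.add (h.isForm_nu.smul t)).add (isForm_ddbar (h.chartSmooth_potential ht))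

theorem isPositive_metric (h : ConicalFlow ω₀ σ θ η f γ ε T ψ φ) (ht : t ∈ Set.Ioo 0 T) :
    IsPositive (flowMetric ω₀ θ η f γ φ t) := h.flow.pos t ⟨ht.1.le, ht.2.le⟩

theorem isClosedForm_metric (h : ConicalFlow ω₀ σ θ η f γ ε T ψ φ) (ht : t ∈ Set.Ioo 0 T) :
    IsClosedForm (flowMetric ω₀ θ η f γ φ t) := by
  have hφ := h.chartSmooth_potential ht
  have hν : IsClosedForm (nu ω₀ θ η f γ) :=
    isClosedForm_nu h.kahler.isForm h.kahler.pos h.smooth_density h.norm h.form h.closed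
  exact ((h.kahler.closed.add (hν.smul h.isForm_nu t) h.kahler.isForm (h.isForm_nu.smul t)).add
    (isClosedForm_ddbar hφ) (h.kahler.isForm.add (h.isForm_nu.smul t)) (isForm_ddbar hφ))

theorem smoothMat_metric (h : ConicalFlow ω₀ σ θ η f γ ε T ψ φ) (hc : c ∈ atlas (Cn n) X) :
    SmoothMat (fun p : ℝ × Cn n => flowMetric ω₀ θ η f γ φ p.1 c p.2)
      (Set.Ioo 0 T ×ˢ c.target) := by
  intro i j
  have h1 := smoothMat_complexHessian_slice (isOpen_cylinder T c) (h.contDiffOn_potential hc) i j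
  have hm : Set.MapsTo Prod.snd (Set.Ioo 0 T ×ˢ c.target) c.target := fun p hp => hp.2
  have h2 := (h.kahler.isForm.smooth c hc i j).comp contDiff_snd.contDiffOn hm
  have h3 := (h.isForm_nu.smooth c hc i j).comp contDiff_snd.contDiffOn hm
  have h4 : ContDiffOn ℝ ∞ (fun p : ℝ × Cn n => ((p.1 : ℝ) : ℂ)) (Set.Ioo 0 T ×ˢ c.target) :=
    contDiffOn_ofReal contDiff_fst.contDiffOn
  exact (h2.add (h4.mul h3)).add h1

theorem posDef_metric (h : ConicalFlow ω₀ σ θ η f γ ε T ψ φ) (hc : c ∈ atlas (Cn n) X) :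
    ∀ p ∈ Set.Ioo 0 T ×ˢ c.target, (flowMetric ω₀ θ η f γ φ p.1 c p.2).PosDef := fun _ hp =>
  h.isPositive_metric hp.1 c hc _ hp.2

theorem speed_eq (h : ConicalFlow ω₀ σ θ η f γ ε T ψ φ) (hc : c ∈ atlas (Cn n) X)
    (ht : t ∈ Set.Ioo 0 T) (hz : z ∈ c.target) :
    flowSpeed ω₀ σ θ η f γ ε φ t (c.symm z) =
      Real.log (flowMetric ω₀ θ η f γ φ t c z).det.re - Real.log (ω₀ c z).det.re +
        f (c.symm z) + (1 - γ) * Real.log (ε ^ 2 + σ (c.symm z)) := by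
  rw [flowSpeed, volumeRatio_eq (h.isForm_metric ht) h.kahler.isForm h.kahler.pos hc
    (c.map_target hz), c.right_inv hz, Real.log_div
    (det_re_pos (h.isPositive_metric ht c hc z hz)).ne'
    (det_re_pos (h.kahler.pos c hc z hz)).ne']

theorem hasDerivAt_potential (h : ConicalFlow ω₀ σ θ η f γ ε T ψ φ) (ht : t ∈ Set.Ioo 0 T)
    (x : X) : HasDerivAt (fun τ => φ τ x) (flowSpeed ω₀ σ θ η f γ ε φ t x) t :=
  (h.flow.eqn t ⟨ht.1.le, ht.2.le⟩ x).hasDerivAt (Icc_mem_nhds ht.1 ht.2)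

theorem contDiffOn_speed (h : ConicalFlow ω₀ σ θ η f γ ε T ψ φ) (hc : c ∈ atlas (Cn n) X) :
    ContDiffOn ℝ ∞ (fun p : ℝ × Cn n => flowSpeed ω₀ σ θ η f γ ε φ p.1 (c.symm p.2))
      (Set.Ioo 0 T ×ˢ c.target) :=
  contDiffOn_of_hasDerivAt (isOpen_cylinder T c) (h.contDiffOn_potential hc)
    fun p hp => h.hasDerivAt_potential hp.1 (c.symm p.2)

theorem chartSmooth_speed (h : ConicalFlow ω₀ σ θ η f γ ε T ψ φ) (ht : t ∈ Set.Ioo 0 T) :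
    ChartSmooth (n := n) (flowSpeed ω₀ σ θ η f γ ε φ t) := fun _ hc =>
  (contDiffOn_slice (h.contDiffOn_speed hc) t).mono fun _ hw => ⟨ht, hw⟩

theorem hasDerivAt_metric (h : ConicalFlow ω₀ σ θ η f γ ε T ψ φ) (hc : c ∈ atlas (Cn n) X)
    (ht : t ∈ Set.Ioo 0 T) (hz : z ∈ c.target) (i j : Fin n) :
    HasDerivAt (fun τ => flowMetric ω₀ θ η f γ φ τ c z i j)
      ((nu ω₀ θ η f γ c z + ddbar (flowSpeed ω₀ σ θ η f γ ε φ t) c z) i j) t := by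
  have h1 := hasDerivAt_complexHessian (isOpen_cylinder T c) (h.contDiffOn_potential hc)
    (fun p hp => h.hasDerivAt_potential hp.1 (c.symm p.2)) (t := t) (z := z) ⟨ht, hz⟩ i j
  have h2 : HasDerivAt (fun τ : ℝ => (τ : ℂ) * nu ω₀ θ η f γ c z i j)
      (1 * nu ω₀ θ η f γ c z i j) t := (hasDerivAt_id t).ofReal_comp.mul_const _
  have h3 := (h2.const_add (ω₀ c z i j)).add h1
  rw [one_mul] at h3
  exact h3

/-- The time derivative of the metric is, up to the twisting form, `-Ric`. -/
theorem metricDeriv_eq (h : ConicalFlow ω₀ σ θ η f γ ε T ψ φ) (hc : c ∈ atlas (Cn n) X)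
    (ht : t ∈ Set.Ioo 0 T) (hz : z ∈ c.target) :
    nu ω₀ θ η f γ c z + ddbar (flowSpeed ω₀ σ θ η f γ ε φ t) c z =
      complexHessian (fun w => Real.log (flowMetric ω₀ θ η f γ φ t c w).det.re) z +
        twistForm σ θ η γ ε c z := by
  have hU := c.open_target
  have hd0 := fun w hw => det_re_pos (h.kahler.pos c hc w hw)
  have hG := contDiffOn_log_det ((h.isForm_metric ht).smooth c hc) (h.isPositive_metric ht c hc)
  have hω := contDiffOn_log_det (h.kahler.isForm.smooth c hc) (h.kahler.pos c hc)
  have hf := h.smooth_density c hc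
  have hl := h.norm.chartSmooth_log h.eps_mem.1 c hc
  have hl' : ContDiffOn ℝ ∞ (fun w => (1 - γ) * Real.log (ε ^ 2 + σ (c.symm w))) c.target :=
    hl.const_smul (1 - γ)
  have e1 : ddbar (flowSpeed ω₀ σ θ η f γ ε φ t) c z =
      complexHessian (fun w => Real.log (flowMetric ω₀ θ η f γ φ t c w).det.re) z -
      complexHessian (fun w => Real.log (ω₀ c w).det.re) z +
      complexHessian (fun w => f (c.symm w)) z +
      (1 - γ) • ddbar (fun x => Real.log (ε ^ 2 + σ x)) c z := by
    rw [ddbar, complexHessian_congr_on hU (fun w hw => h.speed_eq hc ht hw) hz,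
      complexHessian_add hU ((hG.sub hω).add hf) hl' hz,
      complexHessian_add hU (hG.sub hω) hf hz, complexHessian_sub hU hG hω hz]
    congr 1
    exact complexHessian_const_mul hU hl (1 - γ) hz
  have e2 : ricciOfVolume ω₀ f c z = complexHessian (fun w => f (c.symm w)) z -
      complexHessian (fun w => Real.log (ω₀ c w).det.re) z := by
    rw [ricciOfVolume, complexHessian_congr_on hU (v := fun w => -f (c.symm w) +
      Real.log (ω₀ c w).det.re) (fun w hw => by
        rw [Real.log_mul (Real.exp_pos _).ne' (hd0 w hw).ne', Real.log_exp]) hz,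
      complexHessian_add hU hf.neg hω hz, complexHessian_neg hU hf hz]
    abel
  have e3 : nu ω₀ θ η f γ c z = -ricciOfVolume ω₀ f c z + (1 - γ) • θ c z + η c z := rfl
  rw [e1, e3, e2, twistForm]
  module

/-- The quantity to which the maximum principle is applied. -/
def testQuantity (ω₀ : Coeff n X) (σ : X → ℝ) (θ η : Coeff n X) (f : X → ℝ) (γ ε : ℝ)
    (φ : ℝ → X → ℝ) (S : LocalTest n X) (t₀ m N A k : ℝ) (p : ℝ × Cn n) : ℝ :=
  (p.1 - t₀) * (flowSpeed ω₀ σ θ η f γ ε φ p.1 (S.chart.symm p.2) + m * (S.weight ε p.2 +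
    Real.log (formNormSq (flowMetric ω₀ θ η f γ φ p.1 S.chart p.2) (S.covector p.2)) -
      N * S.cutoff p.2)) -
    A * (φ p.1 (S.chart.symm p.2) - k * chi σ γ ε (S.chart.symm p.2))

variable {S : LocalTest n X} {C t₀ m N A k : ℝ}

theorem contDiffOn_formNormSq_metric (h : ConicalFlow ω₀ σ θ η f γ ε T ψ φ)
    (hS : S.IsAdmissible ω₀ σ θ η γ C) : ContDiffOn ℝ ∞ (fun p : ℝ × Cn n =>
      formNormSq (flowMetric ω₀ θ η f γ φ p.1 S.chart p.2) (S.covector p.2))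
        (Set.Ioo 0 T ×ˢ S.domain) :=
  have hsub : Set.Ioo 0 T ×ˢ S.domain ⊆ Set.Ioo 0 T ×ˢ S.chart.target :=
    Set.prod_mono le_rfl hS.domain_subset
  contDiffOn_formNormSq (fun i j => (h.smoothMat_metric hS.mem_atlas i j).mono hsub)
    (fun p hp => h.posDef_metric hS.mem_atlas p (hsub hp))
    fun i => (hS.smooth i).comp contDiff_snd.contDiffOn fun _ hp => hp.2

theorem contDiffOn_log_formNormSq_metric (h : ConicalFlow ω₀ σ θ η f γ ε T ψ φ)
    (hS : S.IsAdmissible ω₀ σ θ η γ C) : ContDiffOn ℝ ∞ (fun p : ℝ × Cn n =>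
      Real.log (formNormSq (flowMetric ω₀ θ η f γ φ p.1 S.chart p.2) (S.covector p.2)))
        (Set.Ioo 0 T ×ˢ S.domain) :=
  (h.contDiffOn_formNormSq_metric hS).log fun p hp => (formNormSq_pos
    (h.posDef_metric hS.mem_atlas p ⟨hp.1, hS.domain_subset hp.2⟩) (hS.ne_zero _ hp.2)).ne'

theorem continuousOn_testQuantity (h : ConicalFlow ω₀ σ θ η f γ ε T ψ φ)
    (hS : S.IsAdmissible ω₀ σ θ η γ C) :
    ContinuousOn (testQuantity ω₀ σ θ η f γ ε φ S t₀ m N A k) (Set.Ioo 0 T ×ˢ S.domain) := by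
  have hsub : Set.Ioo 0 T ×ˢ S.domain ⊆ Set.Ioo 0 T ×ˢ S.chart.target :=
    Set.prod_mono le_rfl hS.domain_subset
  have hm : Set.MapsTo Prod.snd (Set.Ioo 0 T ×ˢ S.domain) S.domain := fun p hp => hp.2
  have h1 := (h.contDiffOn_speed hS.mem_atlas).continuousOn.mono hsub
  have h2 := (h.contDiffOn_log_formNormSq_metric hS).continuousOn
  have h3 := (hS.smooth_weight ε h.eps_mem).continuousOn.comp continuousOn_snd hm
  have h4 := (S.contDiff_cutoff.continuous.comp continuous_snd).continuousOn
    (s := Set.Ioo 0 T ×ˢ S.domain)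
  have h5 := (h.contDiffOn_potential hS.mem_atlas).continuousOn.mono hsub
  have h6 := ((h.norm.chartSmooth_chi h.gamma_mem.1.ne' h.eps_mem.1 S.chart
    hS.mem_atlas).continuousOn.mono hS.domain_subset).comp continuousOn_snd hm
  exact ((continuousOn_fst.sub continuousOn_const).mul (h1.add (continuousOn_const.mul
    ((h3.add h2).sub (continuousOn_const.mul h4))))).sub
    (continuousOn_const.mul (h5.sub (continuousOn_const.mul h6)))

set_option maxHeartbeats 1000000 in
/-- The differential inequality at a maximum point of the test quantity. -/
theorem evolution_estimate (h : ConicalFlow ω₀ σ θ η f γ ε T ψ φ)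
    (hS : S.IsAdmissible ω₀ σ θ η γ C) (hm : 0 ≤ m) (hN : 0 ≤ N) (ht₀ : 0 < t₀) (htt : t₀ < t)
    (htT : t < T) (hz : z ∈ Metric.ball S.center S.radius)
    (hmt : ∀ τ ∈ Set.Icc t₀ t, testQuantity ω₀ σ θ η f γ ε φ S t₀ m N A k (τ, z) ≤
      testQuantity ω₀ σ θ η f γ ε φ S t₀ m N A k (t, z))
    (hmx : IsLocalMax (fun w => testQuantity ω₀ σ θ η f γ ε φ S t₀ m N A k (t, w)) z) :
    0 ≤ (1 - A) * flowSpeed ω₀ σ θ η f γ ε φ t (S.chart.symm z) +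
      m * (S.weight ε z + Real.log (formNormSq (flowMetric ω₀ θ η f γ φ t S.chart z)
        (S.covector z)) - N * S.cutoff z) +
      (t - t₀) * (((flowMetric ω₀ θ η f γ φ t S.chart z)⁻¹ * nu ω₀ θ η f γ S.chart z).trace.re +
        m * ((C + N * C) * ((flowMetric ω₀ θ η f γ φ t S.chart z)⁻¹ * ω₀ S.chart z).trace.re)) +
      A * (n - ((flowMetric ω₀ θ η f γ φ t S.chart z)⁻¹ * (ω₀ S.chart z +
        t • nu ω₀ θ η f γ S.chart z + k • ddbar (chi σ γ ε) S.chart z)).trace.re) := by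
  have ht : t ∈ Set.Ioo 0 T := ⟨ht₀.trans htt, htT⟩
  have hc := hS.mem_atlas
  have hzb := Metric.ball_subset_closedBall hz
  have hzd : z ∈ S.domain := hS.subset_domain hzb
  have hzc : z ∈ S.chart.target := hS.domain_subset hzd
  have hsl : S.domain ⊆ {w | (t, w) ∈ Set.Ioo 0 T ×ˢ S.domain} := fun w hw => ⟨ht, hw⟩
  have hU := hS.isOpen
  have hGpos := h.isPositive_metric ht S.chart hc z hzc
  set Gf := flowMetric ω₀ θ η f γ φ with hGf
  set V := flowSpeed ω₀ σ θ η f γ ε φ with hV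
  set G := Gf t S.chart z with hG
  set ν := nu ω₀ θ η f γ S.chart z with hν
  have hu := formNormSq_pos hGpos (hS.ne_zero z hzd)
  have hP := hGpos.inv.posSemidef
  set u := formNormSq G (S.covector z) with hu'
  -- time derivative
  set G' := ν + ddbar (V t) S.chart z with hG'
  have d1 : HasDerivAt (fun τ => V τ (S.chart.symm z)) (G⁻¹ * G').trace.re t := by
    have h1 := hasDerivAt_log_det (h.hasDerivAt_metric hc ht hzc) hGpos
    have h2 := (((h1.sub_const (Real.log (ω₀ S.chart z).det.re)).add_const
      (f (S.chart.symm z))).add_const ((1 - γ) * Real.log (ε ^ 2 + σ (S.chart.symm z))))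
    refine h2.congr_of_eventuallyEq ?_
    filter_upwards [isOpen_Ioo.mem_nhds ht] with τ hτ
    exact h.speed_eq hc hτ hzc
  have d2 : HasDerivAt (fun τ => Real.log (formNormSq (Gf τ S.chart z) (S.covector z)))
      (-(star (G⁻¹ *ᵥ S.covector z) ⬝ᵥ (G' *ᵥ (G⁻¹ *ᵥ S.covector z))).re / u) t := by
    have hsm : SmoothMat (fun τ => Gf τ S.chart z) (Set.Ioo 0 T) := fun i j =>
      (h.smoothMat_metric hc i j).comp (contDiff_id.prodMk contDiff_const).contDiffOn
        fun τ hτ => ⟨hτ, hzc⟩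
    exact (hasDerivAt_formNormSq isOpen_Ioo ht hsm (h.hasDerivAt_metric hc ht hzc)
      (fun τ hτ => h.isPositive_metric hτ S.chart hc z hzc) _).log hu.ne'
  have d3 := h.hasDerivAt_potential ht (S.chart.symm z)
  -- The covector, the weight and the cutoff do not depend on time, so only the speed, the norm and
  -- the potential contribute.
  have d4 := ((((hasDerivAt_id t).sub_const t₀).mul (d1.add (((d2.const_add (S.weight ε z)).sub_const
    (N * S.cutoff z)).const_mul m))).sub ((d3.sub_const (k * chi σ γ ε (S.chart.symm z))).const_mul A))
  have d5 := nonneg_of_hasDerivAt_of_le htt d4 hmt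
  -- space derivatives
  have s1 : ContDiffOn ℝ ∞ (fun w => V t (S.chart.symm w)) S.domain :=
    (h.chartSmooth_speed ht S.chart hc).mono hS.domain_subset
  have s2 : ContDiffOn ℝ ∞ (S.weight ε) S.domain := hS.smooth_weight ε h.eps_mem
  have s3 : ContDiffOn ℝ ∞ (fun w => Real.log (formNormSq (Gf t S.chart w) (S.covector w)))
      S.domain := (contDiffOn_slice (h.contDiffOn_log_formNormSq_metric hS) t).mono hsl
  have s4 : ContDiffOn ℝ ∞ S.cutoff S.domain := S.contDiff_cutoff.contDiffOn
  have s5 : ContDiffOn ℝ ∞ (fun w => φ t (S.chart.symm w)) S.domain :=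
    (h.chartSmooth_potential ht S.chart hc).mono hS.domain_subset
  have s6 : ContDiffOn ℝ ∞ (fun w => chi σ γ ε (S.chart.symm w)) S.domain :=
    (h.norm.chartSmooth_chi h.gamma_mem.1.ne' h.eps_mem.1 S.chart hc).mono hS.domain_subset
  have c4 : ContDiffOn ℝ ∞ (fun w => N * S.cutoff w) S.domain := s4.const_smul N
  have c24 : ContDiffOn ℝ ∞ (fun w => S.weight ε w + Real.log (formNormSq (Gf t S.chart w)
    (S.covector w)) - N * S.cutoff w) S.domain := (s2.add s3).sub c4
  have c24m : ContDiffOn ℝ ∞ (fun w => m * (S.weight ε w + Real.log (formNormSq (Gf t S.chart w)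
    (S.covector w)) - N * S.cutoff w)) S.domain := c24.const_smul m
  have c1 := s1.add c24m
  have c1t : ContDiffOn ℝ ∞ (fun w => (t - t₀) * (V t (S.chart.symm w) + m * (S.weight ε w +
    Real.log (formNormSq (Gf t S.chart w) (S.covector w)) - N * S.cutoff w))) S.domain :=
      c1.const_smul (t - t₀)
  have c6 : ContDiffOn ℝ ∞ (fun w => k * chi σ γ ε (S.chart.symm w)) S.domain := s6.const_smul k
  have c56 := s5.sub c6
  have c56A : ContDiffOn ℝ ∞ (fun w => A * (φ t (S.chart.symm w) - k * chi σ γ ε (S.chart.symm w)))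
    S.domain := c56.const_smul A
  have hH : ContDiffOn ℝ ∞ (fun w => testQuantity ω₀ σ θ η f γ ε φ S t₀ m N A k (t, w)) S.domain :=
    c1t.sub c56A
  have hess : complexHessian (fun w => testQuantity ω₀ σ θ η f γ ε φ S t₀ m N A k (t, w)) z =
      (t - t₀) • (ddbar (V t) S.chart z + m • (complexHessian (S.weight ε) z +
        complexHessian (fun w => Real.log (formNormSq (Gf t S.chart w) (S.covector w))) z -
        N • complexHessian S.cutoff z)) -
      A • (ddbar (φ t) S.chart z - k • ddbar (chi σ γ ε) S.chart z) := by
    have e0 := complexHessian_sub hU c1t c56A hzd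
    rw [complexHessian_const_mul hU c1 (t - t₀) hzd, complexHessian_add hU s1 c24m hzd,
      complexHessian_const_mul hU c24 m hzd, complexHessian_sub hU (s2.add s3) c4 hzd,
      complexHessian_add hU s2 s3 hzd, complexHessian_const_mul hU s4 N hzd,
      complexHessian_const_mul hU c56 A hzd, complexHessian_sub hU s5 c6 hzd,
      complexHessian_const_mul hU s6 k hzd] at e0
    exact e0
  have p1 := trace_mul_re_nonneg hP
    (posSemidef_neg_complexHessian_of_isLocalMax hU hH hzd hmx)
  rw [hess, Matrix.mul_neg, trace_neg, Complex.neg_re, trace_mul_sub_re, trace_mul_real_smul,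
    trace_mul_real_smul, trace_mul_add_re, trace_mul_real_smul, trace_mul_sub_re, trace_mul_add_re,
    trace_mul_real_smul, trace_mul_sub_re, trace_mul_real_smul] at p1
  -- Bochner inequality and the estimates for the test
  have b1 := bochner_inequality hU hzd
    (fun i j => ((h.isForm_metric ht).smooth S.chart hc i j).mono hS.domain_subset)
    (fun w hw => h.isPositive_metric ht S.chart hc w (hS.domain_subset hw))
    (fun w hw i j l => h.isClosedForm_metric ht S.chart hc w (hS.domain_subset hw) i j l)
    hS.smooth hS.holo hS.ne_zero
  have b2 := hS.evolution ε h.eps_mem z hzb G hGpos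
  have b3 := (hS.cutoff_le z hzb).trace_le hP
  rw [trace_mul_real_smul] at b3
  have e1 : G' = _ := h.metricDeriv_eq hc ht hzc
  have e2 : -(star (G⁻¹ *ᵥ S.covector z) ⬝ᵥ (G' *ᵥ (G⁻¹ *ᵥ S.covector z))).re / u =
      -(star (G⁻¹ *ᵥ S.covector z) ⬝ᵥ (complexHessian (fun w => Real.log
        (Gf t S.chart w).det.re) z *ᵥ (G⁻¹ *ᵥ S.covector z))).re / u +
      -(star (G⁻¹ *ᵥ S.covector z) ⬝ᵥ (twistForm σ θ η γ ε S.chart z *ᵥ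
        (G⁻¹ *ᵥ S.covector z))).re / u := by
    rw [e1, Matrix.add_mulVec, dotProduct_add, Complex.add_re]; ring
  have e3 : (G⁻¹ * G').trace.re = (G⁻¹ * ν).trace.re + (G⁻¹ * ddbar (V t) S.chart z).trace.re := by
    rw [hG', trace_mul_add_re]
  -- The Hessian of the potential is the metric minus its reference form, and the metric has trace
  -- `n` with respect to itself.
  have e4 : (G⁻¹ * ddbar (φ t) S.chart z).trace.re =
      n - (G⁻¹ * (ω₀ S.chart z + t • ν)).trace.re := by
    have : ddbar (φ t) S.chart z = G - (ω₀ S.chart z + t • ν) := by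
      change _ = (ω₀ S.chart z + t • ν + ddbar (φ t) S.chart z) - _
      abel
    rw [this, trace_mul_sub_re, trace_inv_mul_self hGpos, Fintype.card_fin]
  rw [trace_mul_add_re, trace_mul_real_smul G⁻¹ (ddbar (chi σ γ ε) S.chart z) k]
  rw [e4] at p1
  simp only [id, Pi.add_apply, one_mul] at d5
  rw [e3] at d5
  set E := -(star (G⁻¹ *ᵥ S.covector z) ⬝ᵥ (G' *ᵥ (G⁻¹ *ᵥ S.covector z))).re / u
  set trψ := (G⁻¹ * complexHessian (S.weight ε) z).trace.re
  set trL := (G⁻¹ * complexHessian (fun w => Real.log (formNormSq (Gf t S.chart w)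
    (S.covector w))) z).trace.re
  set trd := (G⁻¹ * complexHessian S.cutoff z).trace.re
  set y₀ := (G⁻¹ * ω₀ S.chart z).trace.re
  -- By `e2` the time derivative `E` splits into a Ricci part and a twist part. The Bochner
  -- inequality `b1` cancels the first against `trL`, `b2` bounds the second together with the
  -- weight, and `b3` bounds the cutoff.
  have q1 : E - trL - trψ + N * trd ≤ (C + N * C) * y₀ := by
    have := mul_le_mul_of_nonneg_left b3 hN
    rw [e2]
    nlinarith
  have q2 := mul_le_mul_of_nonneg_left q1 (mul_nonneg (sub_nonneg.2 htt.le) hm)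
  nlinarith

end ConicalFlow

end ConicalKRF

namespace ConicalKRF

open Matrix

/-! ### Bounds for the data which do not depend on `ε`. -/

variable {n : ℕ} {X : Type*} [TopologicalSpace X] [ChartedSpace (Cn n) X]

/-- Constants, independent of `ε`, which bound the data of the flow. -/
structure FlowBounds (ω₀ : Coeff n X) (σ : X → ℝ) (θ ν : Coeff n X) (f : X → ℝ)
    (γ T k b B : ℝ) : Prop where
  k_pos : 0 < k
  b_pos : 0 < b
  B_pos : 0 < B
  abs_density_le : ∀ x, |f x| ≤ B
  norm_le : ∀ x, σ x ≤ B
  nu_le : ∀ c ∈ atlas (Cn n) X, ∀ z ∈ c.target, MatLE (ν c z) (B • ω₀ c z)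
  reference_le : ∀ t ∈ Set.Icc 0 T, ∀ c ∈ atlas (Cn n) X, ∀ z ∈ c.target,
    MatLE (ω₀ c z + t • ν c z) (B • ω₀ c z)
  le_reference : ∀ t ∈ Set.Icc 0 T, ∀ ε ∈ Set.Ioo (0 : ℝ) 1, ∀ c ∈ atlas (Cn n) X,
    ∀ z ∈ c.target, MatLE (b • modelForm ω₀ σ θ γ ε c z)
      (ω₀ c z + t • ν c z + k • ddbar (chi σ γ ε) c z)
  coneApprox_le : ∀ ε ∈ Set.Ioo (0 : ℝ) 1, ∀ c ∈ atlas (Cn n) X, ∀ z ∈ c.target,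
    MatLE (coneApprox ω₀ σ k γ ε c z) (B • modelForm ω₀ σ θ γ ε c z)
  det_model : ∀ ε ∈ Set.Ioo (0 : ℝ) 1, ∀ c ∈ atlas (Cn n) X, ∀ z ∈ c.target,
    b * coneWeight γ ε (σ (c.symm z)) * (ω₀ c z).det.re ≤ (modelForm ω₀ σ θ γ ε c z).det.re
  chi_nonneg : ∀ ε ∈ Set.Ioo (0 : ℝ) 1, ∀ x, 0 ≤ chi σ γ ε x
  chi_le : ∀ ε ∈ Set.Ioo (0 : ℝ) 1, ∀ x, chi σ γ ε x ≤ B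

/-- On a compact interval of times the reference forms are uniformly positive. -/
theorem exists_reference_lower [CompactSpace X] {ω₀ ν : Coeff n X} (h₀ : IsForm ω₀)
    (hpos : IsPositive ω₀) (hν : IsForm ν) {T : ℝ} (hT : 0 < T)
    (hνT : IsPositive (ω₀ + T • ν)) : ∃ b : ℝ, 0 < b ∧ b ≤ 1 ∧ ∀ t ∈ Set.Icc 0 T,
      ∀ c ∈ atlas (Cn n) X, ∀ z ∈ c.target, MatLE (b • ω₀ c z) (ω₀ c z + t • ν c z) := by
  obtain ⟨C, hC, h⟩ := h₀.exists_domination (h₀.add (hν.smul T)) hνT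
  have hC1 : 0 < max C 1 := lt_max_of_lt_left hC
  refine ⟨(max C 1)⁻¹, inv_pos.2 hC1, inv_le_one_of_one_le₀ (le_max_right _ _),
    fun t ht c hc z hz => ?_⟩
  have h1 : MatLE (ω₀ c z) (max C 1 • (ω₀ c z + T • ν c z)) := h _ (le_max_left _ _) c hc z hz
  have h2 := h1.smul (inv_pos.2 hC1).le
  rw [smul_smul, inv_mul_cancel₀ hC1.ne', one_smul] at h2
  -- The reference form at time `t` is the convex combination of `ω₀` and `ω₀ + Tν` with weights `1
  -- - t/T` and `t/T`, so positivity at the two ends suffices.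
  have h3 := h2.smul (c := t / T) (div_nonneg ht.1 hT.le)
  have h4 : MatLE ((max C 1)⁻¹ • ω₀ c z) ((1 : ℝ) • ω₀ c z) :=
    MatLE.smul_le (hpos c hc z hz).posSemidef (inv_le_one_of_one_le₀ (le_max_right _ _))
  have h5 := h4.smul (c := 1 - t / T) (by rw [sub_nonneg, div_le_one hT]; exact ht.2)
  have h6 := h5.add h3
  convert h6 using 1
  · module
  · have e : t • ν c z = (t / T) • T • ν c z := by rw [smul_smul, div_mul_cancel₀ _ hT.ne']
    rw [e]; module

/-- In the Hessian of `kχ` only the multiple of `θ` can spoil positivity. Its coefficient is at most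
`kQ` uniformly in `ε`, so for small `k` it costs at most half of the lower bound `c₁ ω₀` for the
reference forms. -/
theorem exists_flowBounds [CompactSpace X] [IsManifold 𝓘(ℂ, Cn n) ω X] {ω₀ : Coeff n X}
    {σ : X → ℝ} {θ ν : Coeff n X} {f : X → ℝ} {γ T : ℝ} (h : IsDivisorNorm σ θ) (h₀ : IsForm ω₀)
    (hpos : IsPositive ω₀) (hν : IsForm ν) (hf : ChartSmooth (n := n) f)
    (hγ : γ ∈ Set.Ioo (0 : ℝ) 1) (hT : 0 < T) (hνT : IsPositive (ω₀ + T • ν)) :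
    ∃ k₀ > 0, ∀ k ∈ Set.Ioc (0 : ℝ) k₀, ∃ b B, FlowBounds ω₀ σ θ ν f γ T k b B := by
  obtain ⟨M, hM⟩ := h.exists_isBound hν h₀ hpos
  obtain ⟨c₁, hc₁, hc₁', hlow⟩ := exists_reference_lower h₀ hpos hν hT hνT
  obtain ⟨m, hm, hdet⟩ := h.exists_det_modelForm_lower h₀ hpos hγ.2
  obtain ⟨Cν, hCν, hνle⟩ := hν.exists_domination h₀ hpos
  obtain ⟨F, hF⟩ := isCompact_univ.bddAbove_image hf.continuous.abs.continuousOn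
  have hM0 := hM.pos
  have hγ0 := hγ.1
  set Q := M ^ γ / γ with hQ
  have hQ0 : 0 < Q := by positivity
  have hq : ∀ ε ∈ Set.Ioo (0 : ℝ) 1, ∀ x, |((ε ^ 2 + σ x) ^ γ - ε ^ (2 * γ)) / γ| ≤ Q := by
    intro ε hε x
    rw [abs_of_nonneg (div_nonneg (rpow_sub_rpow_nonneg hγ0 hε.1 (h.nonneg x)) hγ0.le), hQ]
    gcongr
    exact (rpow_sub_rpow_le hγ0 hγ.2 hε.1 (h.nonneg x)).trans
      (Real.rpow_le_rpow (h.nonneg x) (hM.norm_le x) hγ0.le)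
  -- `Q` bounds the coefficient of `θ` in the Hessian of `χ`, and `M` bounds `θ` by `ω₀`; this is
  -- the largest `k` with `kQM ≤ c₁/2`.
  refine ⟨c₁ / (2 * (Q * M)), by positivity, fun k hk => ?_⟩
  have hk0 := hk.1
  have hkc : k * Q * M ≤ c₁ / 2 := by
    have := (le_div_iff₀ (by positivity)).1 hk.2
    nlinarith
  have hθ : ∀ ε ∈ Set.Ioo (0 : ℝ) 1, ∀ c ∈ atlas (Cn n) X, ∀ z ∈ c.target, ∀ s : ℝ, |s| ≤ k →
      MatLE ((s * (((ε ^ 2 + σ (c.symm z)) ^ γ - ε ^ (2 * γ)) / γ)) • θ c z)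
        ((c₁ / 2) • ω₀ c z) := by
    intro ε hε c hc z hz s hs
    have hω := (hpos c hc z hz).posSemidef
    have h1 := MatLE.smul_of_abs_le (posSemidef_real_smul hω hM0.le) (hM.curv_le c hc z hz)
      (hM.neg_curv_le c hc z hz) (c := s * (((ε ^ 2 + σ (c.symm z)) ^ γ - ε ^ (2 * γ)) / γ))
      (d := k * Q) (by
        rw [abs_mul]
        exact mul_le_mul hs (hq ε hε _) (abs_nonneg _) hk0.le)
    rw [smul_smul] at h1
    exact h1.trans (MatLE.smul_le hω hkc)
  -- Half of `c₁` survives in front of `ω₀`, `k` is the coefficient of the weighted divisor form,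
  -- and `m` comes from the volume of the model.
  set b := min (min (c₁ / 2) k) m with hb
  have hb0 : 0 < b := lt_min (lt_min (half_pos hc₁) hk0) hm
  have hb1 : b ≤ c₁ / 2 := (min_le_left _ _).trans (min_le_left _ _)
  have hb2 : b ≤ k := (min_le_left _ _).trans (min_le_right _ _)
  have hb3 : b ≤ m := min_le_right _ _
  set B := F + M + Cν + T * Cν + 2 + k + M ^ γ / γ ^ 2 + |F| with hB
  have hMγ : 0 ≤ M ^ γ / γ ^ 2 := by positivity
  have hTC : 0 < T * Cν := by positivity
  have hF' := neg_abs_le F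
  have hF0 := abs_nonneg F
  refine ⟨b, B, ?_⟩
  constructor
  case k_pos => exact hk0
  case b_pos => exact hb0
  case B_pos => linarith
  case abs_density_le =>
    intro x
    have h1 : |f x| ≤ F := hF ⟨x, trivial, rfl⟩
    linarith
  case norm_le => exact fun x => (hM.norm_le x).trans (by linarith)
  case nu_le => exact hνle B (by linarith)
  case reference_le =>
    intro t ht c hc z hz
    have hω := (hpos c hc z hz).posSemidef
    have h1 : MatLE (ν c z) (Cν • ω₀ c z) := hνle Cν le_rfl c hc z hz
    have h2 := (MatLE.refl (ω₀ c z)).add (h1.smul ht.1)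
    refine h2.trans ?_
    have h3 : ω₀ c z + t • Cν • ω₀ c z = (1 + t * Cν) • ω₀ c z := by module
    rw [h3]
    refine MatLE.smul_le hω ?_
    have : t * Cν ≤ T * Cν := mul_le_mul_of_nonneg_right ht.2 hCν.le
    linarith
  case le_reference =>
    intro t ht ε hε c hc z hz
    have hω := (hpos c hc z hz).posSemidef
    have hW := coneWeight_pos (γ := γ) hε.1 (h.nonneg (c.symm z))
    have hβ := posSemidef_real_smul (h.posSemidef_divisorForm hc hz) hW.le
    have h1 := hlow t ht c hc z hz
    have h2 := hθ ε hε c hc z hz k (abs_of_pos hk0).le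
    have h3 := (MatLE.smul_le hω hb1).add (MatLE.smul_le hβ hb2)
    rw [h.ddbar_chi_eq hc hz hγ0.ne' hε.1]
    have h4 := (h1.add h2).add h3
    rw [MatLE] at h4 ⊢
    convert h4 using 1
    rw [modelForm]
    module
  case coneApprox_le =>
    intro ε hε c hc z hz
    have hω := (hpos c hc z hz).posSemidef
    have hW := coneWeight_pos (γ := γ) hε.1 (h.nonneg (c.symm z))
    have hβ := posSemidef_real_smul (h.posSemidef_divisorForm hc hz) hW.le
    have h2 := hθ ε hε c hc z hz (-k) (by rw [abs_neg]; exact (abs_of_pos hk0).le)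
    have h3 := MatLE.smul_le hω (show 1 + c₁ / 2 ≤ B by linarith)
    have h4 := MatLE.smul_le hβ (show k ≤ B by linarith)
    have h5 : coneApprox ω₀ σ k γ ε c z = ω₀ c z + k • ddbar (chi σ γ ε) c z := rfl
    rw [h5, h.ddbar_chi_eq hc hz hγ0.ne' hε.1]
    have h6 := (h2.add h3).add h4
    rw [MatLE] at h6 ⊢
    convert h6 using 1
    rw [modelForm]
    module
  case det_model =>
    intro ε hε c hc z hz
    refine le_trans ?_ (hdet ε hε.1 c hc z hz)
    have hW := coneWeight_pos (γ := γ) hε.1 (h.nonneg (c.symm z))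
    have hd := det_re_pos (hpos c hc z hz)
    gcongr
  case chi_nonneg => exact fun ε hε x => conePotential_nonneg hγ0 hε.1 (h.nonneg x)
  case chi_le =>
    intro ε hε x
    refine (conePotential_le hγ0 hγ.2 hε.1 (h.nonneg x)).trans ?_
    have : σ x ^ γ / γ ^ 2 ≤ M ^ γ / γ ^ 2 := by
      gcongr
      · exact h.nonneg x
      · exact hM.norm_le x
    linarith

namespace FlowBounds

variable {ω₀ : Coeff n X} {σ : X → ℝ} {θ ν : Coeff n X} {f : X → ℝ} {γ T k b B ε : ℝ}
  {c : OpenPartialHomeomorph X (Cn n)} {z : Cn n}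

theorem le_coneApprox (hb : FlowBounds ω₀ σ θ ν f γ T k b B) (hT : 0 ≤ T)
    (hε : ε ∈ Set.Ioo (0 : ℝ) 1) (hc : c ∈ atlas (Cn n) X) (hz : z ∈ c.target) :
    MatLE (b • modelForm ω₀ σ θ γ ε c z) (coneApprox ω₀ σ k γ ε c z) := by
  have := hb.le_reference 0 ⟨le_rfl, hT⟩ ε hε c hc z hz
  rwa [zero_smul, add_zero] at this

theorem isPositive_coneApprox (hb : FlowBounds ω₀ σ θ ν f γ T k b B) (hT : 0 ≤ T)
    (hd : IsDivisorNorm σ θ) (hpos : IsPositive ω₀) (hε : ε ∈ Set.Ioo (0 : ℝ) 1) :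
    IsPositive (coneApprox ω₀ σ k γ ε) := fun c hc z hz =>
  (hb.le_coneApprox hT hε hc hz).posDef
    (posDef_real_smul (hd.modelForm_posDef hpos hε.1 c hc z hz) hb.b_pos)

/-- A lower bound for the normalized volume of a metric whose volume is comparable to that of the
model metric. -/
theorem log_det_ge (hb : FlowBounds ω₀ σ θ ν f γ T k b B) (hd : IsDivisorNorm σ θ)
    (hpos : IsPositive ω₀) (hε : ε ∈ Set.Ioo (0 : ℝ) 1) (hc : c ∈ atlas (Cn n) X)
    (hz : z ∈ c.target) {A : Matrix (Fin n) (Fin n) ℂ} (hA : A.PosDef) {D : ℝ} (hD : 0 < D)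
    (h : (modelForm ω₀ σ θ γ ε c z).det.re ≤ D * A.det.re) :
    Real.log b - Real.log D - B ≤ Real.log A.det.re - Real.log (ω₀ c z).det.re + f (c.symm z) +
      (1 - γ) * Real.log (ε ^ 2 + σ (c.symm z)) := by
  have hσ := hd.nonneg (c.symm z)
  have hW := coneWeight_pos (γ := γ) hε.1 hσ
  have hω := det_re_pos (hpos c hc z hz)
  have hA' := det_re_pos hA
  have h1 := (hb.det_model ε hε c hc z hz).trans h
  have h2 := Real.log_le_log (mul_pos (mul_pos hb.b_pos hW) hω) h1
  rw [Real.log_mul (mul_pos hb.b_pos hW).ne' hω.ne', Real.log_mul hb.b_pos.ne' hW.ne',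
    Real.log_mul hD.ne' hA'.ne', coneWeight, Real.log_rpow (by have := pow_pos hε.1 2; positivity)]
    at h2
  have h3 := (abs_le.1 (hb.abs_density_le (c.symm z))).1
  linarith

end FlowBounds

/-- The parabolic maximum principle. -/
theorem exists_le_of_forall_max [CompactSpace X] {F F' : ℝ → X → ℝ} {t₀ t K : ℝ} (ht : t₀ ≤ t)
    (hcont : ContinuousOn (fun p : ℝ × X => F p.1 p.2) (Set.Icc t₀ t ×ˢ Set.univ))
    (hderiv : ∀ τ ∈ Set.Ioc t₀ t, ∀ x, HasDerivAt (fun s => F s x) (F' τ x) τ)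
    (hmax : ∀ τ ∈ Set.Ioc t₀ t, ∀ x, (∀ y, F τ y ≤ F τ x) → F' τ x ≤ K) (x : X) :
    ∃ x', F t x ≤ F t₀ x' + K * (t - t₀) := by
  have hslice : Continuous (F t₀) := by
    have := hcont.comp (f := fun y : X => (t₀, y)) (s := Set.univ)
      (by fun_prop) fun y _ => ⟨⟨le_rfl, ht⟩, trivial⟩
    exact continuousOn_univ.1 this
  obtain ⟨x', -, hx'⟩ := isCompact_univ.exists_isMaxOn ⟨x, trivial⟩ hslice.continuousOn
  refine ⟨x', ?_⟩
  -- After subtraction of `(K + δ)(τ - t₀)`, the time derivative at a spatial maximum later than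
  -- `t₀` is at most `-δ`. The maximum over space-time therefore occurs at time `t₀`; then `δ → 0`.
  have key : ∀ δ > 0, F t x - (K + δ) * (t - t₀) ≤ F t₀ x' := by
    intro δ hδ
    obtain ⟨⟨t₁, x₁⟩, hp, hpm⟩ := (isCompact_Icc.prod isCompact_univ).exists_isMaxOn
      (s := Set.Icc t₀ t ×ˢ (Set.univ : Set X)) ⟨(t, x), ⟨⟨ht, le_rfl⟩, trivial⟩⟩
      (hcont.sub ((continuous_const (y := K + δ)).mul
        (continuous_fst.sub (continuous_const (y := t₀)))).continuousOn)
    have hle : ∀ τ ∈ Set.Icc t₀ t, ∀ y, F τ y - (K + δ) * (τ - t₀) ≤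
        F t₁ x₁ - (K + δ) * (t₁ - t₀) := fun τ hτ y => hpm (show (τ, y) ∈ _ from ⟨hτ, trivial⟩)
    rcases hp.1.1.eq_or_lt with h0 | h0
    · simp only at h0
      have h1 := hle t ⟨ht, le_rfl⟩ x
      rw [← h0, sub_self, mul_zero, sub_zero] at h1
      exact h1.trans (hx' (Set.mem_univ x₁))
    · exfalso
      have hm1 : t₁ ∈ Set.Ioc t₀ t := ⟨h0, hp.1.2⟩
      have d1 := (hderiv t₁ hm1 x₁).sub (((hasDerivAt_id t₁).sub_const t₀).const_mul (K + δ))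
      have d2 := nonneg_of_hasDerivAt_of_le h0 d1
        fun s hs => hle s ⟨hs.1, hs.2.trans hp.1.2⟩ x₁
      have d3 := hmax t₁ hm1 x₁ fun y => by
        have := hle t₁ ⟨h0.le, hp.1.2⟩ y
        linarith
      linarith
  refine le_of_forall_pos_le_add fun e he => ?_
  have h1 := key (e / (t - t₀ + 1)) (div_pos he (by linarith))
  have h2 : e / (t - t₀ + 1) * (t - t₀) ≤ e := by
    rw [div_mul_eq_mul_div, div_le_iff₀ (by linarith)]
    nlinarith
  nlinarith

/-! ### Linear bounds for the growth and the decay of the potential. -/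

namespace ConicalFlow

variable [IsManifold 𝓘(ℂ, Cn n) ω X] {ω₀ : Coeff n X} {σ : X → ℝ} {θ η : Coeff n X} {f : X → ℝ}
  {γ ε T k b B : ℝ} {ψ : X → ℝ} {φ : ℝ → X → ℝ} {t t₀ : ℝ}

theorem continuousOn_potential (h : ConicalFlow ω₀ σ θ η f γ ε T ψ φ) (ht₀ : 0 < t₀) (ht : t < T) :
    ContinuousOn (fun p : ℝ × X => φ p.1 p.2) (Set.Icc t₀ t ×ˢ Set.univ) :=
  h.flow.smooth.continuousOn.mono
    (Set.prod_mono (Set.Icc_subset_Icc ht₀.le ht.le) le_rfl)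

theorem continuous_chi (h : ConicalFlow ω₀ σ θ η f γ ε T ψ φ) : Continuous (chi σ γ ε) :=
  (h.norm.chartSmooth_chi h.gamma_mem.1.ne' h.eps_mem.1).continuous

/-- The supremum of the potential grows at most linearly. -/
theorem exists_potential_le [CompactSpace X] (h : ConicalFlow ω₀ σ θ η f γ ε T ψ φ)
    (hb : FlowBounds ω₀ σ θ (nu ω₀ θ η f γ) f γ T k b B) (ht₀ : 0 < t₀) (htt : t₀ ≤ t) (ht : t < T)
    (x : X) : ∃ x', φ t x ≤ φ t₀ x' +
      (Real.log ((B * n) ^ n) + B + Real.log (1 + B)) * (t - t₀) := by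
  refine exists_le_of_forall_max htt (h.continuousOn_potential ht₀ ht)
    (fun τ hτ x => h.hasDerivAt_potential ⟨ht₀.trans hτ.1, hτ.2.trans_lt ht⟩ x) ?_ x
  intro τ hτ x hx
  have hτ' : τ ∈ Set.Ioo 0 T := ⟨ht₀.trans hτ.1, hτ.2.trans_lt ht⟩
  set c := chartAt (Cn n) x
  have hc : c ∈ atlas (Cn n) X := chart_mem_atlas _ x
  have hz : c x ∈ c.target := mem_chart_target _ x
  have hxc : c.symm (c x) = x := c.left_inv (mem_chart_source _ x)
  have hG := h.isPositive_metric hτ' c hc _ hz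
  have hω := h.kahler.pos c hc _ hz
  have hmax : IsLocalMax (fun w => φ τ (c.symm w)) (c x) :=
    Filter.Eventually.of_forall fun w => by simp only [hxc]; exact hx _
  have h1 := posSemidef_neg_complexHessian_of_isLocalMax c.open_target
    (h.chartSmooth_potential hτ' c hc) hz hmax
  -- At a maximum of the potential the metric is at most its reference form, hence at most `Bω₀`.
  -- The term `(1-γ) log(ε²+σ)` is harmless here, being bounded above.
  have h2 : MatLE (flowMetric ω₀ θ η f γ φ τ c (c x))
      (ω₀ c (c x) + τ • nu ω₀ θ η f γ c (c x)) := by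
    rw [MatLE]
    convert h1 using 1
    change ω₀ c (c x) + τ • nu ω₀ θ η f γ c (c x) - (ω₀ c (c x) + τ • nu ω₀ θ η f γ c (c x) +
      complexHessian (fun w => φ τ (c.symm w)) (c x)) = _
    abel
  have h3 := det_le_of_le hG hω
    (h2.trans (hb.reference_le τ ⟨hτ'.1.le, hτ'.2.le⟩ c hc _ hz))
  rw [Fintype.card_fin] at h3
  have hp : 0 < (B * n) ^ n := by
    rcases Nat.eq_zero_or_pos n with h0 | h0
    · rw [h0, pow_zero]; exact one_pos
    · have := hb.B_pos
      have : (0 : ℝ) < n := Nat.cast_pos.2 h0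
      positivity
  have h4 := Real.log_le_log (det_re_pos hG) h3
  rw [Real.log_mul hp.ne' (det_re_pos hω).ne'] at h4
  have h5 := h.speed_eq hc hτ' hz
  rw [hxc] at h5
  rw [h5]
  have h6 := (abs_le.1 (hb.abs_density_le x)).2
  have h7 : (1 - γ) * Real.log (ε ^ 2 + σ x) ≤ Real.log (1 + B) := by
    have hσ := h.norm.nonneg x
    have hε := h.eps_mem
    have l1 : Real.log (ε ^ 2 + σ x) ≤ Real.log (1 + B) :=
      Real.log_le_log (by have := pow_pos hε.1 2; positivity)
        (by nlinarith [hb.norm_le x, hε.1, hε.2])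
    have l2 : 0 ≤ Real.log (1 + B) := Real.log_nonneg (by linarith [hb.B_pos])
    have g := h.gamma_mem
    nlinarith [g.1, g.2]
  linarith

/-- The infimum of the modified potential decreases at most linearly. -/
theorem exists_potential_ge [CompactSpace X] (hn : 0 < n) (h : ConicalFlow ω₀ σ θ η f γ ε T ψ φ)
    (hb : FlowBounds ω₀ σ θ (nu ω₀ θ η f γ) f γ T k b B) (ht₀ : 0 < t₀) (htt : t₀ ≤ t) (ht : t < T)
    (x : X) : ∃ x', -(φ t x - k * chi σ γ ε x) ≤ -(φ t₀ x' - k * chi σ γ ε x') +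
      (-(Real.log b - Real.log ((b⁻¹ * n) ^ n) - B)) * (t - t₀) := by
  refine exists_le_of_forall_max (F := fun t x => -(φ t x - k * chi σ γ ε x))
    (F' := fun t x => -flowSpeed ω₀ σ θ η f γ ε φ t x) htt
    ((h.continuousOn_potential ht₀ ht).sub
      ((continuous_const.mul (h.continuous_chi.comp continuous_snd)).continuousOn)).neg
    (fun τ hτ x => ((h.hasDerivAt_potential ⟨ht₀.trans hτ.1, hτ.2.trans_lt ht⟩ x).sub_const _).neg)
    ?_ x
  intro τ hτ x hx
  have hτ' : τ ∈ Set.Ioo 0 T := ⟨ht₀.trans hτ.1, hτ.2.trans_lt ht⟩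
  have hε := h.eps_mem
  set c := chartAt (Cn n) x
  have hc : c ∈ atlas (Cn n) X := chart_mem_atlas _ x
  have hz : c x ∈ c.target := mem_chart_target _ x
  have hxc : c.symm (c x) = x := c.left_inv (mem_chart_source _ x)
  have hG := h.isPositive_metric hτ' c hc _ hz
  have hmodel := h.norm.modelForm_posDef (γ := γ) h.kahler.pos hε.1 c hc _ hz
  have hmax : IsLocalMax (fun w => -(φ τ (c.symm w) - k * chi σ γ ε (c.symm w))) (c x) :=
    Filter.Eventually.of_forall fun w => by simp only [hxc]; exact hx _
  have s1 := h.chartSmooth_potential hτ' c hc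
  have s2 := h.norm.chartSmooth_chi h.gamma_mem.1.ne' hε.1 c hc
  have s3 : ContDiffOn ℝ ∞ (fun w => k * chi σ γ ε (c.symm w)) c.target := s2.const_smul k
  have hU := c.open_target
  have h1 := posSemidef_neg_complexHessian_of_isLocalMax hU (s1.sub s3).neg hz hmax
  have h1' : complexHessian (fun w => -(φ τ (c.symm w) - k * chi σ γ ε (c.symm w))) (c x) =
      -(ddbar (φ τ) c (c x) - k • ddbar (chi σ γ ε) c (c x)) := by
    have e := complexHessian_neg hU (s1.sub s3) hz
    rw [complexHessian_sub hU s1 s3 hz, complexHessian_const_mul hU s2 k hz] at e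
    exact e
  rw [h1', neg_neg] at h1
  -- At a minimum of `φ - kχ` the metric dominates `ω₀ + τν + k√-1∂∂̄χ ≥ b g_ε`. The volume of the
  -- model compensates `(1-γ) log(ε²+σ)`, which is not bounded below uniformly in `ε`; this is why
  -- `kχ` is subtracted.
  have h2 : MatLE (ω₀ c (c x) + τ • nu ω₀ θ η f γ c (c x) + k • ddbar (chi σ γ ε) c (c x))
      (flowMetric ω₀ θ η f γ φ τ c (c x)) := by
    rw [MatLE]
    convert h1 using 1
    change (ω₀ c (c x) + τ • nu ω₀ θ η f γ c (c x) + ddbar (φ τ) c (c x)) - _ = _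
    abel
  have h3 := ((hb.le_reference τ ⟨hτ'.1.le, hτ'.2.le⟩ ε hε c hc _ hz).trans h2).smul
    (inv_pos.2 hb.b_pos).le
  rw [smul_smul, inv_mul_cancel₀ hb.b_pos.ne', one_smul] at h3
  have h4 := det_le_of_le hmodel hG h3
  rw [Fintype.card_fin] at h4
  have hn' : (0 : ℝ) < n := Nat.cast_pos.2 hn
  have hbp := hb.b_pos
  have h5 := hb.log_det_ge h.norm h.kahler.pos hε hc hz hG (by positivity) h4
  have h6 := h.speed_eq hc hτ' hz
  rw [← h6, hxc] at h5
  linarith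

end ConicalFlow

end ConicalKRF

namespace ConicalKRF

open Matrix

/-- A number which is bounded by its logarithm is bounded. -/
theorem exists_bound_of_le_log {a : ℝ} (ha : 0 < a) (e : ℝ) :
    ∃ Y : ℝ, 1 ≤ Y ∧ ∀ y, 0 < y → y ≤ a * Real.log y + e → y ≤ Y := by
  -- From `log(y/(2a)) ≤ y/(2a)` one gets `a log y ≤ y/2 + a log(2a)`, and `y/2` is absorbed.
  refine ⟨max 1 (2 * (a * Real.log (2 * a) + e)), le_max_left _ _, fun y hy h => ?_⟩
  refine le_max_of_le_right ?_
  have h1 : Real.log y = Real.log (y / (2 * a)) + Real.log (2 * a) := by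
    rw [← Real.log_mul (by positivity) (by positivity), div_mul_cancel₀ _ (by positivity)]
  have h2 : Real.log (y / (2 * a)) ≤ y / (2 * a) := by
    linarith [Real.log_le_sub_one_of_pos (show 0 < y / (2 * a) by positivity)]
  have h3 : a * (y / (2 * a)) = y / 2 := by field_simp
  nlinarith

/-! ### Comparison of tests at a point, and interior maxima. -/

variable {n : ℕ} {X : Type*} [TopologicalSpace X] [ChartedSpace (Cn n) X]

/-- The trace of `IsAdmissible.upper`, valid throughout the closed ball of every admissible test.
Its counterpart `le_log_value` holds for the particular test that the family provides at a given
point. -/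
theorem LocalTest.log_value_le {S : LocalTest n X} {ω₀ : Coeff n X} {σ : X → ℝ} {θ η : Coeff n X}
    {γ C ε : ℝ} (hS : S.IsAdmissible ω₀ σ θ η γ C) (hε : ε ∈ Set.Ioo (0 : ℝ) 1) (hC : 0 < C)
    {G : Matrix (Fin n) (Fin n) ℂ} (hG : G.PosDef) {w : Cn n}
    (hw : w ∈ Metric.closedBall S.center S.radius)
    (hy : 0 < (G⁻¹ * modelForm ω₀ σ θ γ ε S.chart w).trace.re) :
    S.weight ε w + Real.log (formNormSq G (S.covector w)) ≤
      Real.log C + Real.log (G⁻¹ * modelForm ω₀ σ θ γ ε S.chart w).trace.re := by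
  have hu := formNormSq_pos hG (hS.ne_zero w (hS.subset_domain hw))
  have h1 := (hS.upper ε hε w hw).trace_le hG.inv.posSemidef
  rw [trace_mul_real_smul, trace_mul_real_smul, ← formNormSq_eq_trace] at h1
  have h2 := Real.log_le_log (mul_pos (Real.exp_pos _) hu) h1
  rwa [Real.log_mul (Real.exp_pos _).ne' hu.ne', Real.log_exp, Real.log_mul hC.ne' hy.ne'] at h2

theorem LocalTest.le_log_value {S : LocalTest n X} {ω₀ : Coeff n X} {σ : X → ℝ} {θ η : Coeff n X}
    {γ C ε y : ℝ} (hS : S.IsAdmissible ω₀ σ θ η γ C) (hC : 0 < C)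
    {G : Matrix (Fin n) (Fin n) ℂ} (hG : G.PosDef) {w : Cn n}
    (hw : w ∈ Metric.closedBall S.center S.radius) (hy : 0 < y)
    (h : y ≤ C * S.value ε G w) :
    Real.log y - Real.log C ≤ S.weight ε w + Real.log (formNormSq G (S.covector w)) := by
  have hu := formNormSq_pos hG (hS.ne_zero w (hS.subset_domain hw))
  have h2 := Real.log_le_log hy h
  rw [LocalTest.value, Real.log_mul hC.ne' (mul_pos (Real.exp_pos _) hu).ne',
    Real.log_mul (Real.exp_pos _).ne' hu.ne', Real.log_exp] at h2
  linarith

theorem LocalTest.cutoff_le_quarter {S : LocalTest n X} (hr : 0 < S.radius) {w : Cn n}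
    (hw : w ∈ Metric.ball S.center (S.radius / 2)) : S.cutoff w ≤ 1 / 4 := by
  rw [Metric.mem_ball, dist_eq_norm] at hw
  rw [LocalTest.cutoff, div_le_iff₀ (by positivity)]
  nlinarith [norm_nonneg (w - S.center)]

theorem LocalTest.cutoff_nonneg (S : LocalTest n X) (w : Cn n) : 0 ≤ S.cutoff w := by
  rw [LocalTest.cutoff]; positivity

theorem LocalTest.cutoff_eq_one {S : LocalTest n X} (hr : 0 < S.radius) {w : Cn n}
    (hw : w ∈ Metric.closedBall S.center S.radius) (hw' : w ∉ Metric.ball S.center S.radius) :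
    S.cutoff w = 1 := by
  rw [Metric.mem_closedBall, dist_eq_norm] at hw
  rw [Metric.mem_ball, dist_eq_norm, not_lt] at hw'
  rw [LocalTest.cutoff, le_antisymm hw hw', div_self (by positivity)]

namespace ConicalFlow

variable [IsManifold 𝓘(ℂ, Cn n) ω X] {ω₀ : Coeff n X} {σ : X → ℝ} {θ η : Coeff n X} {f : X → ℝ}
  {γ ε T k b B : ℝ} {ψ : X → ℝ} {φ : ℝ → X → ℝ} {t t₀ T' m A C : ℝ}

/-- The trace of the model metric with respect to the evolving metric. -/
def modelTrace (ω₀ : Coeff n X) (σ : X → ℝ) (θ η : Coeff n X) (f : X → ℝ) (γ ε : ℝ)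
    (φ : ℝ → X → ℝ) (t : ℝ) (x : X) : ℝ :=
  traceForm (flowMetric ω₀ θ η f γ φ t) (modelForm ω₀ σ θ γ ε) x

theorem modelTrace_eq (h : ConicalFlow ω₀ σ θ η f γ ε T ψ φ) (ht : t ∈ Set.Ioo 0 T)
    {c : OpenPartialHomeomorph X (Cn n)} (hc : c ∈ atlas (Cn n) X) {z : Cn n} (hz : z ∈ c.target) :
    ((flowMetric ω₀ θ η f γ φ t c z)⁻¹ * modelForm ω₀ σ θ γ ε c z).trace.re =
      modelTrace ω₀ σ θ η f γ ε φ t (c.symm z) := by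
  rw [modelTrace, traceForm_eq (h.isForm_metric ht) (h.isPositive_metric ht)
    (h.norm.isForm_modelForm h.kahler.isForm h.eps_mem.1) hc (c.map_target hz), c.right_inv hz]

theorem modelTrace_pos (hn : 0 < n) (h : ConicalFlow ω₀ σ θ η f γ ε T ψ φ)
    (ht : t ∈ Set.Ioo 0 T) (x : X) : 0 < modelTrace ω₀ σ θ η f γ ε φ t x := by
  have : Nonempty (Fin n) := ⟨⟨0, hn⟩⟩
  exact trace_inv_mul_pos (h.isPositive_metric ht _ (chart_mem_atlas _ x) _ (mem_chart_target _ x))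
    (h.norm.modelForm_posDef h.kahler.pos h.eps_mem.1 _ (chart_mem_atlas _ x) _
      (mem_chart_target _ x))

/-- The test quantities attain their maximum in the interior of a coordinate ball. -/
theorem exists_max_testQuantity [Nonempty X] (hn : 0 < n)
    (h : ConicalFlow ω₀ σ θ η f γ ε T ψ φ) {𝒯 : Set (LocalTest n X)} (hfin : 𝒯.Finite)
    (hC : 0 < C) (hadm : ∀ S ∈ 𝒯, S.IsAdmissible ω₀ σ θ η γ C)
    (htest : ∀ x : X, ∀ G : Coeff n X, IsPositive G → ∃ S ∈ 𝒯,
      x ∈ S.chart.source ∧ S.chart x ∈ Metric.ball S.center (S.radius / 2) ∧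
      ((G S.chart (S.chart x))⁻¹ * modelForm ω₀ σ θ γ ε S.chart (S.chart x)).trace.re ≤
        C * S.value ε (G S.chart (S.chart x)) (S.chart x))
    (hm : 0 ≤ m) (ht₀ : 0 < t₀) (htT : t₀ ≤ T') (hT : T' < T) :
    ∃ S ∈ 𝒯, ∃ t₁ ∈ Set.Icc t₀ T', ∃ z₁ ∈ Metric.ball S.center S.radius, ∀ S' ∈ 𝒯,
      ∀ t ∈ Set.Icc t₀ T', ∀ z ∈ Metric.closedBall S'.center S'.radius,
        testQuantity ω₀ σ θ η f γ ε φ S' t₀ m (4 * |Real.log C|) A k (t, z) ≤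
          testQuantity ω₀ σ θ η f γ ε φ S t₀ m (4 * |Real.log C|) A k (t₁, z₁) := by
  set N := 4 * |Real.log C| with hN
  have hN0 : 0 ≤ N := by positivity
  have hIcc : ∀ t ∈ Set.Icc t₀ T', t ∈ Set.Ioo 0 T := fun t ht =>
    ⟨ht₀.trans_le ht.1, ht.2.trans_lt hT⟩
  have hmax : ∀ S ∈ 𝒯, ∃ p ∈ Set.Icc t₀ T' ×ˢ Metric.closedBall S.center S.radius,
      ∀ q ∈ Set.Icc t₀ T' ×ˢ Metric.closedBall S.center S.radius,
        testQuantity ω₀ σ θ η f γ ε φ S t₀ m N A k q ≤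
          testQuantity ω₀ σ θ η f γ ε φ S t₀ m N A k p := by
    intro S hS
    have hSa := hadm S hS
    obtain ⟨p, hp, hpm⟩ := (isCompact_Icc.prod (isCompact_closedBall S.center S.radius)).exists_isMaxOn
      (s := Set.Icc t₀ T' ×ˢ Metric.closedBall S.center S.radius)
      ⟨(t₀, S.center), ⟨⟨le_rfl, htT⟩, Metric.mem_closedBall_self hSa.radius_pos.le⟩⟩
      ((h.continuousOn_testQuantity (t₀ := t₀) (m := m) (N := N) (A := A) (k := k) hSa).mono
        (Set.prod_mono (fun t ht => hIcc t ht) hSa.subset_domain))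
    exact ⟨p, hp, fun q hq => hpm hq⟩
  choose! p hp hpm using hmax
  have hne : 𝒯.Nonempty := by
    obtain ⟨x⟩ := ‹Nonempty X›
    obtain ⟨S, hS, -⟩ := htest x ω₀ h.kahler.pos
    exact ⟨S, hS⟩
  obtain ⟨S₀, hS₀, hS₀m⟩ := Set.exists_max_image 𝒯
    (fun S => testQuantity ω₀ σ θ η f γ ε φ S t₀ m N A k (p S)) hfin hne
  have hall : ∀ S' ∈ 𝒯, ∀ t ∈ Set.Icc t₀ T', ∀ z ∈ Metric.closedBall S'.center S'.radius,
      testQuantity ω₀ σ θ η f γ ε φ S' t₀ m N A k (t, z) ≤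
        testQuantity ω₀ σ θ η f γ ε φ S₀ t₀ m N A k (p S₀) := fun S' hS' t ht z hz =>
    (hpm S' hS' (t, z) ⟨ht, hz⟩).trans (hS₀m S' hS')
  have hp₀ := hp S₀ hS₀
  generalize p S₀ = q at hp₀ hall
  obtain ⟨t₁, z₁⟩ := q
  have ht₁ : t₁ ∈ Set.Icc t₀ T' := hp₀.1
  have hz₁ : z₁ ∈ Metric.closedBall S₀.center S₀.radius := hp₀.2
  have hS₀a := hadm S₀ hS₀
  by_cases hin : z₁ ∈ Metric.ball S₀.center S₀.radius
  · exact ⟨S₀, hS₀, t₁, ht₁, z₁, hin, hall⟩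
  -- The maximum of `S₀` lies on the boundary of its ball. It is replaced by the test `S` given by
  -- the family at the same point of `X`, which lies in the half ball of `S`.
  · have htI := hIcc t₁ ht₁
    have hz₁c : z₁ ∈ S₀.chart.target := hS₀a.domain_subset (hS₀a.subset_domain hz₁)
    set x := S₀.chart.symm z₁ with hx
    obtain ⟨S, hS, hxS, hball, hval⟩ := htest x _ (h.isPositive_metric htI)
    have hSa := hadm S hS
    have hw : S.chart x ∈ Metric.ball S.center S.radius :=
      Metric.ball_subset_ball (half_le_self hSa.radius_pos.le) hball
    have hwc := Metric.ball_subset_closedBall hw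
    refine ⟨S, hS, t₁, ht₁, S.chart x, hw, fun S' hS' t ht z hz => (hall S' hS' t ht z hz).trans ?_⟩
    have hy := h.modelTrace_pos hn htI x
    have e1 := h.modelTrace_eq htI hS₀a.mem_atlas hz₁c
    have e2 := h.modelTrace_eq htI hSa.mem_atlas (S.chart.map_source hxS)
    rw [S.chart.left_inv hxS] at e2
    have l1 := LocalTest.log_value_le hS₀a h.eps_mem hC
      (h.isPositive_metric htI _ hS₀a.mem_atlas _ hz₁c) hz₁ (by rw [e1]; exact hy)
    rw [e1] at l1
    rw [e2] at hval
    have l2 := LocalTest.le_log_value hSa hC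
      (h.isPositive_metric htI _ hSa.mem_atlas _ (S.chart.map_source hxS)) hwc hy hval
    have d1 := LocalTest.cutoff_eq_one hS₀a.radius_pos hz₁ hin
    have d2 := LocalTest.cutoff_le_quarter hSa.radius_pos hball
    have hlogC := le_abs_self (Real.log C)
    simp only [testQuantity]
    rw [S.chart.left_inv hxS, ← hx, d1]
    -- The logarithms of the two tests differ by at most `2 log C`, while the cutoff terms differ by
    -- at least `(3/4)N = 3|log C|`; hence the choice of `N`.
    have hN4 : N * S.cutoff (S.chart x) ≤ N * (1 / 4) := mul_le_mul_of_nonneg_left d2 hN0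
    have hcmp : S₀.weight ε z₁ + Real.log (formNormSq (flowMetric ω₀ θ η f γ φ t₁ S₀.chart z₁)
        (S₀.covector z₁)) - N * 1 ≤ S.weight ε (S.chart x) +
        Real.log (formNormSq (flowMetric ω₀ θ η f γ φ t₁ S.chart (S.chart x))
          (S.covector (S.chart x))) - N * S.cutoff (S.chart x) := by
      linarith
    have := mul_le_mul_of_nonneg_left (mul_le_mul_of_nonneg_left hcmp hm) (sub_nonneg.2 ht₁.1)
    nlinarith

end ConicalFlow

end ConicalKRF

namespace ConicalKRF

open Matrix

/-! ### The trace estimate for the approximate flows. -/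

variable {n : ℕ} {X : Type*} [TopologicalSpace X] [ChartedSpace (Cn n) X]

namespace ConicalFlow

variable [IsManifold 𝓘(ℂ, Cn n) ω X] {ω₀ : Coeff n X} {σ : X → ℝ} {θ η : Coeff n X} {f : X → ℝ}
  {γ ε T k b B : ℝ} {ψ : X → ℝ} {φ : ℝ → X → ℝ} {t t₀ T' C : ℝ}

/-- The volume of the model is at most `yⁿ` times that of the evolving metric, and the model volume
compensates the term `(1-γ) log(ε²+σ)` in the speed. -/
theorem neg_log_le_speed (hn : 0 < n) (h : ConicalFlow ω₀ σ θ η f γ ε T ψ φ)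
    (hb : FlowBounds ω₀ σ θ (nu ω₀ θ η f γ) f γ T k b B) (ht : t ∈ Set.Ioo 0 T) (x : X) :
    Real.log b - n * Real.log (modelTrace ω₀ σ θ η f γ ε φ t x) - B ≤
      flowSpeed ω₀ σ θ η f γ ε φ t x := by
  set c := chartAt (Cn n) x
  have hc : c ∈ atlas (Cn n) X := chart_mem_atlas _ x
  have hz : c x ∈ c.target := mem_chart_target _ x
  have hxc : c.symm (c x) = x := c.left_inv (mem_chart_source _ x)
  have hG := h.isPositive_metric ht c hc _ hz
  have hy := h.modelTrace_pos hn ht x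
  have h1 := det_le_trace_pow hG (h.norm.modelForm_posDef (γ := γ) h.kahler.pos h.eps_mem.1 c hc _ hz)
  rw [h.modelTrace_eq ht hc hz, hxc, Fintype.card_fin, mul_comm] at h1
  have h2 := hb.log_det_ge h.norm h.kahler.pos h.eps_mem hc hz hG (by positivity) h1
  rw [← h.speed_eq hc ht hz, hxc, Real.log_pow] at h2
  exact h2

/-- The weight of the potential in the test quantity. -/
def potentialWeight (n : ℕ) (T b B C : ℝ) : ℝ :=
  1 + (T * (B + ((n - 1 : ℕ) : ℝ) * (C + 4 * |Real.log C| * C)) + 1) / b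

theorem one_lt_potentialWeight (hT : 0 < T) (hb : 0 < b) (hB : 0 < B) (hC : 0 < C) :
    1 < potentialWeight n T b B C := by
  rw [potentialWeight]
  have : 0 ≤ ((n - 1 : ℕ) : ℝ) * (C + 4 * |Real.log C| * C) := by positivity
  have : 0 < (T * (B + ((n - 1 : ℕ) : ℝ) * (C + 4 * |Real.log C| * C)) + 1) / b := by positivity
  linarith

set_option maxHeartbeats 1000000 in
/-- The bound for the test quantity at an interior maximum. -/
theorem exists_testQuantity_le (hn : 0 < n) (hT : 0 < T) (hb0 : 0 < b) (hB0 : 0 < B) (hC : 0 < C) :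
    ∃ K : ℝ, 0 ≤ K ∧ ∀ (ε k : ℝ) (ψ : X → ℝ) (φ : ℝ → X → ℝ) (S : LocalTest n X) (t₀ t : ℝ)
      (z : Cn n), ConicalFlow ω₀ σ θ η f γ ε T ψ φ →
      FlowBounds ω₀ σ θ (nu ω₀ θ η f γ) f γ T k b B → S.IsAdmissible ω₀ σ θ η γ C →
      0 < t₀ → t₀ < t → t < T → z ∈ Metric.ball S.center S.radius →
      (∀ τ ∈ Set.Icc t₀ t, testQuantity ω₀ σ θ η f γ ε φ S t₀ ((n - 1 : ℕ) : ℝ) (4 * |Real.log C|)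
        (potentialWeight n T b B C) k (τ, z) ≤ testQuantity ω₀ σ θ η f γ ε φ S t₀
          ((n - 1 : ℕ) : ℝ) (4 * |Real.log C|) (potentialWeight n T b B C) k (t, z)) →
      IsLocalMax (fun w => testQuantity ω₀ σ θ η f γ ε φ S t₀ ((n - 1 : ℕ) : ℝ) (4 * |Real.log C|)
        (potentialWeight n T b B C) k (t, w)) z →
      testQuantity ω₀ σ θ η f γ ε φ S t₀ ((n - 1 : ℕ) : ℝ) (4 * |Real.log C|)
        (potentialWeight n T b B C) k (t, z) ≤
          K - potentialWeight n T b B C * (φ t (S.chart.symm z) - k * chi σ γ ε (S.chart.symm z)) := by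
  set m : ℝ := ((n - 1 : ℕ) : ℝ) with hm
  set N := 4 * |Real.log C| with hN
  set A := potentialWeight n T b B C with hA
  have hm0 : 0 ≤ m := Nat.cast_nonneg _
  have hN0 : 0 ≤ N := by positivity
  have hn0 : (0 : ℝ) < n := Nat.cast_pos.2 hn
  have hA1 : 1 < A := one_lt_potentialWeight hT hb0 hB0 hC
  -- `A` is chosen so that `-A b y` absorbs all terms linear in `y` produced by the evolution and
  -- still leaves at least `-y`.
  have hAb : A * b = b + T * (B + m * (C + N * C)) + 1 := by
    rw [hA, potentialWeight, ← hm, ← hN, add_mul, one_mul, div_mul_cancel₀ _ hb0.ne', add_assoc]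
  -- The two arguments are what results from combining `q3` below with the lower bound `hlow` for
  -- the speed.
  obtain ⟨Y, hY1, hY⟩ := exists_bound_of_le_log (a := m + (A - 1) * n)
    (by have := mul_pos (sub_pos.2 hA1) hn0; linarith)
    (m * Real.log C + A * n - (A - 1) * (Real.log b - B))
  have hlogY : 0 ≤ Real.log Y := Real.log_nonneg hY1
  set V₁ := (m * (Real.log C + Real.log Y) + A * n) / (A - 1) with hV₁
  refine ⟨T * |V₁ + m * (Real.log C + Real.log Y)|, by positivity, ?_⟩
  intro ε k ψ φ S t₀ t z h hb hS ht₀ htt htT hz hmt hmx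
  have ht : t ∈ Set.Ioo 0 T := ⟨ht₀.trans htt, htT⟩
  have est := h.evolution_estimate hS hm0 hN0 ht₀ htt htT hz hmt hmx
  have hzb := Metric.ball_subset_closedBall hz
  have hzc : z ∈ S.chart.target := hS.domain_subset (hS.subset_domain hzb)
  have hc := hS.mem_atlas
  have hG := h.isPositive_metric ht S.chart hc z hzc
  have hP := hG.inv.posSemidef
  have hy := h.modelTrace_pos hn ht (S.chart.symm z)
  have hye := h.modelTrace_eq ht hc hzc
  have hlow := h.neg_log_le_speed hn hb ht (S.chart.symm z)
  have hlog := LocalTest.log_value_le hS h.eps_mem hC hG hzb (by rw [hye]; exact hy)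
  have k1 := (hb.nu_le S.chart hc z hzc).trace_le hP
  have k2 := (hb.le_reference t ⟨ht.1.le, ht.2.le⟩ ε h.eps_mem S.chart hc z hzc).trace_le hP
  have k3 := (h.norm.le_modelForm (γ := γ) ω₀ h.eps_mem.1 hc hzc).trace_le hP
  rw [hye] at hlog k3
  rw [trace_mul_real_smul] at k1
  rw [trace_mul_real_smul, hye] at k2
  have hd0 := mul_nonneg hN0 (S.cutoff_nonneg z)
  simp only [testQuantity]
  set x := S.chart.symm z
  set V := flowSpeed ω₀ σ θ η f γ ε φ t x
  set y := modelTrace ω₀ σ θ η f γ ε φ t x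
  set G := flowMetric ω₀ θ η f γ φ t S.chart z
  set U := S.weight ε z + Real.log (formNormSq G (S.covector z)) - N * S.cutoff z
  have hU : U ≤ Real.log C + Real.log y := by linarith
  set y₀ := (G⁻¹ * ω₀ S.chart z).trace.re
  have hmU : m * U ≤ m * (Real.log C + Real.log y) := mul_le_mul_of_nonneg_left hU hm0
  have q1 : (t - t₀) * ((G⁻¹ * nu ω₀ θ η f γ S.chart z).trace.re + m * ((C + N * C) * y₀)) ≤
      T * (B + m * (C + N * C)) * y := by
    have hCN : 0 ≤ m * (C + N * C) := by positivity
    have r1 : (G⁻¹ * nu ω₀ θ η f γ S.chart z).trace.re + m * ((C + N * C) * y₀) ≤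
        (B + m * (C + N * C)) * y := by
      have := mul_le_mul_of_nonneg_left k3 hCN
      have := mul_le_mul_of_nonneg_left k3 hB0.le
      linarith
    have r2 : 0 ≤ (B + m * (C + N * C)) * y := by positivity
    calc _ ≤ (t - t₀) * ((B + m * (C + N * C)) * y) :=
          mul_le_mul_of_nonneg_left r1 (sub_nonneg.2 htt.le)
      _ ≤ T * ((B + m * (C + N * C)) * y) :=
          mul_le_mul_of_nonneg_right (by linarith) r2
      _ = _ := by ring
  have q2 : A * (n - (G⁻¹ * (ω₀ S.chart z + t • nu ω₀ θ η f γ S.chart z +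
      k • ddbar (chi σ γ ε) S.chart z)).trace.re) ≤ A * n - A * b * y := by
    have := mul_le_mul_of_nonneg_left k2 (by linarith : 0 ≤ A)
    linarith
  -- The coefficient `A - 1` arises from `-A φ̇` and from differentiating the factor `t - t₀`.
  have q3 : (A - 1) * V ≤ m * (Real.log C + Real.log y) + A * n - y := by
    rw [hAb] at q2
    linarith [mul_pos hb0 hy]
  -- The lower bound for `V` makes `q3` an upper bound of `y` by a multiple of `log y`. With `y`
  -- bounded, `q3` also bounds `V` from above.
  have q4 : y ≤ Y := by
    refine hY y hy ?_
    have := mul_le_mul_of_nonneg_left hlow (by linarith : 0 ≤ A - 1)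
    linarith
  have hly : Real.log y ≤ Real.log Y := Real.log_le_log hy q4
  have hmy : m * Real.log y ≤ m * Real.log Y := mul_le_mul_of_nonneg_left hly hm0
  have q5 : V ≤ V₁ := by
    rw [hV₁, le_div_iff₀ (by linarith)]
    linarith
  have q6 : (t - t₀) * (V + m * U) ≤ T * |V₁ + m * (Real.log C + Real.log Y)| := by
    have r1 : V + m * U ≤ |V₁ + m * (Real.log C + Real.log Y)| :=
      le_trans (by linarith) (le_abs_self _)
    calc _ ≤ (t - t₀) * |V₁ + m * (Real.log C + Real.log Y)| :=
          mul_le_mul_of_nonneg_left r1 (sub_nonneg.2 htt.le)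
      _ ≤ _ := mul_le_mul_of_nonneg_right (by linarith) (abs_nonneg _)
  linarith

theorem sub_le_osc [CompactSpace X] {u : X → ℝ} (hu : Continuous u) (x y : X) :
    u x - u y ≤ osc u := by
  have h1 := (isCompact_range hu).bddAbove
  have h2 := (isCompact_range hu).bddBelow
  exact sub_le_sub (le_ciSup h1 x) (ciInf_le h2 y)

theorem continuous_potential (h : ConicalFlow ω₀ σ θ η f γ ε T ψ φ) (ht : t ∈ Set.Ioo 0 T) :
    Continuous (φ t) := (h.chartSmooth_potential ht).continuous

set_option maxHeartbeats 1000000 in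
/-- The trace estimate for the approximate flows, uniform in `ε`. -/
theorem exists_trace_estimate [CompactSpace X] (hn : 0 < n) (hT : 0 < T)
    (hb : FlowBounds ω₀ σ θ (nu ω₀ θ η f γ) f γ T k b B)
    (hK : IsKahler ω₀) (hd : IsDivisorNorm σ θ) (hη : IsForm η) (hγ : γ ∈ Set.Ioo (0 : ℝ) 1) :
    ∃ C₁ C₂ : ℝ, ∀ (ε : ℝ) (ψ : X → ℝ) (φ : ℝ → X → ℝ), ConicalFlow ω₀ σ θ η f γ ε T ψ φ →
      ∀ t₀ t, 0 < t₀ → t₀ < t → t < T → ∀ x,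
        (t - t₀) * Real.log (traceForm (coneApprox ω₀ σ k γ ε) (flowMetric ω₀ θ η f γ φ t) x) ≤
          C₁ * osc (fun y => φ t₀ y - k * chi σ γ ε y) + C₂ := by
  obtain ⟨𝒯, hfin, C, hC, hadm, htest⟩ := hasTests_univ hn hd hK.isForm hK.pos hη hγ
  obtain ⟨K, hK0, hKb⟩ := exists_testQuantity_le (ω₀ := ω₀) (σ := σ) (θ := θ) (η := η) (f := f)
    (γ := γ) hn hT hb.b_pos hb.B_pos hC
  have hn0 : (0 : ℝ) < n := Nat.cast_pos.2 hn
  set m : ℝ := ((n - 1 : ℕ) : ℝ) with hm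
  set N := 4 * |Real.log C| with hN
  set A := potentialWeight n T b B C with hA
  have hm0 : 0 ≤ m := Nat.cast_nonneg _
  have hN0 : 0 ≤ N := by positivity
  have hA1 : 1 < A := one_lt_potentialWeight hT hb.b_pos hb.B_pos hC
  set K₁ := |Real.log ((B * n) ^ n) + B + Real.log (1 + B)| with hK₁
  set K₂ := |(-(Real.log b - Real.log ((b⁻¹ * n) ^ n) - B))| with hK₂
  set K₃ := -(Real.log b - Real.log ((b⁻¹ * n) ^ n) - B) with hK₃
  set K₄ := |Real.log n + K₃ + m * Real.log B + m * (Real.log C + N)| with hK₄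
  have hbp := hb.b_pos
  have hBp := hb.B_pos
  -- The coefficient of the oscillation is the weight `A` of the potential. In the second constant,
  -- `K₄` comes from converting the trace, `K` from the maximum of the test quantity, `K₁` and `kB`
  -- from the growth of `φ`, and `K₂` from the decay of `φ - kχ`.
  refine ⟨A, T * K₄ + K + A * (K₁ * T + k * B) + A * (K₂ * T), ?_⟩
  intro ε ψ φ h t₀ t ht₀ htt htT x
  have : Nonempty X := ⟨x⟩
  have ht : t ∈ Set.Ioo 0 T := ⟨ht₀.trans htt, htT⟩
  have htI₀ : t₀ ∈ Set.Ioo 0 T := ⟨ht₀, htt.trans htT⟩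
  have hε := h.eps_mem
  obtain ⟨S, hS, t₁, ht₁, z₁, hz₁, hmax⟩ := h.exists_max_testQuantity (m := m) (A := A) (k := k) hn
    hfin hC hadm (fun x G hG => htest x trivial ε hε G hG) hm0 ht₀ htt.le htT
  rw [← hN] at hmax
  have ht₁T : t₁ < T := ht₁.2.trans_lt htT
  set u : X → ℝ := fun y => φ t₀ y - k * chi σ γ ε y with hu
  have huc : Continuous u := (h.continuous_potential htI₀).sub (continuous_const.mul h.continuous_chi)
  -- the maximum of the test quantity
  have hmaxle : testQuantity ω₀ σ θ η f γ ε φ S t₀ m N A k (t₁, z₁) ≤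
      K - A * (φ t₁ (S.chart.symm z₁) - k * chi σ γ ε (S.chart.symm z₁)) := by
    -- At the initial time the factor `t - t₀` kills everything except the potential; later the
    -- interior bound applies.
    rcases ht₁.1.eq_or_lt with h0 | h0
    · subst h0
      simp only [testQuantity, sub_self, zero_mul, zero_sub]
      linarith
    · refine hKb ε k ψ φ S t₀ t₁ z₁ h hb (hadm S hS) ht₀ h0 ht₁T hz₁ ?_ ?_
      · exact fun τ hτ => hmax S hS τ ⟨hτ.1, hτ.2.trans ht₁.2⟩ z₁ (Metric.ball_subset_closedBall hz₁)
      · filter_upwards [Metric.isOpen_ball.mem_nhds hz₁] with w hw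
        exact hmax S hS t₁ ht₁ w (Metric.ball_subset_closedBall hw)
  obtain ⟨x', hx'⟩ := h.exists_potential_ge hn hb ht₀ ht₁.1 ht₁T (S.chart.symm z₁)
  obtain ⟨x'', hx''⟩ := h.exists_potential_le hb ht₀ htt.le htT x
  -- the value of a test at the given point
  obtain ⟨S', hS', hxS, hball, hval⟩ := htest x trivial ε hε _ (h.isPositive_metric ht)
  have hSa := hadm S' hS'
  have hc := hSa.mem_atlas
  have hw : S'.chart x ∈ Metric.closedBall S'.center S'.radius :=
    Metric.closedBall_subset_closedBall (half_le_self hSa.radius_pos.le)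
      (Metric.ball_subset_closedBall hball)
  have hzc : S'.chart x ∈ S'.chart.target := S'.chart.map_source hxS
  have hxc := S'.chart.left_inv hxS
  have hG := h.isPositive_metric ht S'.chart hc _ hzc
  have hy := h.modelTrace_pos hn ht x
  have hye := h.modelTrace_eq ht hc hzc
  rw [hxc] at hye
  rw [hye] at hval
  have l2 := LocalTest.le_log_value hSa hC hG hw hy hval
  have d2 := LocalTest.cutoff_le_quarter hSa.radius_pos hball
  have hle := (hmax S' hS' t ⟨htt.le, le_rfl⟩ _ hw).trans hmaxle
  simp only [testQuantity] at hle
  rw [hxc] at hle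
  set V := flowSpeed ω₀ σ θ η f γ ε φ t x with hV
  set y := modelTrace ω₀ σ θ η f γ ε φ t x with hydef
  -- the trace at the given point
  have hgpos := hb.isPositive_coneApprox hT.le hd hK.pos hε
  have hg := hgpos S'.chart hc _ hzc
  have htr := traceForm_eq (hd.isForm_coneApprox hK.isForm hγ.1.ne' hε.1 k) hgpos
    (h.isForm_metric ht) hc hxS
  rw [htr]
  have : Nonempty (Fin n) := ⟨⟨0, hn⟩⟩
  have htrpos := trace_inv_mul_pos hg hG
  have htrle := trace_le_det_mul_trace_pow hg hG
  have hGg := (hb.coneApprox_le ε hε S'.chart hc _ hzc).trace_le hG.inv.posSemidef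
  rw [trace_mul_real_smul, hye] at hGg
  have hGgpos := trace_inv_mul_pos hG hg
  have hdetG := det_re_pos hG
  have hdetg := det_re_pos hg
  have hlogtr := Real.log_le_log htrpos htrle
  rw [Fintype.card_fin, Real.log_mul (by positivity) (by positivity),
    Real.log_mul hn0.ne' (by positivity), Real.log_div hdetG.ne' hdetg.ne', Real.log_pow] at hlogtr
  have hlogGg := Real.log_le_log hGgpos hGg
  rw [Real.log_mul hBp.ne' hy.ne'] at hlogGg
  have hmGg := mul_le_mul_of_nonneg_left hlogGg hm0
  -- Compares the speed with the logarithmic volume ratio of the evolving metric to the cone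
  -- approximation, whose volume is at least a multiple of that of the model.
  have hvol : -K₃ ≤ V - (Real.log (flowMetric ω₀ θ η f γ φ t S'.chart (S'.chart x)).det.re -
      Real.log (coneApprox ω₀ σ k γ ε S'.chart (S'.chart x)).det.re) := by
    have h3 := (hb.le_coneApprox hT.le hε hc hzc).smul (inv_pos.2 hbp).le
    rw [smul_smul, inv_mul_cancel₀ hbp.ne', one_smul] at h3
    have h4 := det_le_of_le (hd.modelForm_posDef hK.pos hε.1 _ hc _ hzc) hg h3
    rw [Fintype.card_fin] at h4
    have h5 := hb.log_det_ge hd hK.pos hε hc hzc hg (by positivity) h4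
    have h6 := h.speed_eq hc ht hzc
    rw [hxc] at h5 h6
    rw [hV, h6, hK₃]
    linarith
  -- The trace is traded for the inverse trace and the volume ratio. The combination `V + (n-1) log
  -- y` is the one which the test quantity controls.
  have r1 : Real.log ((coneApprox ω₀ σ k γ ε S'.chart (S'.chart x))⁻¹ *
      flowMetric ω₀ θ η f γ φ t S'.chart (S'.chart x)).trace.re ≤
      V + m * Real.log y + (Real.log n + K₃ + m * Real.log B) := by
    linarith
  have r2 : V + m * (Real.log y - Real.log C - N) ≤ V + m * (S'.weight ε (S'.chart x) +
      Real.log (formNormSq (flowMetric ω₀ θ η f γ φ t S'.chart (S'.chart x))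
        (S'.covector (S'.chart x))) - N * S'.cutoff (S'.chart x)) := by
    have hN4 : N * S'.cutoff (S'.chart x) ≤ N * (1 / 4) := mul_le_mul_of_nonneg_left d2 hN0
    have := mul_le_mul_of_nonneg_left (show Real.log y - Real.log C - N ≤ S'.weight ε (S'.chart x) +
      Real.log (formNormSq (flowMetric ω₀ θ η f γ φ t S'.chart (S'.chart x))
        (S'.covector (S'.chart x))) - N * S'.cutoff (S'.chart x) by linarith) hm0
    linarith
  have hτ0 : 0 ≤ t - t₀ := sub_nonneg.2 htt.le
  have hτT : t - t₀ ≤ T := by linarith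
  have r3 := mul_le_mul_of_nonneg_left r1 hτ0
  have r4 := mul_le_mul_of_nonneg_left r2 hτ0
  have r5 : (t - t₀) * (Real.log n + K₃ + m * Real.log B + m * (Real.log C + N)) ≤ T * K₄ :=
    (mul_le_mul_of_nonneg_left (le_abs_self _) hτ0).trans
      (mul_le_mul_of_nonneg_right hτT (abs_nonneg _))
  -- The potential at time `t` and, in `o2`, at the time `t₁` of the maximum are both referred to
  -- `t₀`, so that their difference is an oscillation at `t₀`. Here `kχ ≥ 0` is dropped on the left
  -- and `kχ ≤ kB` is inserted on the right.
  have o1 : φ t x - k * chi σ γ ε x ≤ u x'' + (K₁ * T + k * B) := by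
    have e1 : (Real.log ((B * n) ^ n) + B + Real.log (1 + B)) * (t - t₀) ≤ K₁ * T :=
      (mul_le_mul_of_nonneg_right (le_abs_self _) hτ0).trans
        (mul_le_mul_of_nonneg_left hτT (abs_nonneg _))
    have e2 := mul_nonneg hb.k_pos.le (hb.chi_nonneg ε hε x)
    have e3 := mul_le_mul_of_nonneg_left (hb.chi_le ε hε x'') hb.k_pos.le
    simp only [hu]
    linarith
  have o2 : -(φ t₁ (S.chart.symm z₁) - k * chi σ γ ε (S.chart.symm z₁)) ≤ -u x' + K₂ * T := by
    have e1 : K₃ * (t₁ - t₀) ≤ K₂ * T :=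
      (mul_le_mul_of_nonneg_right (le_abs_self _) (sub_nonneg.2 ht₁.1)).trans
        (mul_le_mul_of_nonneg_left (by linarith [ht₁.2]) (abs_nonneg _))
    simp only [hu]
    linarith
  have hA0 : 0 ≤ A := by linarith
  have o3 := mul_le_mul_of_nonneg_left o1 hA0
  have o4 := mul_le_mul_of_nonneg_left o2 hA0
  have o5 := mul_le_mul_of_nonneg_left (sub_le_osc huc x'' x') hA0
  linarith

end ConicalFlow

end ConicalKRF

end

/-! ### The proposition. -/

theorem proposition0229011 {n : ℕ} {X : Type*} [TopologicalSpace X] [T2Space X] [CompactSpace X]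
    [ChartedSpace (Cn n) X] [IsManifold 𝓘(ℂ, Cn n) ω X]
    -- the Kähler form, the smooth divisor, its line bundle, defining section and Hermitian metric
    (ω₀ : Coeff n X) (hω₀ : IsKahler ω₀) (D : Set X)
    {L : X → Type*} [∀ x, AddCommGroup (L x)] [∀ x, Module ℂ (L x)] [∀ x, TopologicalSpace (L x)]
    [TopologicalSpace (Bundle.TotalSpace ℂ L)] [FiberBundle ℂ L] [VectorBundle ℂ ℂ L]
    [ContMDiffVectorBundle ω ℂ L 𝓘(ℂ, Cn n)]
    (s : ContMDiffSection 𝓘(ℂ, Cn n) ℂ ω L) (hs : IsDefiningSection n s D)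
    (h : HermitianMetric n L)
    (η : Coeff n X) (hη : IsForm η) (hη_closed : IsClosedForm η)
    (γ : ℝ) (hγ : γ ∈ Set.Ioo (0 : ℝ) 1)
    (T : ℝ) (hT : 0 < T) (hT_max : (T : EReal) < maxTime ω₀ h.curvature η γ)
    -- the smooth volume form `e^{-f} ω₀ⁿ`, chosen such that `ω₀ + tν > 0` on `[0,T]`
    (f : X → ℝ) (hf : ContMDiff 𝓘(ℝ, Cn n) 𝓘(ℝ, ℝ) ∞ f)
    (hf_pos : ∀ t ∈ Set.Icc 0 T, IsPositive (ω₀ + t • nu ω₀ h.curvature η f γ)) :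
    ∃ k₀ > 0, ∀ k ∈ Set.Ioc (0 : ℝ) k₀,
      (∀ ε ∈ Set.Ioo (0 : ℝ) 1,
        IsPositive (coneApprox ω₀ (fun x => h.normSq x (s x)) k γ ε)) ∧
      ∀ M : ℝ,
      ∃ C₁ : ℝ, ∀ t₀ T' : ℝ, 0 < t₀ → t₀ < T' → T' < T →
        ∃ C₂ : ℝ, ∀ (φ₀ : X → EReal) (ψ : ℕ → X → ℝ), IsOmegaPSH ω₀ φ₀ →
          (∀ x, lelongNumber n φ₀ x = 0) → (⨆ x, φ₀ x) = (M : EReal) → IsSmoothApprox ω₀ φ₀ ψ →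
          ∀ (j : ℕ), ∀ ε ∈ Set.Ioo (0 : ℝ) 1, ∀ φ : ℝ → X → ℝ,
            IsFlow ω₀ (nu ω₀ h.curvature η f γ) f (fun x => h.normSq x (s x)) γ ε T (ψ j) φ →
            ∀ t ∈ Set.Ioc t₀ T', ∀ x,
              (t - t₀) * Real.log (traceForm
                  (coneApprox ω₀ (fun x => h.normSq x (s x)) k γ ε)
                  (evolvingForm ω₀ (nu ω₀ h.curvature η f γ) t (φ t)) x)
                ≤ C₁ * osc (fun y => φ t₀ y - k * chi (fun x => h.normSq x (s x)) γ ε y) + C₂ := by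
  have hd := hs.isDivisorNorm h s
  have hfc := chartSmooth_of_contMDiff hf
  have hν : IsForm (nu ω₀ h.curvature η f γ) := isForm_nu hω₀.isForm hω₀.pos hfc hd.isForm hη
  obtain ⟨k₀, hk₀, hk⟩ :=
    exists_flowBounds hd hω₀.isForm hω₀.pos hν hfc hγ hT (hf_pos T ⟨hT.le, le_rfl⟩)
  refine ⟨k₀, hk₀, fun k hkk => ?_⟩
  obtain ⟨b, B, hb⟩ := hk k hkk
  refine ⟨fun ε hε => hb.isPositive_coneApprox hT.le hd hω₀.pos hε, fun M => ?_⟩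
  rcases Nat.eq_zero_or_pos n with rfl | hn
  -- In dimension zero the trace is an empty sum, and the logarithm of `0` is `0` by convention.
  · refine ⟨0, fun t₀ T' _ _ _ => ⟨0, ?_⟩⟩
    intro φ₀ ψ _ _ _ _ j ε _ φ _ t _ x
    simp [traceForm, Matrix.trace]
  · obtain ⟨C₁, C₂, hC⟩ := ConicalFlow.exists_trace_estimate hn hT hb hω₀ hd hη hγ
    -- The constants of the trace estimate depend only on the data on the whole interval `[0,T]`, so
    -- one pair serves all `t₀` and `T'`.
    refine ⟨C₁, fun t₀ T' ht₀ _ hT' => ⟨C₂, ?_⟩⟩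
    intro φ₀ ψ _ _ _ _ j ε hε φ hφ t ht x
    exact hC ε (ψ j) φ ⟨hω₀, hd, hη, hη_closed, hfc, hγ, hε, hφ⟩ t₀ t ht₀ ht.1
      (ht.2.trans_lt hT') x
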